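/- Let $M\subset\mathbb C^n$ ($n\ge 1$) be an open set with flat coordinates $t=(t^1,\dots,t^n)$ carrying a holomorphic Frobenius structure, i.e. a holomorphic function $F$ on $M$, a constant symmetric nondegenerate matrix $(\eta_{\alpha\beta})$ with inverse $(\eta^{\alpha\beta})$, and constants $q_\alpha,r_\alpha,d,A_{\alpha\beta}=A_{\beta\alpha},B_\alpha,C\in\mathbb C$ such that (with summation over repeated indices) $$\partial_\alpha\partial_\beta\partial_\lambda F\,\eta^{\lambda\mu}\,\partial_\mu\partial_\gamma\partial_\delta F=\partial_\delta\partial_\beta\partial_\lambda F\,\eta^{\lambda\mu}\,\partial_\mu\partial_\gamma\partial_\alpha F,\qquad \partial_1\partial_\alpha\partial_\beta F=\eta_{\alpha\beta},$$ $$\sum_\alpha[(1-q_\alpha)t^\alpha+r_\alpha]\,\partial_\alpha F=(3-d)F+\tfrac12 A_{\alpha\beta}t^\alpha t^\beta+B_\alpha t^\alpha+C,$$ where $q_1=0$; $r_\alpha\neq0$ only if $q_\alpha=1$; $A_{\alpha\beta}\ne0$ only if $q_\alpha+q_\beta=d-1$; $B_\alpha\neq 0$ only if $q_\alpha=d-2$;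 $C\ne0$ only if $d=3$; $A_{1\alpha}=\sum_\varepsilon\eta_{\alpha\varepsilon}r_\varepsilon$; $B_1=0$. Write $c^\alpha_{\beta\gamma\ldots}=\eta^{\alpha\varepsilon}\partial_\varepsilon\partial_\beta\partial_\gamma\cdots F$, $\langle\partial_\alpha,\partial_\beta\rangle=\eta_{\alpha\beta}$, $\partial_\alpha\cdot\partial_\beta=c^\gamma_{\alpha\beta}(t)\,\partial_\gamma$, $E=\sum_\alpha[(1-q_\alpha)t^\alpha+r_\alpha]\partial_\alpha$ and $\mu_\alpha=q_\alpha-\frac d2$. Assume that $M$ is semisimple: the set $M_{ss}$ of the points $t\in M$ at which the algebra $(T_tM,\cdot)$ is semisimple (isomorphic to $\mathbb C^n$) is dense in $M$. On an open set $U\subset M_{ss}$, canonical coordinates are holomorphic functions $u_1,\dots,u_n$ with invertible Jacobian matrix, with $\frac{\partial}{\partial u_i}\cdot\frac{\partial}{\partial u_j}=\delta_{ij}\frac{\partial}{\partial u_i}$ and $E=\sum_i u_i\frac{\partial}{\partial u_i}$. Put $\eta_{ii}=\langle\frac{\partial}{\partial u_i},\frac{\partial}{\partial u_i}\rangle$,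 $\psi_{i\alpha}=\eta_{ii}^{-1/2}\,\eta_{\alpha\beta}\frac{\partial t^\beta}{\partial u_i}$, $\psi_j^\alpha=\psi_{j\gamma}\eta^{\gamma\alpha}$, $V_{ij}=\sum_\alpha\mu_\alpha\psi_{i\alpha}\psi_j^\alpha$ and $H_i=\frac12\sum_{j\ne i}\frac{V_{ij}^2}{u_i-u_j}$ (a summand is $0$ where $u_i=u_j$; it extends holomorphically by this value). An isomonodromic tau-function is a nowhere vanishing holomorphic function $\tau_I$ on $U$ with $d\log\tau_I=\sum_iH_i\,du_i$. Let $J=\det\left(\frac{\partial t^\alpha}{\partial u_i}\right)$. Getzler's system for a holomorphic function $G$ is the requirement that $$\sum_{\alpha_1,\dots,\alpha_4} z_{\alpha_1}z_{\alpha_2}z_{\alpha_3}z_{\alpha_4}\Big(3c^\mu_{\alpha_1\alpha_2}c^\nu_{\alpha_3\alpha_4}\tfrac{\partial^2G}{\partial t^\mu\partial t^\nu}-4c^\mu_{\alpha_1\alpha_2}c^\nu_{\alpha_3\mu}\tfrac{\partial^2G}{\partial t^{\alpha_4}\partial t^\nu}-c^\mu_{\alpha_1\alpha_2}c^\nu_{\alpha_3\alpha_4\mu}\tfrac{\partial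 G}{\partial t^\nu}+2c^\mu_{\alpha_1\alpha_2\alpha_3}c^\nu_{\alpha_4\mu}\tfrac{\partial G}{\partial t^\nu}$$ $$+\tfrac16c^\mu_{\alpha_1\alpha_2\alpha_3}c^\nu_{\alpha_4\mu\nu}+\tfrac1{24}c^\mu_{\alpha_1\alpha_2\alpha_3\alpha_4}c^\nu_{\mu\nu}-\tfrac14c^\mu_{\alpha_1\alpha_2\nu}c^\nu_{\alpha_3\alpha_4\mu}\Big)=0$$ identically in $z_1,\dots,z_n$, at every point. By a solution $G=G(t^2,\dots,t^n)$ on $U$ we mean a holomorphic $G$ on $U$ satisfying this system and $\partial G/\partial t^1=0$. **Theorem.** (1) On every simply connected open $U\subset M_{ss}$ there exist canonical coordinates, a tau-function $\tau_I$, a holomorphic branch of $J^{1/24}$, and a solution $G=G(t^2,\dots,t^n)$ of Getzler's system with ${\cal L}_EG=\gamma$, where $$\gamma=-\frac14\sum_{\alpha=1}^n\mu_\alpha^2+\frac{nd}{48},$$ given by $G=\log\frac{\tau_I}{J^{1/24}}$ (that is, $e^G=\tau_I/J^{1/24}$). (2) Let $U\subset M_{ss}$ be a nonempty connected open set. If a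 solution $G=G(t^2,\dots,t^n)$ on $U$ satisfies ${\cal L}_EG=\gamma'$ for some constant $\gamma'$, then $\gamma'=\gamma$, with $\gamma$ as in (1); any two solutions on $U$, each satisfying a condition of this form, differ by an additive constant; and whenever canonical coordinates, a tau-function $\tau_I$ and a holomorphic branch of $J^{1/24}$ are given on $U$, a holomorphic function $G$ on $U$ is a solution with ${\cal L}_EG$ constant if and only if $e^G=k\,\tau_I/J^{1/24}$ for some constant $k\ne0$. -/

import Mathlib

noncomputable section

/-- The partial derivative `∂f/∂t^α` of a function on `ℂⁿ`. -/
def partialD {n : ℕ} (α : Fin n) (f : (Fin n → ℂ) → ℂ) : (Fin n → ℂ) → ℂ :=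
  fun t => fderiv ℂ f t (Pi.single α 1)

/-- An `n`-dimensional (complex analytic) Frobenius manifold in flat coordinates, that is, a
solution of the WDVV associativity equations on an open set of `ℂⁿ`.  The index `0 : Fin n` is
the distinguished direction, so that `∂₀` is the unit vector field.  `η` is the matrix of the flat
metric with lower indices; its inverse `η⁻¹` has the upper indices. -/
structure FrobeniusManifold (n : ℕ) [NeZero n] where
  domain : Set (Fin n → ℂ)
  isOpen_domain : IsOpen domain
  /-- the potential (free energy) -/
  F : (Fin n → ℂ) → ℂ
  analytic_F : AnalyticOnNhd ℂ F domain
  η : Matrix (Fin n) (Fin n) ℂ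
  η_symm : η.IsSymm
  η_nondeg : IsUnit η.det
  q : Fin n → ℂ
  r : Fin n → ℂ
  d : ℂ
  A : Matrix (Fin n) (Fin n) ℂ
  B : Fin n → ℂ
  C : ℂ
  /-- associativity -/
  wdvv : ∀ t ∈ domain, ∀ α β γ δ : Fin n,
    ∑ l, ∑ m, partialD α (partialD β (partialD l F)) t * η⁻¹ l m *
        partialD m (partialD γ (partialD δ F)) t =
      ∑ l, ∑ m, partialD δ (partialD β (partialD l F)) t * η⁻¹ l m *
        partialD m (partialD γ (partialD α F)) t
  /-- normalization: `∂₀` is the unit and the metric is constant -/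
  unit : ∀ t ∈ domain, ∀ α β : Fin n,
    partialD 0 (partialD α (partialD β F)) t = η α β
  /-- quasihomogeneity -/
  quasihom : ∀ t ∈ domain,
    ∑ α, ((1 - q α) * t α + r α) * partialD α F t =
      (3 - d) * F t + (1 / 2) * ∑ α, ∑ β, A α β * t α * t β + ∑ α, B α * t α + C
  q_zero : q 0 = 0
  r_ne : ∀ α, r α ≠ 0 → q α = 1
  A_symm : A.IsSymm
  A_ne : ∀ α β, A α β ≠ 0 → q α + q β = d - 1
  B_ne : ∀ α, B α ≠ 0 → q α = d - 2
  C_ne : C ≠ 0 → d = 3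
  A_zero : ∀ α, A 0 α = ∑ ε, η α ε * r ε
  B_zero : B 0 = 0

namespace FrobeniusManifold

variable {n : ℕ} [NeZero n] (M : FrobeniusManifold n)

/-- `c^α_{βγ} = η^{αε} ∂_ε∂_β∂_γ F`. -/
def c3 (α β γ : Fin n) (t : Fin n → ℂ) : ℂ :=
  ∑ ε, M.η⁻¹ α ε * partialD ε (partialD β (partialD γ M.F)) t

/-- `c^α_{βγδ} = η^{αε} ∂_ε∂_β∂_γ∂_δ F`. -/
def c4 (α β γ δ : Fin n) (t : Fin n → ℂ) : ℂ :=
  ∑ ε, M.η⁻¹ α ε * partialD ε (partialD β (partialD γ (partialD δ M.F))) t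

/-- `c^α_{βγδσ} = η^{αε} ∂_ε∂_β∂_γ∂_δ∂_σ F`. -/
def c5 (α β γ δ σ : Fin n) (t : Fin n → ℂ) : ℂ :=
  ∑ ε, M.η⁻¹ α ε * partialD ε (partialD β (partialD γ (partialD δ (partialD σ M.F)))) t

/-- The product of tangent vectors at `t`: `∂_α · ∂_β = c^γ_{αβ}(t) ∂_γ`. -/
def mul (t x y : Fin n → ℂ) : Fin n → ℂ :=
  fun γ => ∑ α, ∑ β, M.c3 γ α β t * x α * y β

/-- The flat metric `⟨x, y⟩ = η_{αβ} x^α y^β`. -/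
def metric (x y : Fin n → ℂ) : ℂ := ∑ α, ∑ β, M.η α β * x α * y β

/-- The Euler vector field `E^α(t) = (1 - q_α) t^α + r_α`. -/
def euler (t : Fin n → ℂ) : Fin n → ℂ := fun α => (1 - M.q α) * t α + M.r α

/-- The eigenvalues `μ_α = q_α - d/2`. -/
def mu (α : Fin n) : ℂ := M.q α - M.d / 2

/-- The points `t` of `M` where the tangent algebra `A_t` is semisimple, that is, isomorphic to the
algebra `ℂⁿ` with componentwise multiplication (a finite-dimensional commutative `ℂ`-algebra is
semisimple exactly if it is a product of copies of `ℂ`). -/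
def semisimpleLocus : Set (Fin n → ℂ) :=
  {t | t ∈ M.domain ∧ ∃ φ : (Fin n → ℂ) ≃ₗ[ℂ] (Fin n → ℂ), ∀ x y, φ (M.mul t x y) = φ x * φ y}

/-- The semisimplicity condition: the algebras `A_t` are semisimple for generic `t`. -/
def IsSemisimple : Prop := M.domain ⊆ closure M.semisimpleLocus

/-- The Jacobian matrix `(∂u_i/∂t^α)_{i,α}`. -/
def jac (u : (Fin n → ℂ) → Fin n → ℂ) (t : Fin n → ℂ) : Matrix (Fin n) (Fin n) ℂ :=
  Matrix.of fun i α => partialD α (fun s => u s i) t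

/-- The vector field `∂/∂u_i`, with components `∂t^α/∂u_i`. -/
def frame (u : (Fin n → ℂ) → Fin n → ℂ) (i : Fin n) (t : Fin n → ℂ) : Fin n → ℂ :=
  fun α => (jac u t)⁻¹ α i

/-- `J = det (∂t^α/∂u_i)`. -/
def jacobian (u : (Fin n → ℂ) → Fin n → ℂ) (t : Fin n → ℂ) : ℂ :=
  (Matrix.of fun α i => frame u i t α : Matrix (Fin n) (Fin n) ℂ).det

/-- Canonical coordinates `u_1, …, u_n` on `U`: holomorphic functions with invertible Jacobian
matrix, such that `∂/∂u_i · ∂/∂u_j = δ_ij ∂/∂u_i`.  The additive constants are fixed by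
`E = ∑ u_i ∂/∂u_i`, that is, the `u_i` are the eigenvalues of the multiplication by `E`. -/
structure IsCanonical (u : (Fin n → ℂ) → Fin n → ℂ) (U : Set (Fin n → ℂ)) : Prop where
  analytic : ∀ i, AnalyticOnNhd ℂ (fun t => u t i) U
  det_ne_zero : ∀ t ∈ U, (jac u t).det ≠ 0
  mul_frame : ∀ t ∈ U, ∀ i j,
    M.mul t (frame u i t) (frame u j t) = if i = j then frame u i t else 0
  euler_eq : ∀ t ∈ U, M.euler t = ∑ i, u t i • frame u i t

/-- `ψ_{iα} = ∂_i t_α / √η_ii`, where `t_α = η_{αβ} t^β` and `η_ii = ⟨∂/∂u_i, ∂/∂u_i⟩`.  The choice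
of the sign of the square root does not matter below, since only the squares `V_ij²` are used. -/
def psi (u : (Fin n → ℂ) → Fin n → ℂ) (i α : Fin n) (t : Fin n → ℂ) : ℂ :=
  (∑ β, M.η α β * frame u i t β) / (M.metric (frame u i t) (frame u i t)) ^ (1 / 2 : ℂ)

/-- `V_ij = ∑_α μ_α ψ_{iα} ψ_j^α`, where `ψ_j^α = ψ_{jγ} η^{γα}`. -/
def V (u : (Fin n → ℂ) → Fin n → ℂ) (i j : Fin n) (t : Fin n → ℂ) : ℂ :=
  ∑ α, M.mu α * M.psi u i α t * ∑ γ, M.psi u j γ t * M.η⁻¹ γ α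

/-- The Hamiltonians `H_i = (1/2) ∑_{j ≠ i} V_ij² / (u_i - u_j)`.  At a point where `u_i = u_j` for
some `j ≠ i` one has `V_ij = 0`, and the summand (which is `γ_ij² (u_i - u_j)` with holomorphic
rotation coefficients `γ_ij²`) has the value `0`, as `0 / 0 = 0` here. -/
def H (u : (Fin n → ℂ) → Fin n → ℂ) (i : Fin n) (t : Fin n → ℂ) : ℂ :=
  (1 / 2) * ∑ j ∈ Finset.univ.erase i, M.V u i j t ^ 2 / (u t i - u t j)

/-- `τ` is an isomonodromic tau-function on `U`: a holomorphic function without zeros with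
`d log τ = ∑ H_i du_i`. -/
structure IsTau (u : (Fin n → ℂ) → Fin n → ℂ) (τ : (Fin n → ℂ) → ℂ) (U : Set (Fin n → ℂ)) :
    Prop where
  analytic : AnalyticOnNhd ℂ τ U
  ne_zero : ∀ t ∈ U, τ t ≠ 0
  dlog : ∀ t ∈ U, ∀ α, partialD α τ t / τ t = ∑ i, M.H u i t * partialD α (fun s => u s i) t

/-- `j` is a holomorphic branch of `J^{1/24}` on `U`. -/
structure IsJacobianRoot (u : (Fin n → ℂ) → Fin n → ℂ) (j : (Fin n → ℂ) → ℂ)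
    (U : Set (Fin n → ℂ)) : Prop where
  analytic : AnalyticOnNhd ℂ j U
  pow_eq : ∀ t ∈ U, j t ^ 24 = jacobian u t

/-- The left-hand side of Getzler's system at the point `t`, a quartic polynomial in `z`. -/
def getzlerPoly (G : (Fin n → ℂ) → ℂ) (t z : Fin n → ℂ) : ℂ :=
  ∑ a₁, ∑ a₂, ∑ a₃, ∑ a₄, z a₁ * z a₂ * z a₃ * z a₄ * ∑ m, ∑ v,
    (3 * M.c3 m a₁ a₂ t * M.c3 v a₃ a₄ t * partialD m (partialD v G) t
      - 4 * M.c3 m a₁ a₂ t * M.c3 v a₃ m t * partialD a₄ (partialD v G) t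
      - M.c3 m a₁ a₂ t * M.c4 v a₃ a₄ m t * partialD v G t
      + 2 * M.c4 m a₁ a₂ a₃ t * M.c3 v a₄ m t * partialD v G t
      + (1 / 6) * M.c4 m a₁ a₂ a₃ t * M.c4 v a₄ m v t
      + (1 / 24) * M.c5 m a₁ a₂ a₃ a₄ t * M.c3 v m v t
      - (1 / 4) * M.c4 m a₁ a₂ v t * M.c4 v a₃ a₄ m t)

/-- `G` is a holomorphic solution of Getzler's system on `U` that does not depend on the first
coordinate, `G = G(t², …, tⁿ)`. -/
structure IsGetzlerSolution (G : (Fin n → ℂ) → ℂ) (U : Set (Fin n → ℂ)) : Prop where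
  analytic : AnalyticOnNhd ℂ G U
  indep : ∀ t ∈ U, partialD 0 G t = 0
  getzler : ∀ t ∈ U, ∀ z : Fin n → ℂ, M.getzlerPoly G t z = 0

/-- The quasihomogeneity condition `L_E G = γ` on `U`, with a constant `γ`. -/
def HasAnomaly (G : (Fin n → ℂ) → ℂ) (γ : ℂ) (U : Set (Fin n → ℂ)) : Prop :=
  ∀ t ∈ U, ∑ α, M.euler t α * partialD α G t = γ

/-- `-(1/4) ∑ μ_α² + n d / 48`. -/
def anomaly : ℂ := -(1 / 4) * ∑ α, M.mu α ^ 2 + n * M.d / 48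

end FrobeniusManifold

end

/-!
On the semisimple locus the tangent algebras are spanned by orthogonal idempotents `π_i`, with dual
covectors `p_i = du_i`.  Written in this frame, Getzler's system becomes a prescription of the
mixed second derivatives of `G`, and the proof consists in comparing them with those of
`log (τ / J^{1/24})`.

*Algebra.*  Everything but existence of the frame and of primitives is algebra over a commutative
ring `R` with commuting derivations `∂_a` (`IdempotentFrame`, `ConformalFrame`); later `R` is the
ring of holomorphic functions on an open set.  The third derivatives of the potential are
`∑ η_ii p_i p_i p_i` (`IdempotentFrame.F3_eq`).  The components of the fourth derivatives along
the idempotents vanish for three different indices, and in all are given by a symmetric matrix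
`g_ij = γ_ij √(η_ii η_jj)` of rotation coefficients, which are thereby defined without choosing
square roots.  The same matrix governs the derivatives of `p_i` and of `η_ii`
(`IdempotentFrame.D_covec`, `IdempotentFrame.D_len`).  For a constant vector `z` and `Z_i = p_i(z)`
the contraction of the fourth derivatives with `z` is `½ ∑ g_ij (Z_i - Z_j)^4`.  With these formulas
Getzler's polynomial at a `G` with `∂_0 G = 0` turns into
`½ ∑_ij (π_i π_j G - K_ij) (Z_i - Z_j)^4` (`IdempotentFrame.getzler_eq`), with `48 K_ij` given
explicitly in terms of `g` (`IdempotentFrame.hess`).  Such a quartic vanishes for all `Z` only if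
its coefficients off the diagonal vanish (`eq_zero_of_sum_quartic`), so that Getzler's system says
that `π_i π_j G = K_ij` for `i ≠ j`.

*The Euler field.*  Quasihomogeneity determines the Lie derivatives of `p_i` and `η_ii`.  Hence
`u_i = p_i(E)` is a primitive of `p_i`, the Hamiltonians `H_i = ½ ∑_j (u_i - u_j) γ_ij²` form a
closed form, and `∑ u_i H_i = -¼ ∑ μ_α²`; further `E log J = -nd/2`
(`ConformalFrame.sum_u_ham`, `ConformalFrame.sum_u_logJac`).  The form `H_i - (1/24) π_i log J` has
the mixed derivatives `K_ij` (`ConformalFrame.del_sol`).  If `G` is another solution, the difference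
`X_i` between `π_i G` and that form satisfies `π_j X_i = 0` for `j ≠ i` and `∑ X_i = 0`, so that all
`X_i` are constant; and applying `π_i` to the constant `∑ u_j X_j` gives `X_i = 0`
(`ConformalFrame.del_eq_sol`).  This is the uniqueness, and it determines the anomaly.

*Analysis.*  By the implicit function theorem the idempotents at a point extend to analytic fields
(`FrobeniusManifold.exists_idempotent_germ`).  On a simply connected set a multivalued function has
a single-valued branch, by lifting to a covering space (`exists_global_branch`); applied to the
idempotents this orders them consistently (`FrobeniusManifold.exists_global_frame`), and applied to
local primitives it integrates closed forms (`exists_primitive`).  The logarithms of `τ` and `J`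
are found in this way, and holomorphic functions without zeros are compared through their
logarithmic derivatives (`exists_eq_const_mul_iff`).
-/

noncomputable section

/-! ### Frames of orthogonal idempotents -/

/-- The contraction `∑ x^a f_a`. -/
def pairing {n : ℕ} {R : Type*} [CommRing R] (x f : Fin n → R) : R := ∑ a, x a * f a

namespace pairing

variable {n : ℕ} {R : Type*} [CommRing R] (x : Fin n → R)

theorem add (f g : Fin n → R) :
    pairing x (fun a => f a + g a) = pairing x f + pairing x g := by
  simp [pairing, mul_add, Finset.sum_add_distrib]

theorem sub (f g : Fin n → R) :
    pairing x (fun a => f a - g a) = pairing x f - pairing x g := by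
  simp [pairing, mul_sub, Finset.sum_sub_distrib]

theorem mul_const (f : Fin n → R) (r : R) :
    pairing x (fun a => f a * r) = pairing x f * r := by
  simp [pairing, Finset.sum_mul, mul_assoc]

theorem const_mul (f : Fin n → R) (r : R) :
    pairing x (fun a => r * f a) = r * pairing x f := by
  simp only [pairing, Finset.mul_sum]
  exact Finset.sum_congr rfl fun _ _ => by ring

theorem sum {κ : Type*} (s : Finset κ) (f : κ → Fin n → R) :
    pairing x (fun a => ∑ y ∈ s, f y a) = ∑ y ∈ s, pairing x (f y) := by
  simp only [pairing, Finset.mul_sum]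
  exact Finset.sum_comm

theorem sum_left {κ : Type*} (s : Finset κ) (y : κ → Fin n → R) (f : Fin n → R) :
    pairing (fun a => ∑ k ∈ s, y k a) f = ∑ k ∈ s, pairing (y k) f := by
  simp only [pairing, Finset.sum_mul]
  exact Finset.sum_comm

theorem mul_const_left (f : Fin n → R) (r : R) :
    pairing (fun a => x a * r) f = pairing x f * r := by
  simp only [pairing, Finset.sum_mul]
  exact Finset.sum_congr rfl fun _ _ => by ring

theorem zero : pairing x (fun _ => 0) = 0 := by
  simp [pairing]

end pairing

/-- A solution `F` of the associativity equations over a commutative `ℂ`-algebra `R` with `n`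
commuting derivations `D a`, together with a frame of orthogonal idempotents.  The vector field
`vec i` is the `i`-th idempotent and `covec i` the dual covector field.  Condition `idem` says
`π_i · π_j = δ_ij π_i`, with the upper index of the product lowered. -/
structure IdempotentFrame (n : ℕ) [NeZero n] (R : Type*) [CommRing R] [Algebra ℂ R] where
  D : Fin n → Derivation ℂ R R
  D_comm : ∀ a b f, D a (D b f) = D b (D a f)
  F : R
  η : Matrix (Fin n) (Fin n) ℂ
  η_symm : η.IsSymm
  η_nondeg : IsUnit η.det
  unit : ∀ a b, D 0 (D a (D b F)) = algebraMap ℂ R (η a b)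
  vec : Fin n → Fin n → R
  covec : Fin n → Fin n → R
  covec_vec : ∀ i j, ∑ a, covec i a * vec j a = if i = j then 1 else 0
  vec_covec : ∀ a b, ∑ i, vec i a * covec i b = if a = b then 1 else 0
  idem : ∀ i j d, ∑ a, ∑ b, D d (D a (D b F)) * vec i a * vec j b =
    if i = j then ∑ b, algebraMap ℂ R (η d b) * vec i b else 0

namespace IdempotentFrame

variable {n : ℕ} [NeZero n] {R : Type*} [CommRing R] [Algebra ℂ R] (Φ : IdempotentFrame n R)

/-- The component of a covector along the `k`-th idempotent. -/
def comp (k : Fin n) (f : Fin n → R) : R := pairing (Φ.vec k) f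

theorem comp_add (k) (f g : Fin n → R) :
    Φ.comp k (fun a => f a + g a) = Φ.comp k f + Φ.comp k g := pairing.add _ _ _

theorem comp_sub (k) (f g : Fin n → R) :
    Φ.comp k (fun a => f a - g a) = Φ.comp k f - Φ.comp k g := pairing.sub _ _ _

theorem comp_zero (k) : Φ.comp k (fun _ => 0) = 0 := pairing.zero _

theorem comp_mul_const (k) (f : Fin n → R) (r : R) :
    Φ.comp k (fun a => f a * r) = Φ.comp k f * r := pairing.mul_const _ _ _

theorem comp_const_mul (k) (f : Fin n → R) (r : R) :
    Φ.comp k (fun a => r * f a) = r * Φ.comp k f := pairing.const_mul _ _ _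

theorem comp_sum {κ : Type*} (s : Finset κ) (k) (f : κ → Fin n → R) :
    Φ.comp k (fun a => ∑ x ∈ s, f x a) = ∑ x ∈ s, Φ.comp k (f x) := pairing.sum _ _ _

theorem comp_covec (k i) : Φ.comp k (fun a => Φ.covec i a) = if i = k then 1 else 0 := by
  rw [← Φ.covec_vec, comp, pairing]
  exact Finset.sum_congr rfl fun _ _ => mul_comm _ _

theorem comp_swap (k l) (f : Fin n → Fin n → R) :
    (Φ.comp k fun a => Φ.comp l fun b => f a b) = Φ.comp l fun b => Φ.comp k fun a => f a b := by
  simp only [comp, pairing, Finset.mul_sum]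
  rw [Finset.sum_comm]
  exact Finset.sum_congr rfl fun _ _ => Finset.sum_congr rfl fun _ _ => by ring

/-- A covector is determined by its components along the idempotents. -/
theorem sum_covec_comp (f : Fin n → R) (a) : ∑ k, Φ.covec k a * Φ.comp k f = f a := by
  simp only [comp, pairing, Finset.mul_sum]
  rw [Finset.sum_comm]
  calc _ = ∑ b, (∑ k, Φ.vec k b * Φ.covec k a) * f b := by
        refine Finset.sum_congr rfl fun b _ => ?_
        rw [Finset.sum_mul]
        exact Finset.sum_congr rfl fun _ _ => by ring
    _ = f a := by simp [Φ.vec_covec]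

theorem covector_ext {f g : Fin n → R} (h : ∀ k, Φ.comp k f = Φ.comp k g) (a) : f a = g a := by
  rw [← Φ.sum_covec_comp f, ← Φ.sum_covec_comp g]
  simp [h]

theorem covector_ext₂ {f g : Fin n → Fin n → R}
    (h : ∀ k l, (Φ.comp k fun a => Φ.comp l fun b => f a b) =
      Φ.comp k fun a => Φ.comp l fun b => g a b) (a b) : f a b = g a b := by
  refine Φ.covector_ext (f := f a) (g := g a) (fun l => ?_) b
  exact Φ.covector_ext (f := fun a => Φ.comp l fun b => f a b)
    (g := fun a => Φ.comp l fun b => g a b) (fun k => h k l) a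

/-- The lowered vector `η π_i`. -/
def low (i d : Fin n) : R := ∑ b, algebraMap ℂ R (Φ.η d b) * Φ.vec i b

/-- The square length `η_ii` of the `i`-th idempotent. -/
def len (i : Fin n) : R := Φ.comp i (Φ.low i)

/-- Third derivatives of the potential. -/
def F3 (a b c : Fin n) : R := Φ.D a (Φ.D b (Φ.D c Φ.F))

theorem F3_swap₁ (a b c) : Φ.F3 a b c = Φ.F3 b a c := Φ.D_comm _ _ _
theorem F3_swap₂ (a b c) : Φ.F3 a b c = Φ.F3 a c b := by
  unfold F3; rw [Φ.D_comm b c]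

theorem comp_comp_F3 (i j d) :
    (Φ.comp i fun a => Φ.comp j fun b => Φ.F3 d a b) = if i = j then Φ.low i d else 0 := by
  have := Φ.idem i j d
  simp only [low]
  rw [← this]
  simp only [comp, pairing, Finset.mul_sum]
  exact Finset.sum_congr rfl fun _ _ => Finset.sum_congr rfl fun _ _ => by rw [F3]; ring

/-- The idempotents are orthogonal for the metric, as `⟨x · y, z⟩` is symmetric. -/
theorem comp_low (i j) : Φ.comp i (Φ.low j) = if j = i then Φ.len i else 0 := by
  have h1 : (Φ.comp i fun d => Φ.comp j fun a => Φ.comp j fun b => Φ.F3 d a b)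
      = Φ.comp i (Φ.low j) := by simp [comp_comp_F3]
  have h2 : (Φ.comp i fun d => Φ.comp j fun a => Φ.comp j fun b => Φ.F3 d a b)
      = Φ.comp j fun d => if i = j then Φ.low i d else 0 := by
    simp only [← comp_comp_F3]
    rw [comp_swap]
    exact congr_arg _ (funext fun a => congr_arg _ (funext fun d => congr_arg _ (funext fun b =>
      Φ.F3_swap₁ _ _ _)))
  rw [← h1, h2]
  by_cases h : i = j
  · subst h; simp [len]
  · simp [h, Ne.symm h, comp_zero]

theorem low_eq (i d) : Φ.low i d = Φ.len i * Φ.covec i d := by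
  refine Φ.covector_ext (f := Φ.low i) (g := fun d => Φ.len i * Φ.covec i d) (fun k => ?_) d
  rw [comp_low, comp_const_mul, comp_covec]
  by_cases h : i = k
  · subst h; simp
  · simp [h]

theorem F3_eq (a b c) : Φ.F3 a b c = ∑ i, Φ.len i * (Φ.covec i a * Φ.covec i b * Φ.covec i c) := by
  have : ∀ b c, Φ.F3 a b c = ∑ i, Φ.len i * Φ.covec i a * Φ.covec i b * Φ.covec i c := by
    refine Φ.covector_ext₂ fun k l => ?_
    rw [comp_comp_F3]
    simp only [comp_sum, comp_const_mul, comp_covec, comp_mul_const]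
    by_cases h : k = l
    · subst h; simp [low_eq]
    · simp [h, Ne.symm h]
  rw [this]
  exact Finset.sum_congr rfl fun _ _ => by ring

theorem metric_eq (a b) :
    algebraMap ℂ R (Φ.η a b) = ∑ i, Φ.len i * (Φ.covec i a * Φ.covec i b) := by
  refine Φ.covector_ext (f := fun b => algebraMap ℂ R (Φ.η a b))
    (g := fun b => ∑ i, Φ.len i * (Φ.covec i a * Φ.covec i b)) (fun k => ?_) b
  simp only [comp_sum, comp_const_mul, comp_covec]
  simp only [mul_ite, mul_one, mul_zero, Finset.sum_ite_eq', Finset.mem_univ, if_true]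
  rw [← low_eq, comp, pairing]
  exact Finset.sum_congr rfl fun _ _ => mul_comm _ _

/-- The inverse `1 / η_ii`, written as the square length of the covector dual to the `i`-th
idempotent. -/
def inv (i : Fin n) : R := ∑ a, ∑ b, Φ.covec i a * (algebraMap ℂ R (Φ.η⁻¹ a b) * Φ.covec i b)

theorem sum_inv_metric (a c) :
    ∑ b, algebraMap ℂ R (Φ.η⁻¹ a b) * algebraMap ℂ R (Φ.η b c) = if a = c then 1 else 0 := by
  have h : Φ.η⁻¹ * Φ.η = 1 := Matrix.nonsing_inv_mul _ Φ.η_nondeg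
  have := congr_arg (algebraMap ℂ R) (congr_fun (congr_fun h a) c)
  rw [Matrix.mul_apply, map_sum] at this
  simp only [map_mul] at this
  rw [this, Matrix.one_apply]
  split_ifs <;> simp

theorem sum_inv_low (i a) : ∑ b, algebraMap ℂ R (Φ.η⁻¹ a b) * Φ.low i b = Φ.vec i a := by
  simp only [low, Finset.mul_sum]
  rw [Finset.sum_comm]
  calc _ = ∑ c, (∑ b, algebraMap ℂ R (Φ.η⁻¹ a b) * algebraMap ℂ R (Φ.η b c)) * Φ.vec i c := by
        refine Finset.sum_congr rfl fun c _ => ?_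
        rw [Finset.sum_mul]
        exact Finset.sum_congr rfl fun _ _ => by ring
    _ = Φ.vec i a := by simp [Φ.sum_inv_metric]

theorem vec_eq (i a) :
    Φ.vec i a = Φ.len i * ∑ b, algebraMap ℂ R (Φ.η⁻¹ a b) * Φ.covec i b := by
  rw [← Φ.sum_inv_low, Finset.mul_sum]
  exact Finset.sum_congr rfl fun _ _ => by rw [low_eq]; ring

theorem len_mul_inv (i) : Φ.len i * Φ.inv i = 1 := by
  have := Φ.covec_vec i i
  rw [if_pos rfl] at this
  rw [← this, inv, Finset.mul_sum]
  refine Finset.sum_congr rfl fun a _ => ?_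
  rw [Φ.vec_eq, ← Finset.mul_sum]
  ring

theorem sum_inv_covec (i a) :
    ∑ b, algebraMap ℂ R (Φ.η⁻¹ a b) * Φ.covec i b = Φ.inv i * Φ.vec i a := by
  rw [Φ.vec_eq, ← mul_assoc, mul_comm (Φ.inv i), len_mul_inv, one_mul]

/-- The unit field `∂_0` is the sum of the idempotents. -/
theorem covec_zero (i) : Φ.covec i 0 = 1 := by
  have h := Φ.metric_eq
  have h' : ∀ b, Φ.low i b = ∑ j, Φ.len j * (Φ.covec j 0 * ((if j = i then 1 else 0) * Φ.covec j b)) := by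
    intro b
    have : Φ.low i b = Φ.comp i fun a => Φ.F3 0 a b := by
      simp only [F3, Φ.unit, low, comp, pairing]
      refine Finset.sum_congr rfl fun a _ => ?_
      rw [mul_comm, Φ.η_symm.apply]
    rw [this]
    simp only [F3_eq, mul_assoc, comp_sum, comp_const_mul, comp_mul_const, comp_covec]
  have h2 := congr_arg (Φ.comp i) (funext h')
  rw [comp_low, if_pos rfl] at h2
  simp only [comp_sum, comp_const_mul, comp_covec] at h2
  simp at h2
  have h3 := Φ.len_mul_inv i
  linear_combination (1 - Φ.covec i 0) * h3 - Φ.inv i * h2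

/-- A covector evaluated on the unit field. -/
theorem sum_comp (f : Fin n → R) : ∑ k, Φ.comp k f = f 0 := by
  rw [← Φ.sum_covec_comp f 0]
  simp [covec_zero]

end IdempotentFrame

/-! ### Rotation coefficients and the derivatives of the frame -/

namespace IdempotentFrame

variable {n : ℕ} [NeZero n] {R : Type*} [CommRing R] [Algebra ℂ R] (Φ : IdempotentFrame n R)

/-- Fourth derivatives of the potential. -/
def F4 (a b c d : Fin n) : R := Φ.D a (Φ.F3 b c d)

theorem F4_swap₁ (a b c d) : Φ.F4 a b c d = Φ.F4 b a c d := Φ.D_comm _ _ _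
theorem F4_swap₂ (a b c d) : Φ.F4 a b c d = Φ.F4 a c b d := by unfold F4; rw [Φ.F3_swap₁]
theorem F4_swap₃ (a b c d) : Φ.F4 a b c d = Φ.F4 a b d c := by unfold F4; rw [Φ.F3_swap₂]

/-- Components of the fourth derivatives of the potential along the idempotents. -/
def quartic (i j k l : Fin n) : R :=
  Φ.comp i fun a => Φ.comp j fun b => Φ.comp k fun c => Φ.comp l fun d => Φ.F4 a b c d

theorem quartic_swap₁ (i j k l) : Φ.quartic i j k l = Φ.quartic j i k l := by
  unfold quartic
  rw [comp_swap]
  simp only [fun a b c d => Φ.F4_swap₁ a b c d]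

theorem quartic_swap₂ (i j k l) : Φ.quartic i j k l = Φ.quartic i k j l := by
  unfold quartic
  refine congr_arg _ (funext fun a => ?_)
  rw [comp_swap]
  simp only [Φ.F4_swap₂ a]

theorem quartic_swap₃ (i j k l) : Φ.quartic i j k l = Φ.quartic i j l k := by
  unfold quartic
  refine congr_arg _ (funext fun a => congr_arg _ (funext fun b => ?_))
  rw [comp_swap]
  simp only [Φ.F4_swap₃ a b]

/-- The fourth derivatives of the potential vanish in the direction of the unit field, as the metric
is constant. -/
theorem sum_quartic (j k l) : ∑ i, Φ.quartic i j k l = 0 := by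
  unfold quartic
  rw [Φ.sum_comp]
  have : ∀ b c d, Φ.F4 0 b c d = 0 := by
    intro b c d
    rw [F4_swap₁]
    simp only [F4, F3, Φ.unit, Derivation.map_algebraMap]
  simp [this, comp_zero]

/-- Derivative of the covector `i` along the idempotent `w`, evaluated on the idempotent `k`. -/
def conn (w i k : Fin n) : R := Φ.comp w fun d => Φ.comp k fun a => Φ.D d (Φ.covec i a)

/-- The derivative of the constancy of the metric, in the form `metric_eq`. -/
theorem metric_conn (w j k) :
    (if j = k then Φ.comp w fun d => Φ.D d (Φ.len j) else 0) + Φ.len k * Φ.conn w k j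
      + Φ.len j * Φ.conn w j k = 0 := by
  have h : ∀ d a b, ∑ i, (Φ.D d (Φ.len i) * (Φ.covec i a * Φ.covec i b) +
      Φ.len i * (Φ.D d (Φ.covec i a) * Φ.covec i b + Φ.covec i a * Φ.D d (Φ.covec i b))) = 0 := by
    intro d a b
    rw [← Derivation.map_algebraMap (Φ.D d) (Φ.η a b), Φ.metric_eq, map_sum]
    refine Finset.sum_congr rfl fun i _ => ?_
    simp only [Derivation.leibniz, smul_eq_mul]
    ring
  have h' : (Φ.comp w fun d => Φ.comp j fun a => Φ.comp k fun b =>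
      ∑ i, (Φ.D d (Φ.len i) * (Φ.covec i a * Φ.covec i b) +
      Φ.len i * (Φ.D d (Φ.covec i a) * Φ.covec i b + Φ.covec i a * Φ.D d (Φ.covec i b)))) = 0 := by
    simp [h, comp_zero]
  simp only [comp_sum, comp_add, comp_const_mul, comp_mul_const, comp_covec] at h'
  refine Eq.trans ?_ h'
  rw [Finset.sum_add_distrib]
  simp only [mul_add, Finset.sum_add_distrib, conn, add_assoc]
  congr 1
  · by_cases hjk : j = k
    · subst hjk; simp
    · simp [hjk, Ne.symm hjk]
  · simp

/-- The fourth derivatives of the potential as derivatives of `F3_eq`. -/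
theorem quartic_conn (w j k l) :
    Φ.quartic w j k l = (if j = k ∧ k = l then Φ.comp w fun d => Φ.D d (Φ.len j) else 0)
      + ((if k = l then Φ.len k * Φ.conn w k j else 0) + (if j = l then Φ.len l * Φ.conn w l k else 0)
      + (if j = k then Φ.len j * Φ.conn w j l else 0)) := by
  have h : ∀ d a b c, Φ.F4 d a b c = ∑ i, (Φ.D d (Φ.len i) * (Φ.covec i a * Φ.covec i b * Φ.covec i c)
      + Φ.len i * (Φ.D d (Φ.covec i a) * (Φ.covec i b * Φ.covec i c)
        + Φ.covec i a * Φ.D d (Φ.covec i b) * Φ.covec i c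
        + Φ.covec i a * Φ.covec i b * Φ.D d (Φ.covec i c))) := by
    intro d a b c
    rw [F4, F3_eq, map_sum]
    refine Finset.sum_congr rfl fun i _ => ?_
    simp only [Derivation.leibniz, smul_eq_mul]
    ring
  unfold quartic
  simp only [h]
  simp only [comp_sum, comp_add, comp_const_mul, comp_mul_const, comp_covec]
  rw [Finset.sum_add_distrib]
  simp only [mul_add, Finset.sum_add_distrib, conn]
  congr 1
  · by_cases hjk : j = k
    · subst hjk
      by_cases hl : j = l
      · subst hl; simp
      · simp [hl, Ne.symm hl]
    · simp only [hjk, false_and, if_false]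
      refine Finset.sum_eq_zero fun x _ => ?_
      by_cases hx : x = j
      · subst hx; simp [hjk]
      · simp [hx]
  · congr 1
    · congr 1
      · by_cases hl : k = l
        · subst hl; simp
        · simp [hl, Ne.symm hl]
      · by_cases hl : j = l
        · subst hl; simp
        · simp [hl, Ne.symm hl]
    · by_cases hl : j = k
      · subst hl; simp
      · simp [hl, Ne.symm hl]

/-- `γ_ij √(η_ii η_jj)`, where `γ_ij` are the rotation coefficients of the metric; zero on the
diagonal.  It is read off from the fourth derivatives of the potential, so that no square root of
`η_ii` has to be chosen. -/
def rot (i j : Fin n) : R := if i = j then 0 else Φ.quartic i i j j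

theorem rot_self (i) : Φ.rot i i = 0 := if_pos rfl

theorem rot_symm (i j) : Φ.rot i j = Φ.rot j i := by
  unfold rot
  by_cases h : i = j
  · subst h; rfl
  · rw [if_neg h, if_neg (Ne.symm h), quartic_swap₂, quartic_swap₁, quartic_swap₃, quartic_swap₂]

theorem quartic_distinct (w : Fin n) {j k l} (hjk : j ≠ k) (hkl : k ≠ l) (hjl : j ≠ l) :
    Φ.quartic w j k l = 0 := by
  rw [quartic_conn]; simp [hjk, hkl, hjl]

theorem quartic_two_two {i k : Fin n} (h : i ≠ k) : Φ.quartic k i i k = Φ.rot i k := by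
  rw [rot, if_neg h, quartic_swap₁, quartic_swap₂]

theorem quartic_three_one {i k : Fin n} (h : i ≠ k) : Φ.quartic i i i k = -Φ.rot i k := by
  have := Φ.sum_quartic i i k
  rw [Finset.sum_eq_add i k h] at this
  · rw [Φ.quartic_two_two h] at this
    linear_combination this
  · intro w _ hw
    rw [quartic_swap₂, quartic_swap₁]
    exact Φ.quartic_distinct i hw.1 h hw.2
  · simp
  · simp

theorem quartic_four (i : Fin n) : Φ.quartic i i i i = ∑ m, Φ.rot i m := by
  have := Φ.sum_quartic i i i
  rw [← Finset.add_sum_erase _ _ (Finset.mem_univ i)] at this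
  rw [← Finset.add_sum_erase _ _ (Finset.mem_univ i), rot_self, zero_add]
  rw [← sub_eq_zero, sub_eq_add_neg, ← Finset.sum_neg_distrib, ← this]
  congr 1
  refine Finset.sum_congr rfl fun w hw => ?_
  have hw' : i ≠ w := (Finset.ne_of_mem_erase hw).symm
  rw [← Φ.quartic_three_one hw', Φ.quartic_swap₁ w, Φ.quartic_swap₂ i w, Φ.quartic_swap₃ i i w]

/-- The connection is determined by the rotation coefficients: the constancy of the metric and the
symmetry of the fourth derivatives can be solved for it. -/
theorem len_conn (w i k) : Φ.len i * Φ.conn w i k =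
    ∑ m, Φ.rot i m * (((if m = w then 1 else 0) - (if i = w then 1 else 0)) *
      ((if m = k then 1 else 0) - (if i = k then 1 else 0))) := by
  have e : ∑ m, Φ.rot i m * (((if m = w then 1 else 0) - (if i = w then 1 else 0)) *
      ((if m = k then 1 else 0) - (if i = k then 1 else 0))) =
      (if w = k then Φ.rot i w else 0) - (if i = k then Φ.rot i w else 0)
      - (if i = w then Φ.rot i k else 0) + (if i = w ∧ i = k then ∑ m, Φ.rot i m else 0) := by
    simp only [mul_sub, sub_mul, Finset.sum_sub_distrib]
    by_cases h1 : i = w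
    · subst h1
      by_cases h2 : i = k
      · subst h2; simp [rot_self]
      · simp [h2, Ne.symm h2]
    · by_cases h2 : i = k
      · subst h2; simp [h1, Ne.symm h1]
      · by_cases h3 : w = k
        · subst h3; simp [h1]
        · simp [h1, h2, h3, Ne.symm h3]
  rw [e]
  by_cases hik : i = k
  · subst hik
    have h1 := Φ.metric_conn w i i
    have h2 := Φ.quartic_conn w i i i
    simp only [and_self, if_true] at h1 h2
    have h3 : Φ.len i * Φ.conn w i i = Φ.quartic w i i i := by linear_combination -h1 - h2
    rw [h3]
    by_cases hw : i = w
    · subst hw; simp [quartic_four, rot_self]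
    · rw [quartic_swap₁, quartic_swap₂, quartic_swap₃, Φ.quartic_three_one hw]
      simp [hw, Ne.symm hw]
  · have h2 := Φ.quartic_conn w i i k
    simp only [hik, and_false, if_false, if_true, zero_add] at h2
    rw [← h2]
    by_cases hw : i = w
    · subst hw; simp [Φ.quartic_three_one hik, hik]
    · by_cases hk : w = k
      · subst hk; simp [Φ.quartic_two_two hik, hik]
      · rw [quartic_swap₁, Φ.quartic_distinct i (Ne.symm hw) hik hk]
        simp [hw, hk, hik]

theorem D_covec (d i a) : Φ.D d (Φ.covec i a) = Φ.inv i * ∑ m, Φ.rot i m *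
    ((Φ.covec m d - Φ.covec i d) * (Φ.covec m a - Φ.covec i a)) := by
  refine Φ.covector_ext₂ (f := fun d a => Φ.D d (Φ.covec i a)) (g := fun d a => Φ.inv i *
    ∑ m, Φ.rot i m * ((Φ.covec m d - Φ.covec i d) * (Φ.covec m a - Φ.covec i a)))
    (fun w k => ?_) d a
  simp only [comp_sum, comp_const_mul, comp_mul_const, comp_sub, comp_covec]
  rw [← len_conn, ← mul_assoc, mul_comm (Φ.inv i), len_mul_inv, one_mul, conn]

theorem D_len (d i) : Φ.D d (Φ.len i) = 2 * ∑ m, Φ.rot i m * (Φ.covec m d - Φ.covec i d) := by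
  refine Φ.covector_ext (f := fun d => Φ.D d (Φ.len i))
    (g := fun d => 2 * ∑ m, Φ.rot i m * (Φ.covec m d - Φ.covec i d)) (fun w => ?_) d
  have h1 := Φ.metric_conn w i i
  rw [if_pos rfl, len_conn] at h1
  simp only [comp_sum, comp_const_mul, comp_sub, comp_covec]
  have : ∑ m, Φ.rot i m * (((if m = w then 1 else 0) - (if i = w then 1 else 0)) *
      ((if m = i then 1 else 0) - (if i = i then 1 else 0))) =
      -∑ m, Φ.rot i m * ((if m = w then 1 else 0) - (if i = w then 1 else 0)) := by
    rw [← Finset.sum_neg_distrib]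
    refine Finset.sum_congr rfl fun m _ => ?_
    by_cases hm : m = i
    · subst hm; simp [rot_self]
    · simp only [hm, if_true, if_false]; ring
  rw [this] at h1
  linear_combination h1

theorem D_inv (d i) : Φ.D d (Φ.inv i) = -(Φ.inv i * Φ.inv i) * Φ.D d (Φ.len i) := by
  have h := congr_arg (Φ.D d) (Φ.len_mul_inv i)
  simp only [Derivation.leibniz, smul_eq_mul, Derivation.map_one_eq_zero] at h
  linear_combination Φ.inv i * h - Φ.D d (Φ.inv i) * Φ.len_mul_inv i

/-- The covectors `p_i` are closed forms. -/
theorem D_covec_symm (d i a) : Φ.D d (Φ.covec i a) = Φ.D a (Φ.covec i d) := by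
  simp only [D_covec, mul_comm]

/-- The derivation along the `k`-th idempotent. -/
def del (k : Fin n) : Derivation ℂ R R := ∑ a, Φ.vec k a • Φ.D a

theorem del_apply (k f) : Φ.del k f = Φ.comp k fun a => Φ.D a f := by
  have := map_sum (Derivation.coeFnAddMonoidHom (R := ℂ) (A := R) (M := R))
    (fun a => Φ.vec k a • Φ.D a) Finset.univ
  have h := congr_fun this f
  rw [Finset.sum_apply] at h
  exact h

theorem D_eq_sum (a f) : Φ.D a f = ∑ k, Φ.covec k a * Φ.del k f := by
  simp only [del_apply]
  exact (Φ.sum_covec_comp (fun a => Φ.D a f) a).symm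

/-- The matrix `½ ∂η_ii/∂u_j`: off the diagonal it is `rot`, and its rows sum to zero. -/
def hrot (i j : Fin n) : R := Φ.rot i j - if i = j then ∑ k, Φ.rot i k else 0

theorem hrot_symm (i j) : Φ.hrot i j = Φ.hrot j i := by
  unfold hrot
  by_cases h : i = j
  · subst h; rfl
  · simp [h, Ne.symm h, Φ.rot_symm i j]

theorem hrot_of_ne {i j : Fin n} (h : i ≠ j) : Φ.hrot i j = Φ.rot i j := by simp [hrot, h]

theorem sum_hrot (i) : ∑ j, Φ.hrot i j = 0 := by simp [hrot]

theorem del_len (j i) : Φ.del j (Φ.len i) = 2 * Φ.hrot i j := by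
  rw [del_apply]
  simp only [D_len, comp_sum, comp_const_mul, comp_sub, comp_covec, hrot]
  simp only [mul_sub, Finset.sum_sub_distrib]
  simp

theorem del_covec (j i a) : Φ.del j (Φ.covec i a) = Φ.inv i * (Φ.rot i j * (Φ.covec j a - Φ.covec i a)
    - if i = j then ∑ m, Φ.rot i m * (Φ.covec m a - Φ.covec i a) else 0) := by
  rw [del_apply]
  simp only [D_covec, comp_sum, comp_const_mul, comp_mul_const, comp_sub, comp_covec]
  congr 1
  simp only [mul_sub, sub_mul, Finset.sum_sub_distrib]
  by_cases h : i = j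
  · subst h; simp
  · simp [h]

theorem del_covec_of_ne {j i : Fin n} (h : i ≠ j) (a) :
    Φ.del j (Φ.covec i a) = Φ.inv i * (Φ.rot i j * (Φ.covec j a - Φ.covec i a)) := by
  simp [del_covec, h]

theorem del_inv (j i) : Φ.del j (Φ.inv i) = -(Φ.inv i * Φ.inv i) * (2 * Φ.hrot i j) := by
  rw [← del_len, del_apply, del_apply]
  simp only [D_inv, comp_const_mul]

/-- The derivatives of the idempotents as vector fields, obtained from those of the lowered vectors
`η_jj p_j` by raising the index.  The right-hand side is symmetric in `i` and `j`, whence the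
idempotents commute. -/
theorem del_vec_of_ne {i j : Fin n} (h : i ≠ j) (a) : Φ.del i (Φ.vec j a) =
    Φ.rot i j * (Φ.inv i * Φ.vec i a + Φ.inv j * Φ.vec j a) := by
  have e : ∀ b, Φ.del i (Φ.low j b) = Φ.rot i j * (Φ.covec i b + Φ.covec j b) := by
    intro b
    have hl := Φ.len_mul_inv j
    simp only [low_eq, Derivation.leibniz, smul_eq_mul, del_len, Φ.del_covec_of_ne h.symm,
      Φ.hrot_of_ne h.symm, Φ.rot_symm j i]
    linear_combination Φ.rot i j * (Φ.covec i b - Φ.covec j b) * hl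
  conv_lhs => rw [← Φ.sum_inv_low, map_sum]
  simp only [Derivation.leibniz, smul_eq_mul, Derivation.map_algebraMap, mul_zero, add_zero, e]
  rw [← Φ.sum_inv_covec i, ← Φ.sum_inv_covec j, ← Finset.sum_add_distrib, Finset.mul_sum]
  exact Finset.sum_congr rfl fun _ _ => by ring

/-- The idempotents commute as derivations: they are the coordinate fields `∂/∂u_i`. -/
theorem del_comm (i j f) : Φ.del i (Φ.del j f) = Φ.del j (Φ.del i f) := by
  by_cases h : i = j
  · rw [h]
  have key : ∀ i j : Fin n, i ≠ j → Φ.del i (Φ.del j f) =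
      (Φ.comp i fun a => Φ.comp j fun b => Φ.D a (Φ.D b f)) +
      ∑ a, Φ.rot i j * (Φ.inv i * Φ.vec i a + Φ.inv j * Φ.vec j a) * Φ.D a f := by
    intro i j h
    conv_lhs => rw [Φ.del_apply j, comp, pairing, map_sum]
    simp only [Derivation.leibniz, smul_eq_mul, Φ.del_vec_of_ne h, Finset.sum_add_distrib]
    congr 1
    · rw [comp_swap]
      simp only [del_apply]
      rfl
    · exact Finset.sum_congr rfl fun _ _ => mul_comm _ _
  rw [key i j h, key j i (Ne.symm h), comp_swap, Φ.rot_symm i j]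
  simp only [Φ.D_comm]
  congr 1
  exact Finset.sum_congr rfl fun _ _ => by ring

theorem sum_del (f) : ∑ k, Φ.del k f = Φ.D 0 f := by
  simp only [D_eq_sum, covec_zero, one_mul]

theorem del_zero_rot (i j) : Φ.D 0 (Φ.rot i j) = 0 := by
  by_cases h : i = j
  · simp [h, rot_self]
  have hl : Φ.D 0 (Φ.len i) = 0 := by simp [D_len, covec_zero]
  have : Φ.D 0 (Φ.del j (Φ.len i)) = 0 := by
    rw [← sum_del]
    simp only [Φ.del_comm _ j]
    rw [← map_sum, sum_del, hl, map_zero]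
  rw [del_len, Φ.hrot_of_ne h] at this
  have h2 : (algebraMap ℂ R (1/2)) * 2 = 1 := by
    rw [← map_ofNat (algebraMap ℂ R) 2, ← map_mul]; norm_num
  rw [Derivation.leibniz] at this
  simp only [smul_eq_mul] at this
  have h3 : Φ.D 0 (2 : R) = 0 := by
    rw [← map_ofNat (algebraMap ℂ R) 2, Derivation.map_algebraMap]
  rw [h3] at this
  linear_combination (algebraMap ℂ R (1/2)) * this - Φ.D 0 (Φ.rot i j) * h2

/-- Off the diagonal, the rotation coefficients satisfy `∂_k γ_ij = γ_ik γ_kj`; in terms of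
`rot`, which carries the lengths, this reads as follows.  It is the flatness of the metric. -/
theorem del_rot {i j k : Fin n} (hij : i ≠ j) (hik : i ≠ k) (hjk : j ≠ k) :
    Φ.del k (Φ.rot i j) = Φ.inv i * Φ.rot i j * Φ.rot i k + Φ.inv j * Φ.rot i j * Φ.rot j k
      + Φ.inv k * Φ.rot i k * Φ.rot j k := by
  -- equality of the mixed derivatives of the covector `p_j`
  have e : ∀ a, Φ.del k (Φ.inv j * (Φ.rot j i * (Φ.covec i a - Φ.covec j a))) =
      Φ.del i (Φ.inv j * (Φ.rot j k * (Φ.covec k a - Φ.covec j a))) := by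
    intro a
    rw [← Φ.del_covec_of_ne hij.symm, ← Φ.del_covec_of_ne hjk, del_comm]
  simp only [Derivation.leibniz, smul_eq_mul, map_sub, del_inv, Φ.del_covec_of_ne hik,
    Φ.del_covec_of_ne hjk, Φ.del_covec_of_ne hij.symm, Φ.del_covec_of_ne hik.symm,
    Φ.hrot_of_ne hjk, Φ.hrot_of_ne hij.symm] at e
  have e' := congr_arg (Φ.comp i) (funext e)
  simp only [comp_add, comp_sub, comp_const_mul, comp_mul_const, comp_covec, if_true, if_neg hij.symm,
    if_neg hik.symm, Φ.rot_symm j i, Φ.rot_symm k i] at e'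
  have hl := Φ.len_mul_inv j
  linear_combination Φ.len j * e' + (Φ.inv i * Φ.rot i j * Φ.rot i k + Φ.inv j * Φ.rot i j * Φ.rot j k
      + Φ.inv k * Φ.rot i k * Φ.rot j k - Φ.del k (Φ.rot i j)) * hl
end IdempotentFrame

/-! ### Contraction of Getzler's polynomial -/

open pairing in
/-- Getzler's polynomial in terms of a frame.  Here `π` and `p` are dual bases, `Z` are the
coordinates of `z` in the frame, and the tensors `c3`, `c4` and the derivatives of `G` are expressed
through a matrix `g` and a vector `e`, to be specialized to the rotation coefficients and `1 / η_ii`.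
`G i` and `B j i` are the first and second derivatives of the function along the frame, and `y k` is
the component along `p k` of the vector `c5` contracted with `z`.  All terms with the first
derivatives `G i` cancel. -/
theorem getzler_contract {n : ℕ} (p π : Fin n → Fin n → ℂ) (g : Fin n → Fin n → ℂ) (e G y : Fin n → ℂ)
    (B : Fin n → Fin n → ℂ)
    (hpπ : ∀ i j, pairing (π i) (p j) = if j = i then 1 else 0)
    (hg : ∀ i, g i i = 0)
    (c3 : Fin n → Fin n → Fin n → ℂ) (c4 : Fin n → Fin n → Fin n → Fin n → ℂ)
    (c5 : Fin n → Fin n → Fin n → Fin n → Fin n → ℂ) (dG : Fin n → ℂ) (ddG : Fin n → Fin n → ℂ)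
    (z Z : Fin n → ℂ)
    (hZ : ∀ i, pairing z (p i) = Z i)
    (hc3 : ∀ m a b, c3 m a b = ∑ i, π i m * (p i a * p i b))
    (hc4 : ∀ m a b c, c4 m a b c = ∑ i, ∑ j, π i m * (g i j * e i *
      ((p i a - p j a) * (p i b - p j b) * (p i c - p j c))))
    (hc5 : ∀ k, pairing z (fun a₁ => pairing z fun a₂ => pairing z fun a₃ => pairing z fun a₄ =>
      ∑ m, c5 m a₁ a₂ a₃ a₄ * p k m) = y k)
    (hdG : ∀ v, dG v = ∑ i, G i * p i v)
    (hddG : ∀ m v, ddG m v = (∑ i, ∑ k, e i * G i * g i k * ((p k m - p i m) * (p k v - p i v)))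
      + ∑ i, ∑ j, B j i * (p j m * p i v)) :
    ∑ a₁, ∑ a₂, ∑ a₃, ∑ a₄, z a₁ * z a₂ * z a₃ * z a₄ * ∑ m, ∑ v,
      (3 * c3 m a₁ a₂ * c3 v a₃ a₄ * ddG m v
      - 4 * c3 m a₁ a₂ * c3 v a₃ m * ddG a₄ v
      - c3 m a₁ a₂ * c4 v a₃ a₄ m * dG v
      + 2 * c4 m a₁ a₂ a₃ * c3 v a₄ m * dG v
      + (1 / 6) * c4 m a₁ a₂ a₃ * c4 v a₄ m v
      + (1 / 24) * c5 m a₁ a₂ a₃ a₄ * c3 v m v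
      - (1 / 4) * c4 m a₁ a₂ v * c4 v a₃ a₄ m) =
    (∑ i, ∑ j, B j i * (3 * Z i ^ 2 * Z j ^ 2 - 4 * Z i ^ 3 * Z j))
      + (1 / 6) * (∑ i, ∑ j, g i j * e i * ((Z i - Z j) *
        (e i * (∑ k, g i k * (Z i - Z k) ^ 3) - e j * (∑ k, g j k * (Z j - Z k) ^ 3))))
      + (1 / 24) * (∑ k, y k)
      - (1 / 4) * ∑ i, ∑ j, g i j * e i * (Z i - Z j) ^ 2 * ∑ k, ∑ l, g k l * e k * (Z k - Z l) ^ 2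
          * (((if i = k then 1 else 0) - (if j = k then 1 else 0)) *
            ((if k = i then 1 else 0) - (if l = i then 1 else 0))) := by
  -- the tensors contracted with `z`; `Q` is the square of `z`
  set Q : Fin n → ℂ := fun m => ∑ i, π i m * Z i ^ 2 with hQ
  have e1 : ∀ m, pairing z (fun a₁ => pairing z fun a₂ => c3 m a₁ a₂) = Q m := by
    intro m
    simp only [hc3, sum, const_mul, mul_const, hZ, hQ]
    exact Finset.sum_congr rfl fun _ _ => by ring
  have e2 : ∀ v m, pairing z (fun a => c3 v a m) = ∑ i, π i v * (Z i * p i m) := by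
    intro v m
    simp only [hc3, sum, const_mul, mul_const, hZ]
  set N3 : Fin n → ℂ := fun m => ∑ i, π i m * (e i * ∑ j, g i j * (Z i - Z j) ^ 3) with hN3
  have e3 : ∀ m, pairing z (fun a₁ => pairing z fun a₂ => pairing z fun a₃ => c4 m a₁ a₂ a₃) = N3 m := by
    intro m
    simp only [hc4, sum, const_mul, mul_const, sub, hZ, hN3, Finset.mul_sum]
    exact Finset.sum_congr rfl fun _ _ => Finset.sum_congr rfl fun _ _ => by ring
  have e4 : ∀ v m, pairing z (fun a₁ => pairing z fun a₂ => c4 v a₁ a₂ m) =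
      ∑ i, ∑ j, π i v * (g i j * e i * (Z i - Z j) ^ 2 * (p i m - p j m)) := by
    intro v m
    simp only [hc4, sum, const_mul, mul_const, sub, hZ]
    exact Finset.sum_congr rfl fun _ _ => Finset.sum_congr rfl fun _ _ => by ring
  have e5 : ∀ v m w, pairing z (fun a => c4 v a m w) =
      ∑ i, ∑ j, π i v * (g i j * e i * ((Z i - Z j) * (p i m - p j m) * (p i w - p j w))) := by
    intro v m w
    simp only [hc4, sum, const_mul, mul_const, sub, hZ]
  have q1 : ∀ j, pairing Q (p j) = Z j ^ 2 := by
    intro j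
    simp [hQ, sum_left, mul_const_left, hpπ]
  have q3 : ∀ j, pairing N3 (p j) = e j * ∑ k, g j k * (Z j - Z k) ^ 3 := by
    intro j
    simp [hN3, sum_left, mul_const_left, hpπ]
  have start : ∑ a₁, ∑ a₂, ∑ a₃, ∑ a₄, z a₁ * z a₂ * z a₃ * z a₄ * ∑ m, ∑ v,
      (3 * c3 m a₁ a₂ * c3 v a₃ a₄ * ddG m v
      - 4 * c3 m a₁ a₂ * c3 v a₃ m * ddG a₄ v
      - c3 m a₁ a₂ * c4 v a₃ a₄ m * dG v
      + 2 * c4 m a₁ a₂ a₃ * c3 v a₄ m * dG v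
      + (1 / 6) * c4 m a₁ a₂ a₃ * c4 v a₄ m v
      + (1 / 24) * c5 m a₁ a₂ a₃ a₄ * c3 v m v
      - (1 / 4) * c4 m a₁ a₂ v * c4 v a₃ a₄ m) =
      3 * pairing Q (fun m => pairing Q fun v => ddG m v)
      - 4 * pairing Q (fun m => pairing (fun v => pairing z fun a => c3 v a m)
          fun v => pairing z fun a => ddG a v)
      - pairing Q (fun m => pairing (fun v => pairing z fun a₁ => pairing z fun a₂ => c4 v a₁ a₂ m) dG)
      + 2 * pairing N3 (fun m => pairing (fun v => pairing z fun a => c3 v a m) dG)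
      + (1 / 6) * pairing N3 (fun m => ∑ v, pairing z fun a => c4 v a m v)
      + (1 / 24) * pairing z (fun a₁ => pairing z fun a₂ => pairing z fun a₃ => pairing z fun a₄ =>
          ∑ m, c5 m a₁ a₂ a₃ a₄ * ∑ v, c3 v m v)
      - (1 / 4) * ∑ m, ∑ v, (pairing z fun a₁ => pairing z fun a₂ => c4 m a₁ a₂ v) *
          (pairing z fun a₁ => pairing z fun a₂ => c4 v a₁ a₂ m) := by
    have : ∀ T : Fin n → Fin n → Fin n → Fin n → ℂ,
        ∑ a₁, ∑ a₂, ∑ a₃, ∑ a₄, z a₁ * z a₂ * z a₃ * z a₄ * T a₁ a₂ a₃ a₄ =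
        pairing z fun a₁ => pairing z fun a₂ => pairing z fun a₃ => pairing z fun a₄ =>
          T a₁ a₂ a₃ a₄ := by
      intro T
      simp only [pairing, Finset.mul_sum]
      exact Finset.sum_congr rfl fun _ _ => Finset.sum_congr rfl fun _ _ =>
        Finset.sum_congr rfl fun _ _ => Finset.sum_congr rfl fun _ _ => by ring
    rw [this]
    simp only [add, sub, sum, const_mul, mul_const, e1, e3, Finset.sum_add_distrib,
      Finset.sum_sub_distrib]
    have h1 : ∀ (k : ℂ) (x : Fin n → ℂ) (A W : Fin n → Fin n → ℂ),
        ∑ m, ∑ v, k * x m * A v m * W m v =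
          k * pairing x (fun m => pairing (fun v => A v m) (W m)) := by
      intro k x A W
      simp only [pairing, Finset.mul_sum]
      exact Finset.sum_congr rfl fun _ _ => Finset.sum_congr rfl fun _ _ => by ring
    have h2 : ∀ (k : ℂ) (A W : Fin n → Fin n → ℂ),
        ∑ m, ∑ v, k * A m v * W m v = k * ∑ m, ∑ v, A m v * W m v := by
      intro k A W
      simp only [Finset.mul_sum]
      exact Finset.sum_congr rfl fun _ _ => Finset.sum_congr rfl fun _ _ => by ring
    congr 1
    · congr 1
      · congr 1
        · congr 1
          · congr 1
            · congr 1
              · exact h1 3 Q (fun v _ => Q v) ddG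
              · exact h1 4 Q _ fun _ v => pairing z fun a => ddG a v
            · simpa using h1 1 Q (fun v m => pairing z fun a₁ => pairing z fun a₂ => c4 v a₁ a₂ m)
                fun _ => dG
          · exact h1 2 N3 _ fun _ => dG
        · simp only [pairing, Finset.mul_sum]
          rw [Finset.sum_comm]
          exact Finset.sum_congr rfl fun _ _ => Finset.sum_congr rfl fun _ _ =>
            Finset.sum_congr rfl fun _ _ => by ring
      · simp only [Finset.mul_sum]
        exact Finset.sum_congr rfl fun _ _ => Finset.sum_congr rfl fun _ _ => by ring
    · exact h2 (1 / 4) _ _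
  have hπp : ∀ i j, ∑ v, π i v * p j v = if j = i then 1 else 0 := hpπ
  have tr3 : ∀ m, ∑ v, c3 v m v = ∑ k, p k m := by
    intro m
    simp only [hc3]
    rw [Finset.sum_comm]
    refine Finset.sum_congr rfl fun i _ => ?_
    have := hπp i i
    rw [if_pos rfl] at this
    calc _ = p i m * ∑ v, π i v * p i v := by
          rw [Finset.mul_sum]; exact Finset.sum_congr rfl fun _ _ => by ring
      _ = _ := by rw [this, mul_one]
  have tr4 : ∀ m, ∑ v, pairing z (fun a => c4 v a m v) =
      ∑ i, ∑ j, g i j * e i * ((Z i - Z j) * (p i m - p j m)) := by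
    intro m
    simp only [e5]
    rw [Finset.sum_comm]
    refine Finset.sum_congr rfl fun i _ => ?_
    rw [Finset.sum_comm]
    refine Finset.sum_congr rfl fun j _ => ?_
    calc _ = g i j * e i * ((Z i - Z j) * (p i m - p j m)) *
            (∑ v, π i v * p i v - ∑ v, π i v * p j v) := by
          rw [← Finset.sum_sub_distrib, Finset.mul_sum]
          exact Finset.sum_congr rfl fun _ _ => by ring
      _ = _ := by
          rw [hπp, hπp]
          by_cases hij : j = i
          · subst hij; simp [hg]
          · simp [hij]
  have eL : ∀ x W : Fin n → ℂ, pairing x (fun m => pairing (fun v => pairing z fun a => c3 v a m) W) =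
      ∑ i, Z i * pairing x (p i) * pairing (π i) W := by
    intro x W
    simp only [e2, sum, const_mul, sum_left, mul_const_left]
    exact Finset.sum_congr rfl fun _ _ => by ring
  have eG : ∀ i, pairing (π i) dG = G i := by
    intro i
    have hd : dG = fun v => ∑ i, G i * p i v := funext hdG
    simp [hd, sum, const_mul, hpπ]
  have t1 : pairing Q (fun m => pairing Q fun v => ddG m v) =
      (∑ i, ∑ k, e i * G i * g i k * (Z k ^ 2 - Z i ^ 2) ^ 2) +
        ∑ i, ∑ j, B j i * (Z j ^ 2 * Z i ^ 2) := by
    simp only [hddG, add, sum, const_mul, mul_const, sub, q1, sq]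
  have t2 : pairing Q (fun m => pairing (fun v => pairing z fun a => c3 v a m)
        fun v => pairing z fun a => ddG a v) =
      (∑ i, ∑ k, e i * G i * g i k * ((Z k - Z i) * (Z k ^ 3 - Z i ^ 3))) +
        ∑ i, ∑ j, B j i * (Z j * Z i ^ 3) := by
    rw [eL]
    have : ∑ i, Z i * pairing Q (p i) * pairing (π i) (fun v => pairing z fun a => ddG a v) =
        pairing (fun v => ∑ i, π i v * Z i ^ 3) (fun v => pairing z fun a => ddG a v) := by
      simp only [sum_left, mul_const_left, q1]
      exact Finset.sum_congr rfl fun _ _ => by ring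
    have q : ∀ j, pairing (fun v => ∑ i, π i v * Z i ^ 3) (p j) = Z j ^ 3 := by
      intro j
      simp [sum_left, mul_const_left, hpπ]
    rw [this]
    simp only [hddG, add, sum, const_mul, mul_const, sub, hZ, q]
  have t3 : pairing Q (fun m => pairing (fun v => pairing z fun a₁ => pairing z fun a₂ =>
        c4 v a₁ a₂ m) dG) =
      ∑ i, ∑ j, g i j * e i * G i * ((Z i - Z j) ^ 2 * (Z i ^ 2 - Z j ^ 2)) := by
    simp only [e4, sum, const_mul, sub, sum_left, mul_const_left, eG, q1]
    exact Finset.sum_congr rfl fun _ _ => Finset.sum_congr rfl fun _ _ => by ring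
  have t4 : pairing N3 (fun m => pairing (fun v => pairing z fun a => c3 v a m) dG) =
      ∑ i, Z i * G i * (e i * ∑ j, g i j * (Z i - Z j) ^ 3) := by
    rw [eL]
    simp only [q3, eG]
    exact Finset.sum_congr rfl fun _ _ => by ring
  have t5 : pairing N3 (fun m => ∑ v, pairing z fun a => c4 v a m v) =
      ∑ i, ∑ j, g i j * e i * ((Z i - Z j) *
        (e i * (∑ k, g i k * (Z i - Z k) ^ 3) - e j * (∑ k, g j k * (Z j - Z k) ^ 3))) := by
    simp only [tr4, sum, const_mul, sub, q3]
  have t6 : pairing z (fun a₁ => pairing z fun a₂ => pairing z fun a₃ => pairing z fun a₄ =>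
          ∑ m, c5 m a₁ a₂ a₃ a₄ * ∑ v, c3 v m v) = ∑ k, y k := by
    simp only [tr3, ← hc5, Finset.mul_sum]
    simp only [← sum]
    exact congr_arg _ (funext fun _ => congr_arg _ (funext fun _ => congr_arg _ (funext fun _ =>
      congr_arg _ (funext fun _ => Finset.sum_comm))))
  have t7 : ∑ m, ∑ v, (pairing z fun a₁ => pairing z fun a₂ => c4 m a₁ a₂ v) *
          (pairing z fun a₁ => pairing z fun a₂ => c4 v a₁ a₂ m) =
      ∑ i, ∑ j, g i j * e i * (Z i - Z j) ^ 2 * ∑ k, ∑ l, g k l * e k * (Z k - Z l) ^ 2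
          * (((if i = k then 1 else 0) - (if j = k then 1 else 0)) *
            ((if k = i then 1 else 0) - (if l = i then 1 else 0))) := by
    have eX : ∀ m W, pairing (fun v => pairing z fun a₁ => pairing z fun a₂ => c4 v a₁ a₂ m) W =
        ∑ k, ∑ l, pairing (π k) W * (g k l * e k * (Z k - Z l) ^ 2 * (p k m - p l m)) := by
      intro m W
      simp only [e4, sum_left, mul_const_left]
    have eY : ∀ k m, pairing (π k) (fun v => pairing z fun a₁ => pairing z fun a₂ => c4 m a₁ a₂ v) =
        ∑ i, ∑ j, π i m * (g i j * e i * (Z i - Z j) ^ 2 *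
            ((if i = k then 1 else 0) - (if j = k then 1 else 0))) := by
      intro k m
      simp only [e4, sum, const_mul, sub, hpπ]
    calc _ = ∑ m, pairing (fun v => pairing z fun a₁ => pairing z fun a₂ => c4 v a₁ a₂ m)
          (fun v => pairing z fun a₁ => pairing z fun a₂ => c4 m a₁ a₂ v) :=
          Finset.sum_congr rfl fun _ _ => Finset.sum_congr rfl fun _ _ => mul_comm _ _
      _ = ∑ m, ∑ k, ∑ l, (∑ i, ∑ j, π i m * (g i j * e i * (Z i - Z j) ^ 2 *
            ((if i = k then 1 else 0) - (if j = k then 1 else 0)))) *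
            (g k l * e k * (Z k - Z l) ^ 2 * (p k m - p l m)) := by
          simp only [eX, eY]
      _ = ∑ k, ∑ l, g k l * e k * (Z k - Z l) ^ 2 * pairing (fun m =>
            ∑ i, ∑ j, π i m * (g i j * e i * (Z i - Z j) ^ 2 *
            ((if i = k then 1 else 0) - (if j = k then 1 else 0)))) (fun m => p k m - p l m) := by
          rw [Finset.sum_comm]
          refine Finset.sum_congr rfl fun k _ => ?_
          rw [Finset.sum_comm]
          refine Finset.sum_congr rfl fun l _ => ?_
          rw [pairing, Finset.mul_sum]
          exact Finset.sum_congr rfl fun _ _ => by ring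
      _ = _ := by
          simp only [sum_left, mul_const_left]
          simp only [sub, hpπ]
          refine Finset.sum_congr rfl fun k _ => Finset.sum_congr rfl fun l _ => ?_
          congr 1
          refine Finset.sum_congr rfl fun i _ => Finset.sum_congr rfl fun j _ => ?_
          ring
  rw [start, t1, t2, t3, t4, t5, t6, t7]
  -- the terms with first derivatives of the function cancel
  have hG : 3 * (∑ i, ∑ k, e i * G i * g i k * (Z k ^ 2 - Z i ^ 2) ^ 2)
      - 4 * (∑ i, ∑ k, e i * G i * g i k * ((Z k - Z i) * (Z k ^ 3 - Z i ^ 3)))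
      - (∑ i, ∑ j, g i j * e i * G i * ((Z i - Z j) ^ 2 * (Z i ^ 2 - Z j ^ 2)))
      + 2 * (∑ i, Z i * G i * (e i * ∑ j, g i j * (Z i - Z j) ^ 3)) = 0 := by
    simp only [Finset.mul_sum, ← Finset.sum_sub_distrib, ← Finset.sum_add_distrib]
    exact Finset.sum_eq_zero fun _ _ => Finset.sum_eq_zero fun _ _ => by ring
  have hB : (∑ i, ∑ j, B j i * (3 * Z i ^ 2 * Z j ^ 2 - 4 * Z i ^ 3 * Z j)) =
      3 * (∑ i, ∑ j, B j i * (Z j ^ 2 * Z i ^ 2)) - 4 * ∑ i, ∑ j, B j i * (Z j * Z i ^ 3) := by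
    simp only [Finset.mul_sum, ← Finset.sum_sub_distrib]
    exact Finset.sum_congr rfl fun _ _ => Finset.sum_congr rfl fun _ _ => by ring
  rw [hB]
  linear_combination hG

/-! ### Quartic forms in the differences of the variables -/

section Quartic

variable {n : ℕ} (g : Fin n → Fin n → ℂ) (e Z : Fin n → ℂ)

/-- For a vector `h` with zero sum, the binomial expansion around `Z_k` of the quartic with matrix
`h_i h_j` only involves moments of `h` up to order three. -/
theorem sum_quartic_of_sum_eq_zero (h : Fin n → ℂ) (hh : ∑ i, h i = 0) (k : Fin n) :
    ∑ i, ∑ j, h i * h j * (Z i - Z j) ^ 4 =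
      6 * (∑ j, h j * (Z k - Z j) ^ 2) ^ 2
        - 8 * (∑ j, h j * (Z k - Z j)) * ∑ j, h j * (Z k - Z j) ^ 3 := by
  have e1 : ∀ i j, h i * h j * (Z i - Z j) ^ 4 =
      (h i * (Z k - Z i) ^ 4) * h j + h i * (h j * (Z k - Z j) ^ 4)
      + 6 * ((h i * (Z k - Z i) ^ 2) * (h j * (Z k - Z j) ^ 2))
      - 4 * ((h i * (Z k - Z i)) * (h j * (Z k - Z j) ^ 3))
      - 4 * ((h i * (Z k - Z i) ^ 3) * (h j * (Z k - Z j))) := by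
    intro i j; ring
  simp only [e1, Finset.sum_add_distrib, Finset.sum_sub_distrib, ← Finset.mul_sum,
    ← Finset.sum_mul, hh]
  ring

/-- The term `(1/6) c4 c4` of Getzler's polynomial.  Its second part cancels against a part of
`sum_derivative_quartic`. -/
theorem sum_connection_quartic (hg : ∀ i j, g i j = g j i) :
    (∑ i, ∑ j, g i j * e i * ((Z i - Z j) *
      (e i * (∑ k, g i k * (Z i - Z k) ^ 3) - e j * (∑ k, g j k * (Z j - Z k) ^ 3)))) =
    (∑ i, e i ^ 2 * (∑ j, g i j * (Z i - Z j)) * (∑ k, g i k * (Z i - Z k) ^ 3))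
      + ∑ i, e i * (∑ j, g i j * e j * (Z i - Z j)) * (∑ k, g i k * (Z i - Z k) ^ 3) := by
  suffices key : ∀ S : Fin n → ℂ, ∑ i, ∑ j, g i j * e i * ((Z i - Z j) * (e i * S i - e j * S j)) =
      (∑ i, e i ^ 2 * (∑ j, g i j * (Z i - Z j)) * S i)
        + ∑ i, e i * (∑ j, g i j * e j * (Z i - Z j)) * S i from
    key fun i => ∑ k, g i k * (Z i - Z k) ^ 3
  intro S
  have e1 : ∀ i j, g i j * e i * ((Z i - Z j) * (e i * S i - e j * S j)) =
      e i ^ 2 * (g i j * (Z i - Z j)) * S i - g i j * e i * e j * (Z i - Z j) * S j := by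
    intro i j; ring
  have e2 : ∑ i, ∑ j, g i j * e i * e j * (Z i - Z j) * S j =
      -∑ i, e i * (∑ j, g i j * e j * (Z i - Z j)) * S i := by
    rw [Finset.sum_comm, ← Finset.sum_neg_distrib]
    refine Finset.sum_congr rfl fun i _ => ?_
    rw [Finset.mul_sum, Finset.sum_mul, ← Finset.sum_neg_distrib]
    exact Finset.sum_congr rfl fun j _ => by rw [hg j i]; ring
  simp only [e1, Finset.sum_sub_distrib, e2, ← Finset.mul_sum, ← Finset.sum_mul, sub_neg_eq_add]

/-- The term `(1/4) c4 c4` of Getzler's polynomial. -/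
theorem sum_delta_quartic (hg : ∀ i j, g i j = g j i) (hg0 : ∀ i, g i i = 0) :
    (∑ i, ∑ j, g i j * e i * (Z i - Z j) ^ 2 * ∑ k, ∑ l, g k l * e k * (Z k - Z l) ^ 2
      * (((if i = k then 1 else 0) - (if j = k then 1 else 0)) *
        ((if k = i then 1 else 0) - (if l = i then 1 else 0)))) =
    (∑ i, e i ^ 2 * (∑ j, g i j * (Z i - Z j) ^ 2) ^ 2)
      + ∑ i, ∑ j, g i j ^ 2 * e i * e j * (Z i - Z j) ^ 4 := by
  have e1 : ∀ i j, g i j * (∑ k, ∑ l, g k l * e k * (Z k - Z l) ^ 2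
      * (((if i = k then 1 else 0) - (if j = k then 1 else 0)) *
        ((if k = i then 1 else 0) - (if l = i then 1 else 0)))) =
      g i j * (e i * ∑ l, g i l * (Z i - Z l) ^ 2) + g i j * (g i j * e j * (Z i - Z j) ^ 2) := by
    intro i j
    by_cases hij : i = j
    · subst hij; simp [hg0]
    rw [← mul_add]
    congr 1
    have e2 : ∀ k l, g k l * e k * (Z k - Z l) ^ 2
      * (((if i = k then 1 else 0) - (if j = k then 1 else 0)) *
        ((if k = i then 1 else 0) - (if l = i then 1 else 0))) =
        (if k = i then g k l * e k * (Z k - Z l) ^ 2 else 0)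
        - (if k = i then if l = i then g k l * e k * (Z k - Z l) ^ 2 else 0 else 0)
        + (if k = j then if l = i then g k l * e k * (Z k - Z l) ^ 2 else 0 else 0) := by
      intro k l
      by_cases h1 : k = i
      · subst h1
        by_cases h3 : l = k
        · simp [h3, hij]
        · simp [h3, Ne.symm hij]
      · by_cases h2 : k = j
        · subst h2
          by_cases h3 : l = i
          · simp [h3, h1, hij]
          · simp [h1, h3]
        · simp [h1, h2, Ne.symm h1, Ne.symm h2]
    simp only [e2, Finset.sum_add_distrib, Finset.sum_sub_distrib]
    have e3 : ∀ (a : Fin n) (f : Fin n → Fin n → ℂ),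
        ∑ k, ∑ l, (if k = a then f k l else 0) = ∑ l, f a l := by
      intro a f
      rw [Finset.sum_comm]
      simp
    rw [e3, e3, e3]
    simp only [Finset.sum_ite_eq', Finset.mem_univ, if_true, hg0, Finset.mul_sum]
    rw [hg j i]
    have : ∑ l, g i l * e i * (Z i - Z l) ^ 2 = ∑ l, e i * (g i l * (Z i - Z l) ^ 2) :=
      Finset.sum_congr rfl fun _ _ => by ring
    rw [this]
    ring
  rw [← Finset.sum_add_distrib]
  refine Finset.sum_congr rfl fun i _ => ?_
  calc _ = ∑ j, e i * (Z i - Z j) ^ 2 * (g i j * (∑ k, ∑ l, g k l * e k * (Z k - Z l) ^ 2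
      * (((if i = k then 1 else 0) - (if j = k then 1 else 0)) *
        ((if k = i then 1 else 0) - (if l = i then 1 else 0))))) :=
        Finset.sum_congr rfl fun j _ => by ring
    _ = ∑ j, ((g i j * (Z i - Z j) ^ 2) * (e i ^ 2 * ∑ l, g i l * (Z i - Z l) ^ 2)
        + g i j ^ 2 * e i * e j * (Z i - Z j) ^ 4) := by
        refine Finset.sum_congr rfl fun j _ => ?_
        rw [e1]
        ring
    _ = _ := by
        rw [Finset.sum_add_distrib, ← Finset.sum_mul]
        ring

/-- The term with the fifth derivatives of the potential: `dg k i j` stands for the derivative of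
`g i j` along the `k`-th idempotent, and the rest is the derivative of `(Z_i - Z_j)^4`. -/
theorem sum_derivative_quartic (hg : ∀ i j, g i j = g j i) (dg : Fin n → Fin n → Fin n → ℂ) :
    (∑ k, e k * ((1 / 2) * ∑ i, ∑ j, (dg k i j * (Z i - Z j) ^ 4 + g i j * (4 * (Z i - Z j) ^ 3 *
      (e i * (g i k * (Z k - Z i) - if i = k then ∑ m, g i m * (Z m - Z i) else 0)
      - e j * (g j k * (Z k - Z j) - if j = k then ∑ m, g j m * (Z m - Z j) else 0)))))) =
    (1 / 2) * (∑ i, ∑ j, (∑ k, e k * dg k i j) * (Z i - Z j) ^ 4)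
      + 4 * ((∑ i, e i ^ 2 * (∑ j, g i j * (Z i - Z j)) * (∑ k, g i k * (Z i - Z k) ^ 3))
      - ∑ i, e i * (∑ j, g i j * e j * (Z i - Z j)) * (∑ k, g i k * (Z i - Z k) ^ 3)) := by
  obtain ⟨d, hd⟩ : ∃ d : Fin n → Fin n → ℂ, ∀ k i, d k i = e i * (g i k * (Z k - Z i) -
      if i = k then ∑ m, g i m * (Z m - Z i) else 0) := ⟨_, fun _ _ => rfl⟩
  simp only [← hd]
  have e1 : ∀ i, ∑ k, e k * d k i = e i ^ 2 * (∑ j, g i j * (Z i - Z j))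
      - e i * ∑ j, g i j * e j * (Z i - Z j) := by
    intro i
    have : ∀ k, e k * d k i = -(e i * (g i k * e k * (Z i - Z k)))
        - if i = k then e i ^ 2 * ∑ m, g i m * (Z m - Z i) else 0 := by
      intro k
      by_cases h : i = k
      · subst h; simp [hd]; ring
      · simp [hd, h]; ring
    simp only [this, Finset.sum_sub_distrib, Finset.sum_neg_distrib, ← Finset.mul_sum]
    simp only [Finset.sum_ite_eq, Finset.mem_univ, if_true]
    have h2 : ∑ m, g i m * (Z m - Z i) = -∑ m, g i m * (Z i - Z m) := by
      rw [← Finset.sum_neg_distrib]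
      exact Finset.sum_congr rfl fun _ _ => by ring
    rw [h2]
    ring
  have e2 : ∀ k, ∑ i, ∑ j, (dg k i j * (Z i - Z j) ^ 4 + g i j * (4 * (Z i - Z j) ^ 3 *
      (d k i - d k j))) = (∑ i, ∑ j, dg k i j * (Z i - Z j) ^ 4)
      + 8 * ∑ i, (∑ j, g i j * (Z i - Z j) ^ 3) * d k i := by
    intro k
    have h1 : ∑ i, ∑ j, g i j * (Z i - Z j) ^ 3 * d k j =
        -∑ i, (∑ j, g i j * (Z i - Z j) ^ 3) * d k i := by
      rw [Finset.sum_comm, ← Finset.sum_neg_distrib]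
      refine Finset.sum_congr rfl fun i _ => ?_
      rw [Finset.sum_mul, ← Finset.sum_neg_distrib]
      exact Finset.sum_congr rfl fun j _ => by rw [hg j i]; ring
    have h2 : ∀ i j, dg k i j * (Z i - Z j) ^ 4 + g i j * (4 * (Z i - Z j) ^ 3 * (d k i - d k j)) =
        dg k i j * (Z i - Z j) ^ 4 + 4 * (g i j * (Z i - Z j) ^ 3 * d k i)
        - 4 * (g i j * (Z i - Z j) ^ 3 * d k j) := by
      intro i j; ring
    simp only [h2, Finset.sum_add_distrib, Finset.sum_sub_distrib, ← Finset.mul_sum, h1,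
      ← Finset.sum_mul]
    ring
  have e3 : ∑ k, e k * ((1 / 2) * ((∑ i, ∑ j, dg k i j * (Z i - Z j) ^ 4)
      + 8 * ∑ i, (∑ j, g i j * (Z i - Z j) ^ 3) * d k i)) =
      (1 / 2) * (∑ k, ∑ i, ∑ j, e k * dg k i j * (Z i - Z j) ^ 4)
      + 4 * ∑ k, ∑ i, (∑ j, g i j * (Z i - Z j) ^ 3) * (e k * d k i) := by
    rw [Finset.mul_sum, Finset.mul_sum, ← Finset.sum_add_distrib]
    refine Finset.sum_congr rfl fun k _ => ?_
    have h1 : ∑ i, (∑ j, g i j * (Z i - Z j) ^ 3) * (e k * d k i) =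
        e k * ∑ i, (∑ j, g i j * (Z i - Z j) ^ 3) * d k i := by
      rw [Finset.mul_sum]
      exact Finset.sum_congr rfl fun _ _ => by ring
    rw [h1]
    simp only [mul_assoc, ← Finset.mul_sum]
    ring
  simp only [e2]
  rw [e3]
  congr 1
  · congr 1
    rw [Finset.sum_comm]
    refine Finset.sum_congr rfl fun i _ => ?_
    rw [Finset.sum_comm]
    simp only [Finset.sum_mul]
  · congr 1
    rw [Finset.sum_comm]
    simp only [← Finset.mul_sum, e1]
    rw [← Finset.sum_sub_distrib]
    exact Finset.sum_congr rfl fun _ _ => by ring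

/-- The terms with second derivatives of `G`.  The rows of the Hessian `B` sum to zero when `G` is
constant along the unit field, and this supplies the missing monomials of `(Z_i - Z_j)^4`. -/
theorem sum_hessian_quartic (B : Fin n → Fin n → ℂ) (hB : ∀ i j, B i j = B j i)
    (hB0 : ∀ i, ∑ j, B i j = 0) :
    (∑ i, ∑ j, B j i * (3 * Z i ^ 2 * Z j ^ 2 - 4 * Z i ^ 3 * Z j)) =
      (1 / 2) * ∑ i, ∑ j, B i j * (Z i - Z j) ^ 4 := by
  have h1 : ∑ i, ∑ j, B i j * Z i ^ 4 = 0 := by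
    simp [← Finset.sum_mul, hB0]
  have h2 : ∑ i, ∑ j, B i j * Z j ^ 4 = 0 := by
    rw [Finset.sum_comm]
    simp only [← Finset.sum_mul, hB _]
    simp [hB0]
  have h3 : ∑ i, ∑ j, B i j * (Z i * Z j ^ 3) = ∑ i, ∑ j, B i j * (Z i ^ 3 * Z j) := by
    rw [Finset.sum_comm]
    exact Finset.sum_congr rfl fun i _ => Finset.sum_congr rfl fun j _ => by rw [hB]; ring
  have e1 : ∀ i j, B i j * (Z i - Z j) ^ 4 = B i j * Z i ^ 4 + B i j * Z j ^ 4
      - 4 * (B i j * (Z i * Z j ^ 3)) - 4 * (B i j * (Z i ^ 3 * Z j))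
      + 6 * (B i j * (Z i ^ 2 * Z j ^ 2)) := by
    intro i j; ring
  have e2 : ∀ i j, B j i * (3 * Z i ^ 2 * Z j ^ 2 - 4 * Z i ^ 3 * Z j) =
      3 * (B i j * (Z i ^ 2 * Z j ^ 2)) - 4 * (B i j * (Z i ^ 3 * Z j)) := by
    intro i j; rw [hB j i]; ring
  simp only [e1, e2, Finset.sum_add_distrib, Finset.sum_sub_distrib, ← Finset.mul_sum, h1, h2, h3]
  ring

/-- The coefficients off the diagonal are determined by the quartic.  The values `Z = e_i` show that
the rows of the matrix sum to zero; then `Z = e_i + e_j` isolates the coefficient at `(i, j)`. -/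
theorem eq_zero_of_sum_quartic (X : Fin n → Fin n → ℂ) (hX : ∀ i j, X i j = X j i)
    (h : ∀ Z : Fin n → ℂ, ∑ i, ∑ j, X i j * (Z i - Z j) ^ 4 = 0) {i j : Fin n} (hij : i ≠ j) :
    X i j = 0 := by
  -- the diagonal of `X` does not contribute
  set X' : Fin n → Fin n → ℂ := fun i j => if i = j then 0 else X i j with hX'
  have hs : ∀ i j, X' i j = X' j i := by
    intro i j
    by_cases h : i = j
    · simp [h]
    · simp [hX', h, Ne.symm h, hX i j]
  have h' : ∀ Z : Fin n → ℂ, ∑ i, ∑ j, X' i j * (Z i - Z j) ^ 4 = 0 := by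
    intro Z
    rw [← h Z]
    refine Finset.sum_congr rfl fun i _ => Finset.sum_congr rfl fun j _ => ?_
    by_cases h : i = j
    · simp [hX', h]
    · simp [hX', h]
  have row : ∀ i, ∑ j, X' i j = 0 := by
    intro i
    have h1 := h' (Pi.single i 1)
    have e1 : ∀ k l, X' k l * ((Pi.single i 1 : Fin n → ℂ) k - (Pi.single i 1 : Fin n → ℂ) l) ^ 4 =
        (if k = i then X' k l else 0) + (if l = i then X' k l else 0) := by
      intro k l
      by_cases hk : k = i
      · by_cases hl : l = i
        · simp [hk, hl, hX']
        · simp [hk, hl]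
      · by_cases hl : l = i
        · simp [hk, hl]; ring
        · simp [hk, hl]
    simp only [e1, Finset.sum_add_distrib, Finset.sum_ite_eq', Finset.mem_univ, if_true] at h1
    rw [Finset.sum_comm] at h1
    simp only [Finset.sum_ite_eq', Finset.mem_univ, if_true] at h1
    have h2 : ∑ k, X' k i = ∑ k, X' i k := Finset.sum_congr rfl fun k _ => hs k i
    rw [h2] at h1
    linear_combination h1 / 2
  have h1 := h' (Pi.single i 1 + Pi.single j 1)
  have e1 : ∀ k l, X' k l * ((Pi.single i 1 + Pi.single j 1 : Fin n → ℂ) k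
      - (Pi.single i 1 + Pi.single j 1 : Fin n → ℂ) l) ^ 4 =
      (if k = i then X' k l else 0) + (if k = j then X' k l else 0)
      + (if l = i then X' k l else 0) + (if l = j then X' k l else 0)
      - 2 * (if k = i then (if l = j then X' k l else 0) else 0)
      - 2 * (if k = j then (if l = i then X' k l else 0) else 0) := by
    intro k l
    by_cases hkl : k = l
    · subst hkl
      simp [hX']
    by_cases hk : k = i
    · have hkj : k ≠ j := by rw [hk]; exact hij
      by_cases hl : l = j
      · have hli : l ≠ i := by rw [hl]; exact hij.symm
        simp [hk, hl, hij, hij.symm]; ring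
      · have hli : l ≠ i := by rw [← hk]; exact Ne.symm hkl
        simp [hk, hl, hij, hli]
    · by_cases hk' : k = j
      · have hlj : l ≠ j := by rw [← hk']; exact Ne.symm hkl
        by_cases hl : l = i
        · simp [hk', hl, hij, hij.symm]; ring
        · simp [hk', hl, hij.symm, hlj]
      · by_cases hl : l = i
        · simp [hk, hk', hl, hij]; ring
        · by_cases hl' : l = j
          · simp [hk, hk', hl', hij.symm]; ring
          · simp [hk, hk', hl, hl']
  have c : ∀ i, ∑ k, X' k i = 0 := fun i => by
    rw [← row i]; exact Finset.sum_congr rfl fun k _ => hs k i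
  have e3 : ∀ (a : Fin n) (f : Fin n → Fin n → ℂ),
      ∑ k, ∑ l, (if k = a then f k l else 0) = ∑ l, f a l := by
    intro a f
    rw [Finset.sum_comm]
    simp
  simp only [e1, Finset.sum_add_distrib, Finset.sum_sub_distrib, ← Finset.mul_sum, e3] at h1
  simp only [Finset.sum_ite_eq', Finset.mem_univ, if_true, row, c] at h1
  rw [hs j i] at h1
  have h4 : X' i j = X i j := by simp [hX', hij]
  rw [← h4]
  linear_combination -h1 / 4

end Quartic

/-! ### Getzler's polynomial in a frame of idempotents -/

theorem pairing.map_derivation {n : ℕ} {R : Type*} [CommRing R] [Algebra ℂ R] (z : Fin n → ℂ) (D : Derivation ℂ R R) (f : Fin n → R) :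
    D (pairing (fun a => algebraMap ℂ R (z a)) f) =
      pairing (fun a => algebraMap ℂ R (z a)) fun a => D (f a) := by
  simp [pairing]

namespace IdempotentFrame

variable {n : ℕ} [NeZero n] {R : Type*} [CommRing R] [Algebra ℂ R] (Φ : IdempotentFrame n R)

/-- The fourth derivatives of the potential in terms of the rotation coefficients. -/
theorem F4_eq (a b c d) : Φ.F4 a b c d = ∑ i, ∑ j, Φ.rot i j * (Φ.covec i a *
    ((Φ.covec i b - Φ.covec j b) * (Φ.covec i c - Φ.covec j c) * (Φ.covec i d - Φ.covec j d))) := by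
  have h : ∀ i, Φ.D a (Φ.len i * (Φ.covec i b * Φ.covec i c * Φ.covec i d)) =
      ∑ k, (Φ.rot i k * Φ.covec k a - Φ.rot i k * Φ.covec i a) *
        (2 * (Φ.covec i b * Φ.covec i c * Φ.covec i d)
          + (Φ.covec k b - Φ.covec i b) * (Φ.covec i c * Φ.covec i d)
          + (Φ.covec k c - Φ.covec i c) * (Φ.covec i b * Φ.covec i d)
          + (Φ.covec k d - Φ.covec i d) * (Φ.covec i b * Φ.covec i c)) := by
    intro i
    have hl := Φ.len_mul_inv i
    have hd : ∀ b, Φ.len i * Φ.D a (Φ.covec i b) =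
        ∑ k, Φ.rot i k * ((Φ.covec k a - Φ.covec i a) * (Φ.covec k b - Φ.covec i b)) := by
      intro b
      rw [D_covec, ← mul_assoc, hl, one_mul]
    simp only [Derivation.leibniz, smul_eq_mul]
    calc _ = Φ.D a (Φ.len i) * (Φ.covec i b * Φ.covec i c * Φ.covec i d)
          + (Φ.len i * Φ.D a (Φ.covec i b)) * (Φ.covec i c * Φ.covec i d)
          + (Φ.len i * Φ.D a (Φ.covec i c)) * (Φ.covec i b * Φ.covec i d)
          + (Φ.len i * Φ.D a (Φ.covec i d)) * (Φ.covec i b * Φ.covec i c) := by ring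
      _ = _ := by
        rw [hd, hd, hd, D_len]
        simp only [Finset.mul_sum, Finset.sum_mul, ← Finset.sum_add_distrib]
        exact Finset.sum_congr rfl fun _ _ => by ring
  rw [F4, F3_eq, map_sum]
  simp only [h, sub_mul, Finset.sum_sub_distrib]
  rw [Finset.sum_comm, ← Finset.sum_sub_distrib]
  refine Finset.sum_congr rfl fun i _ => ?_
  rw [← Finset.sum_sub_distrib]
  refine Finset.sum_congr rfl fun j _ => ?_
  rw [Φ.rot_symm j i]
  ring

/-- `c^m_{ab}`. -/
def c3 (m a b : Fin n) : R := ∑ ε, algebraMap ℂ R (Φ.η⁻¹ m ε) * Φ.F3 ε a b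

/-- `c^m_{abc}`. -/
def c4 (m a b c : Fin n) : R := ∑ ε, algebraMap ℂ R (Φ.η⁻¹ m ε) * Φ.F4 ε a b c

/-- `c^m_{abcd}`. -/
def c5 (m a b c d : Fin n) : R := ∑ ε, algebraMap ℂ R (Φ.η⁻¹ m ε) * Φ.D ε (Φ.F4 a b c d)

theorem c3_eq (m a b) : Φ.c3 m a b = ∑ i, Φ.vec i m * (Φ.covec i a * Φ.covec i b) := by
  simp only [c3, F3_eq, Finset.mul_sum]
  rw [Finset.sum_comm]
  refine Finset.sum_congr rfl fun i _ => ?_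
  rw [vec_eq, Finset.mul_sum, Finset.sum_mul]
  exact Finset.sum_congr rfl fun _ _ => by ring

theorem c4_eq (m a b c) : Φ.c4 m a b c = ∑ i, ∑ j, Φ.vec i m * (Φ.rot i j * Φ.inv i *
    ((Φ.covec i a - Φ.covec j a) * (Φ.covec i b - Φ.covec j b) *
      (Φ.covec i c - Φ.covec j c))) := by
  simp only [c4, F4_eq, Finset.mul_sum]
  rw [Finset.sum_comm]
  refine Finset.sum_congr rfl fun i _ => ?_
  rw [Finset.sum_comm]
  refine Finset.sum_congr rfl fun j _ => ?_
  calc _ = Φ.inv i * Φ.vec i m * (Φ.rot i j * ((Φ.covec i a - Φ.covec j a) *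
        (Φ.covec i b - Φ.covec j b) * (Φ.covec i c - Φ.covec j c))) := by
        rw [← sum_inv_covec, Finset.sum_mul]
        exact Finset.sum_congr rfl fun _ _ => by ring
    _ = _ := by ring

theorem c5_covec (k a b c d) : ∑ m, Φ.c5 m a b c d * Φ.covec k m =
    Φ.inv k * Φ.del k (Φ.F4 a b c d) := by
  rw [del_apply, comp, pairing, Finset.mul_sum]
  simp only [c5, Finset.sum_mul]
  rw [Finset.sum_comm]
  refine Finset.sum_congr rfl fun ε _ => ?_
  rw [← mul_assoc, ← sum_inv_covec, Finset.sum_mul]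
  refine Finset.sum_congr rfl fun m _ => ?_
  have : Φ.η⁻¹ m ε = Φ.η⁻¹ ε m := by
    have h : Φ.η⁻¹.transpose = Φ.η⁻¹ := by
      rw [Matrix.transpose_nonsing_inv, Φ.η_symm.eq]
    exact congr_fun (congr_fun h ε) m
  rw [this]
  ring

/-- Canonical components `du_i(z)` of a constant vector `z`. -/
def can (z : Fin n → ℂ) (i : Fin n) : R := pairing (fun a => algebraMap ℂ R (z a)) (Φ.covec i)

theorem pairing_covec (z : Fin n → ℂ) (i) :
    pairing (fun a => algebraMap ℂ R (z a)) (Φ.covec i) = Φ.can z i := rfl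

open pairing in
theorem del_can (z : Fin n → ℂ) (k i) : Φ.del k (Φ.can z i) =
    Φ.inv i * (Φ.rot i k * (Φ.can z k - Φ.can z i)
    - if i = k then ∑ m, Φ.rot i m * (Φ.can z m - Φ.can z i) else 0) := by
  simp only [can, map_derivation, del_covec, const_mul, sub]
  by_cases h : i = k
  · subst h; simp [sum, const_mul, sub]
  · simp [h, zero]

open pairing in
/-- The fourth derivatives contracted with a constant vector. -/
theorem two_mul_F4_can (z : Fin n → ℂ) :
    2 * (pairing (fun a => algebraMap ℂ R (z a)) fun a => pairing (fun a => algebraMap ℂ R (z a)) fun b =>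
      pairing (fun a => algebraMap ℂ R (z a)) fun c => pairing (fun a => algebraMap ℂ R (z a)) fun d =>
        Φ.F4 a b c d) = ∑ i, ∑ j, Φ.rot i j * (Φ.can z i - Φ.can z j) ^ 4 := by
  simp only [F4_eq, sum, const_mul, mul_const, sub, pairing_covec]
  have : ∑ i, ∑ j, Φ.rot i j * (Φ.can z i * ((Φ.can z i - Φ.can z j) * (Φ.can z i - Φ.can z j) *
      (Φ.can z i - Φ.can z j))) = -∑ i, ∑ j, Φ.rot i j * (Φ.can z j * ((Φ.can z i - Φ.can z j) *
        (Φ.can z i - Φ.can z j) * (Φ.can z i - Φ.can z j))) := by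
    rw [Finset.sum_comm, ← Finset.sum_neg_distrib]
    refine Finset.sum_congr rfl fun i _ => ?_
    rw [← Finset.sum_neg_distrib]
    refine Finset.sum_congr rfl fun j _ => ?_
    rw [Φ.rot_symm j i]
    ring
  rw [two_mul]
  nth_rewrite 2 [this]
  rw [← sub_eq_add_neg]
  simp only [← Finset.sum_sub_distrib]
  exact Finset.sum_congr rfl fun _ _ => Finset.sum_congr rfl fun _ _ => by ring

/-- The value of Getzler's polynomial for `G` at `z`; the coefficients are evaluated by a
homomorphism to `ℂ`, such as the evaluation at a point. -/
def getzler (G : R) (z : Fin n → ℂ) (ev : R →+* ℂ) : ℂ :=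
  ∑ a₁, ∑ a₂, ∑ a₃, ∑ a₄, z a₁ * z a₂ * z a₃ * z a₄ * ∑ m, ∑ v,
    (3 * ev (Φ.c3 m a₁ a₂) * ev (Φ.c3 v a₃ a₄) * ev (Φ.D m (Φ.D v G))
      - 4 * ev (Φ.c3 m a₁ a₂) * ev (Φ.c3 v a₃ m) * ev (Φ.D a₄ (Φ.D v G))
      - ev (Φ.c3 m a₁ a₂) * ev (Φ.c4 v a₃ a₄ m) * ev (Φ.D v G)
      + 2 * ev (Φ.c4 m a₁ a₂ a₃) * ev (Φ.c3 v a₄ m) * ev (Φ.D v G)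
      + (1 / 6) * ev (Φ.c4 m a₁ a₂ a₃) * ev (Φ.c4 v a₄ m v)
      + (1 / 24) * ev (Φ.c5 m a₁ a₂ a₃ a₄) * ev (Φ.c3 v m v)
      - (1 / 4) * ev (Φ.c4 m a₁ a₂ v) * ev (Φ.c4 v a₃ a₄ m))

/-- `∂²log τ/∂u_i∂u_j - (1/24) ∂²log J/∂u_i∂u_j` for `i ≠ j`, multiplied by 48. -/
def hess (i j : Fin n) : R := 24 * Φ.rot i j ^ 2 * Φ.inv i * Φ.inv j
  - 2 * ((∑ k, Φ.inv k * Φ.del k (Φ.rot i j)) - 2 * ∑ k, Φ.inv k ^ 2 * Φ.hrot k i * Φ.hrot k j)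

/-- The Hessian in flat coordinates in terms of derivatives along the idempotents. -/
theorem D_D_eq (G : R) (m v) : Φ.D m (Φ.D v G) =
    (∑ i, ∑ k, Φ.inv i * Φ.del i G * Φ.rot i k * ((Φ.covec k m - Φ.covec i m) *
      (Φ.covec k v - Φ.covec i v)))
    + ∑ i, ∑ j, Φ.del j (Φ.del i G) * (Φ.covec j m * Φ.covec i v) := by
  rw [Φ.D_eq_sum v G, map_sum, ← Finset.sum_add_distrib]
  refine Finset.sum_congr rfl fun i _ => ?_
  rw [Derivation.leibniz, smul_eq_mul, smul_eq_mul, D_covec, Φ.D_eq_sum m (Φ.del i G),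
    Finset.mul_sum, Finset.mul_sum, Finset.mul_sum, add_comm]
  congr 1 <;> exact Finset.sum_congr rfl fun _ _ => by ring

open pairing in
/-- Getzler's polynomial as a quartic form in the differences of the canonical components of `z`, for
a function that is constant along the unit field. -/
theorem getzler_eq (G : R) (z : Fin n → ℂ) (ev : R →ₐ[ℂ] ℂ) (hG : Φ.D 0 G = 0) :
    Φ.getzler G z ev = (1 / 2) * ∑ i, ∑ j, (ev (Φ.del i (Φ.del j G)) - (1 / 48) * ev (Φ.hess i j)) *
      (ev (Φ.can z i) - ev (Φ.can z j)) ^ 4 := by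
  have hev : ∀ f : Fin n → R, ev (pairing (fun a => algebraMap ℂ R (z a)) f) =
      pairing z fun a => ev (f a) := by
    intro f; simp [pairing]
  have hZ : ∀ i, pairing z (fun a => ev (Φ.covec i a)) = ev (Φ.can z i) := by
    intro i; rw [can, hev]
  have hg : ∀ i j, ev (Φ.rot i j) = ev (Φ.rot j i) := fun i j => by rw [rot_symm]
  have hg0 : ∀ i, ev (Φ.rot i i) = 0 := fun i => by rw [rot_self, map_zero]
  have h5 : ∀ k, pairing z (fun a₁ => pairing z fun a₂ => pairing z fun a₃ => pairing z fun a₄ =>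
      ∑ m, ev (Φ.c5 m a₁ a₂ a₃ a₄) * ev (Φ.covec k m)) =
      ev (Φ.inv k) * ((1 / 2) * ∑ i, ∑ j, (ev (Φ.del k (Φ.rot i j)) *
        (ev (Φ.can z i) - ev (Φ.can z j)) ^ 4 + ev (Φ.rot i j) *
        (4 * (ev (Φ.can z i) - ev (Φ.can z j)) ^ 3 *
      (ev (Φ.inv i) * (ev (Φ.rot i k) * (ev (Φ.can z k) - ev (Φ.can z i)) - if i = k then
        ∑ m, ev (Φ.rot i m) * (ev (Φ.can z m) - ev (Φ.can z i)) else 0)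
      - ev (Φ.inv j) * (ev (Φ.rot j k) * (ev (Φ.can z k) - ev (Φ.can z j)) - if j = k then
        ∑ m, ev (Φ.rot j m) * (ev (Φ.can z m) - ev (Φ.can z j)) else 0))))) := by
    intro k
    have e1 : ∀ a₁ a₂ a₃ a₄, ∑ m, ev (Φ.c5 m a₁ a₂ a₃ a₄) * ev (Φ.covec k m) =
        ev (Φ.inv k) * ev (Φ.del k (Φ.F4 a₁ a₂ a₃ a₄)) := by
      intro a₁ a₂ a₃ a₄
      rw [← map_mul, ← c5_covec, map_sum]
      simp only [map_mul]
    simp only [e1, const_mul, ← hev, ← map_derivation]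
    congr 1
    have e2 := congr_arg (fun x => ev (Φ.del k x)) (Φ.two_mul_F4_can z)
    simp only [map_sum, Derivation.leibniz, Derivation.leibniz_pow, del_can, map_add, map_mul,
      smul_eq_mul, map_ofNat, map_sub, nsmul_eq_mul, map_natCast, map_pow] at e2
    have e3 : Φ.del k (2 : R) = 0 := by
      rw [← map_ofNat (algebraMap ℂ R) 2, Derivation.map_algebraMap]
    rw [e3, map_zero, mul_zero, add_zero] at e2
    have e4 : ∀ i, ev (if i = k then ∑ m, Φ.rot i m * (Φ.can z m - Φ.can z i) else 0) =
        if i = k then ∑ m, ev (Φ.rot i m) * (ev (Φ.can z m) - ev (Φ.can z i)) else 0 := by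
      intro i
      split_ifs <;> simp
    simp only [e4] at e2
    have e5 : ∀ x y : ℂ, 2 * x = y → x = 1 / 2 * y := by
      intro x y h; rw [← h]; ring
    refine e5 _ _ (e2.trans ?_)
    refine Finset.sum_congr rfl fun i _ => Finset.sum_congr rfl fun j _ => ?_
    norm_num
    ring
  have main := getzler_contract (fun i a => ev (Φ.covec i a)) (fun i a => ev (Φ.vec i a))
    (fun i j => ev (Φ.rot i j)) (fun i => ev (Φ.inv i)) (fun i => ev (Φ.del i G)) _
    (fun i j => ev (Φ.del i (Φ.del j G)))
    (by
      intro i j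
      have := congr_arg ev (Φ.covec_vec j i)
      rw [map_sum] at this
      simp only [map_mul] at this
      rw [pairing]
      simp only [mul_comm (ev (Φ.vec _ _)), this]
      split_ifs <;> simp) hg0
    (fun m a b => ev (Φ.c3 m a b)) (fun m a b c => ev (Φ.c4 m a b c))
    (fun m a b c d => ev (Φ.c5 m a b c d)) (fun v => ev (Φ.D v G)) (fun m v => ev (Φ.D m (Φ.D v G)))
    z (fun i => ev (Φ.can z i)) hZ (by intro m a b; simp [c3_eq])
    (by intro m a b c; simp [c4_eq]) h5
    (by intro v; rw [D_eq_sum, map_sum]; exact Finset.sum_congr rfl fun _ _ => by simp [mul_comm])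
    (by intro m v; rw [D_D_eq]; simp)
  have hB : ∀ i j, ev (Φ.del i (Φ.del j G)) = ev (Φ.del j (Φ.del i G)) := fun i j => by
    rw [del_comm]
  have hB0 : ∀ i, ∑ j, ev (Φ.del i (Φ.del j G)) = 0 := by
    intro i
    rw [← map_sum, ← map_sum, sum_del, hG, map_zero, map_zero]
  -- the rows of `hrot` sum to zero, and the diagonal of `hrot` is multiplied by `Z_k - Z_k`
  have hk : ∀ k, ∑ i, ∑ j, ev (Φ.hrot k i) * ev (Φ.hrot k j) * (ev (Φ.can z i) - ev (Φ.can z j)) ^ 4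
      = 6 * (∑ j, ev (Φ.rot k j) * (ev (Φ.can z k) - ev (Φ.can z j)) ^ 2) ^ 2
        - 8 * (∑ j, ev (Φ.rot k j) * (ev (Φ.can z k) - ev (Φ.can z j))) *
          ∑ j, ev (Φ.rot k j) * (ev (Φ.can z k) - ev (Φ.can z j)) ^ 3 := by
    intro k
    rw [sum_quartic_of_sum_eq_zero (fun i => ev (Φ.can z i)) (fun i => ev (Φ.hrot k i))
      (by rw [← map_sum, sum_hrot, map_zero]) k]
    have : ∀ m : ℕ, m ≠ 0 → ∑ j, ev (Φ.hrot k j) * (ev (Φ.can z k) - ev (Φ.can z j)) ^ m =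
        ∑ j, ev (Φ.rot k j) * (ev (Φ.can z k) - ev (Φ.can z j)) ^ m := by
      intro m hm
      refine Finset.sum_congr rfl fun j _ => ?_
      by_cases h : k = j
      · subst h; simp [hm]
      · rw [Φ.hrot_of_ne h]
    have h1 := this 1 one_ne_zero
    simp only [pow_one] at h1
    rw [this 2 two_ne_zero, this 3 three_ne_zero, h1]
  rw [getzler]
  refine main.trans ?_
  rw [sum_hessian_quartic _ _ hB hB0, sum_connection_quartic _ _ _ hg,
    sum_delta_quartic _ _ _ hg hg0, sum_derivative_quartic _ _ _ hg]
  have hK : ∑ i, ∑ j, ev (Φ.hess i j) * (ev (Φ.can z i) - ev (Φ.can z j)) ^ 4 =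
      24 * (∑ i, ∑ j, ev (Φ.rot i j) ^ 2 * ev (Φ.inv i) * ev (Φ.inv j) *
        (ev (Φ.can z i) - ev (Φ.can z j)) ^ 4)
      - 2 * (∑ i, ∑ j, (∑ k, ev (Φ.inv k) * ev (Φ.del k (Φ.rot i j))) *
        (ev (Φ.can z i) - ev (Φ.can z j)) ^ 4)
      + 4 * ∑ k, ev (Φ.inv k) ^ 2 * (6 * (∑ j, ev (Φ.rot k j) * (ev (Φ.can z k) - ev (Φ.can z j)) ^ 2) ^ 2
        - 8 * (∑ j, ev (Φ.rot k j) * (ev (Φ.can z k) - ev (Φ.can z j))) *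
          ∑ j, ev (Φ.rot k j) * (ev (Φ.can z k) - ev (Φ.can z j)) ^ 3) := by
    have e1 : ∑ k, ev (Φ.inv k) ^ 2 * (∑ i, ∑ j, ev (Φ.hrot k i) * ev (Φ.hrot k j) *
        (ev (Φ.can z i) - ev (Φ.can z j)) ^ 4) =
        ∑ i, ∑ j, (∑ k, ev (Φ.inv k) ^ 2 * ev (Φ.hrot k i) * ev (Φ.hrot k j)) *
          (ev (Φ.can z i) - ev (Φ.can z j)) ^ 4 := by
      simp only [Finset.mul_sum, Finset.sum_mul]
      rw [Finset.sum_comm]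
      refine Finset.sum_congr rfl fun i _ => ?_
      rw [Finset.sum_comm]
      exact Finset.sum_congr rfl fun _ _ => Finset.sum_congr rfl fun _ _ => by ring
    simp only [← hk]
    rw [e1]
    have lin : ∀ a b c : Fin n → Fin n → ℂ, 24 * (∑ i, ∑ j, a i j) - 2 * (∑ i, ∑ j, b i j)
        + 4 * (∑ i, ∑ j, c i j) = ∑ i, ∑ j, (24 * a i j - 2 * b i j + 4 * c i j) := by
      intro a b c
      simp only [Finset.mul_sum, Finset.sum_add_distrib, Finset.sum_sub_distrib]
    rw [lin]
    refine Finset.sum_congr rfl fun i _ => Finset.sum_congr rfl fun j _ => ?_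
    simp only [hess, map_sub, map_mul, map_pow, map_sum, map_ofNat]
    ring
  have hS : ∑ k, ev (Φ.inv k) ^ 2 * (6 * (∑ j, ev (Φ.rot k j) * (ev (Φ.can z k) - ev (Φ.can z j)) ^ 2) ^ 2
        - 8 * (∑ j, ev (Φ.rot k j) * (ev (Φ.can z k) - ev (Φ.can z j))) *
          ∑ j, ev (Φ.rot k j) * (ev (Φ.can z k) - ev (Φ.can z j)) ^ 3) =
      6 * (∑ k, ev (Φ.inv k) ^ 2 * (∑ j, ev (Φ.rot k j) * (ev (Φ.can z k) - ev (Φ.can z j)) ^ 2) ^ 2)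
      - 8 * ∑ k, ev (Φ.inv k) ^ 2 * (∑ j, ev (Φ.rot k j) * (ev (Φ.can z k) - ev (Φ.can z j))) *
          ∑ j, ev (Φ.rot k j) * (ev (Φ.can z k) - ev (Φ.can z j)) ^ 3 := by
    rw [Finset.mul_sum, Finset.mul_sum, ← Finset.sum_sub_distrib]
    exact Finset.sum_congr rfl fun _ _ => by ring
  rw [hS] at hK
  have e1 : ∑ i, ∑ j, (ev (Φ.del i (Φ.del j G)) - (1 / 48) * ev (Φ.hess i j)) *
      (ev (Φ.can z i) - ev (Φ.can z j)) ^ 4 = (∑ i, ∑ j, ev (Φ.del i (Φ.del j G)) *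
      (ev (Φ.can z i) - ev (Φ.can z j)) ^ 4) - (1 / 48) * ∑ i, ∑ j, ev (Φ.hess i j) *
      (ev (Φ.can z i) - ev (Φ.can z j)) ^ 4 := by
    simp only [sub_mul, Finset.sum_sub_distrib, mul_assoc, ← Finset.mul_sum]
  rw [e1, hK]
  ring

end IdempotentFrame

/-! ### The Euler field and the solution -/

/-- A frame of idempotents together with flat coordinates `t a`, for which the `D a` are the partial
derivatives, and with the quasihomogeneity of the potential. -/
structure ConformalFrame (n : ℕ) [NeZero n] (R : Type*) [CommRing R] [Algebra ℂ R] extends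
    IdempotentFrame n R where
  t : Fin n → R
  D_t : ∀ b a, D b (t a) = if a = b then 1 else 0
  q : Fin n → ℂ
  r : Fin n → ℂ
  d : ℂ
  A : Matrix (Fin n) (Fin n) ℂ
  B : Fin n → ℂ
  C : ℂ
  q_zero : q 0 = 0
  quasihom : ∑ a, (algebraMap ℂ R (1 - q a) * t a + algebraMap ℂ R (r a)) * D a F =
    algebraMap ℂ R (3 - d) * F + algebraMap ℂ R (1 / 2) * ∑ a, ∑ b, algebraMap ℂ R (A a b) * (t a * t b)
      + ∑ a, algebraMap ℂ R (B a) * t a + algebraMap ℂ R C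

namespace ConformalFrame

variable {n : ℕ} [NeZero n] {R : Type*} [CommRing R] [Algebra ℂ R] (Φ : ConformalFrame n R)

theorem eq_of_two_mul {R : Type*} [CommRing R] [Algebra ℂ R] {x y : R} (h : 2 * x = 2 * y) :
    x = y := by
  have h2 : (algebraMap ℂ R (1/2)) * 2 = 1 := by
    rw [← map_ofNat (algebraMap ℂ R) 2, ← map_mul]; norm_num
  linear_combination (algebraMap ℂ R (1/2)) * h - (x - y) * h2

/-- Components of the Euler vector field. -/
def E (a : Fin n) : R := algebraMap ℂ R (1 - Φ.q a) * Φ.t a + algebraMap ℂ R (Φ.r a)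

/-- The derivation along the Euler vector field. -/
def L (f : R) : R := ∑ a, Φ.E a * Φ.D a f

theorem L_mul (f g : R) : Φ.L (f * g) = Φ.L f * g + f * Φ.L g := by
  simp only [L, Derivation.leibniz, smul_eq_mul, Finset.sum_mul, Finset.mul_sum,
    ← Finset.sum_add_distrib]
  exact Finset.sum_congr rfl fun _ _ => by ring

theorem L_sum {κ : Type*} (s : Finset κ) (f : κ → R) : Φ.L (∑ x ∈ s, f x) = ∑ x ∈ s, Φ.L (f x) := by
  simp only [L, map_sum, Finset.mul_sum]
  exact Finset.sum_comm

theorem L_algebraMap (c : ℂ) : Φ.L (algebraMap ℂ R c) = 0 := by simp [L]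

theorem L_one : Φ.L 1 = 0 := by simp [L]

theorem D_E (b a) : Φ.D b (Φ.E a) = if a = b then algebraMap ℂ R (1 - Φ.q b) else 0 := by
  unfold E
  rw [map_add, Derivation.leibniz, Derivation.map_algebraMap, Derivation.map_algebraMap, Φ.D_t]
  by_cases h : a = b
  · subst h; simp
  · simp [h]

theorem D_L (b f) : Φ.D b (Φ.L f) = Φ.L (Φ.D b f) + algebraMap ℂ R (1 - Φ.q b) * Φ.D b f := by
  simp only [L, map_sum, Derivation.leibniz, smul_eq_mul, D_E, Finset.sum_add_distrib]
  simp only [Φ.D_comm b, mul_ite, mul_zero, Finset.sum_ite_eq', Finset.mem_univ, if_true]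
  ring

theorem D_D_linear (a b x : Fin n) : Φ.D a (Φ.D b (Φ.t x)) = 0 := by
  rw [Φ.D_t]
  split_ifs <;> simp

theorem L_F3 (a b c) : Φ.L (Φ.F3 a b c) =
    algebraMap ℂ R (Φ.q a + Φ.q b + Φ.q c - Φ.d) * Φ.F3 a b c := by
  have h := congr_arg (fun x => Φ.D a (Φ.D b (Φ.D c x))) Φ.quasihom
  have hL : ∑ a, (algebraMap ℂ R (1 - Φ.q a) * Φ.t a + algebraMap ℂ R (Φ.r a)) * Φ.D a Φ.F
      = Φ.L Φ.F := rfl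
  rw [hL] at h
  simp only [D_L, map_add, Derivation.leibniz, map_sum, Derivation.map_algebraMap, smul_eq_mul,
    mul_zero, add_zero, map_zero, Finset.sum_const_zero, D_D_linear] at h
  simp only [IdempotentFrame.F3]
  simp only [map_add, map_sub, map_one, map_ofNat] at h ⊢
  linear_combination h

/-- The metric is a conformal Killing tensor: `q_a + q_b = d` where `η_ab ≠ 0`. -/
theorem metric_homogeneous (a b) :
    algebraMap ℂ R (Φ.q a + Φ.q b - Φ.d) * algebraMap ℂ R (Φ.η a b) = 0 := by
  have h := Φ.L_F3 0 a b
  simp only [IdempotentFrame.F3, Φ.unit, L_algebraMap, Φ.q_zero, zero_add] at h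
  exact h.symm

/-- The defect of homogeneity of the covector `du_i`; it is zero. -/
def defect (i a : Fin n) : R := Φ.L (Φ.covec i a) - algebraMap ℂ R (Φ.q a) * Φ.covec i a

/-- The Lie derivative of the metric along the Euler field, in the frame. -/
theorem metric_defect (j k) : (if j = k then Φ.L (Φ.len j) + algebraMap ℂ R Φ.d * Φ.len j else 0)
    + Φ.len k * Φ.comp j (Φ.defect k) + Φ.len j * Φ.comp k (Φ.defect j) = 0 := by
  have h : ∀ a b, ∑ i, ((Φ.L (Φ.len i) + algebraMap ℂ R Φ.d * Φ.len i) * (Φ.covec i a * Φ.covec i b)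
      + Φ.len i * (Φ.defect i a * Φ.covec i b + Φ.covec i a * Φ.defect i b)) = 0 := by
    intro a b
    have h1 := Φ.L_algebraMap (Φ.η a b)
    have h2 := Φ.metric_homogeneous a b
    rw [Φ.metric_eq] at h1 h2
    rw [L_sum] at h1
    rw [← sub_eq_zero.2 (h1.trans h2.symm)]
    rw [Finset.mul_sum, ← Finset.sum_sub_distrib]
    refine Finset.sum_congr rfl fun i _ => ?_
    simp only [L_mul, defect, map_add, map_sub]
    ring
  have h' : (Φ.comp j fun a => Φ.comp k fun b => ∑ i, ((Φ.L (Φ.len i) + algebraMap ℂ R Φ.d * Φ.len i)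
      * (Φ.covec i a * Φ.covec i b)
      + Φ.len i * (Φ.defect i a * Φ.covec i b + Φ.covec i a * Φ.defect i b))) = 0 := by
    simp [h, Φ.comp_zero]
  refine Eq.trans ?_ h'
  simp only [Φ.comp_sum, Φ.comp_add, Φ.comp_const_mul, Φ.comp_mul_const, Φ.comp_covec]
  rw [Finset.sum_add_distrib]
  simp only [mul_add, Finset.sum_add_distrib, add_assoc]
  congr 1
  · by_cases hjk : j = k
    · subst hjk; simp
    · simp [hjk, Ne.symm hjk]
  · simp

/-- The Lie derivative along the Euler field of the third derivatives of the potential, in the frame. -/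
theorem cubic_defect (j k) : (if j = k then Φ.L (Φ.len j) + algebraMap ℂ R Φ.d * Φ.len j else 0)
    + Φ.len k * Φ.comp j (Φ.defect k)
    + (if j = k then 2 * (Φ.len k * Φ.comp k (Φ.defect k)) else 0) = 0 := by
  have h : ∀ a b c, ∑ i, ((Φ.L (Φ.len i) + algebraMap ℂ R Φ.d * Φ.len i) *
      (Φ.covec i a * Φ.covec i b * Φ.covec i c)
      + Φ.len i * (Φ.defect i a * (Φ.covec i b * Φ.covec i c) + Φ.covec i a *
        (Φ.defect i b * Φ.covec i c + Φ.covec i b * Φ.defect i c))) = 0 := by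
    intro a b c
    have h1 := Φ.L_F3 a b c
    rw [Φ.F3_eq, L_sum, Finset.mul_sum, ← sub_eq_zero, ← Finset.sum_sub_distrib] at h1
    rw [← h1]
    refine Finset.sum_congr rfl fun i _ => ?_
    simp only [L_mul, defect, map_add, map_sub]
    ring
  have h' : (Φ.comp j fun a => Φ.comp k fun b => Φ.comp k fun c =>
      ∑ i, ((Φ.L (Φ.len i) + algebraMap ℂ R Φ.d * Φ.len i) *
      (Φ.covec i a * Φ.covec i b * Φ.covec i c)
      + Φ.len i * (Φ.defect i a * (Φ.covec i b * Φ.covec i c) + Φ.covec i a *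
        (Φ.defect i b * Φ.covec i c + Φ.covec i b * Φ.defect i c)))) = 0 := by
    simp [h, Φ.comp_zero]
  refine Eq.trans ?_ h'
  simp only [Φ.comp_sum, Φ.comp_add, Φ.comp_const_mul, Φ.comp_mul_const, Φ.comp_covec]
  rw [Finset.sum_add_distrib]
  simp only [mul_add, Finset.sum_add_distrib, add_assoc]
  congr 1
  · by_cases hjk : j = k
    · subst hjk; simp
    · simp [hjk, Ne.symm hjk]
  · congr 1
    · simp
    · by_cases hjk : j = k
      · subst hjk; simp; ring
      · simp [hjk, Ne.symm hjk]

/-- The difference of `cubic_defect` and `metric_defect` on the diagonal; off the diagonal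
`cubic_defect` suffices. -/
theorem comp_defect (j k) : Φ.comp j (Φ.defect k) = 0 := by
  have hl := Φ.len_mul_inv k
  have h : Φ.len k * Φ.comp j (Φ.defect k) = 0 := by
    have h1 := Φ.cubic_defect j k
    by_cases hjk : j = k
    · subst hjk
      have h2 := Φ.metric_defect j j
      simp only [if_true] at h1 h2
      linear_combination h1 - h2
    · simpa [hjk] using h1
  linear_combination Φ.inv k * h - Φ.comp j (Φ.defect k) * hl

/-- The forms `du_i` are homogeneous of degree one: with respect to the flat frame `dt^a`, of degree
`1 - q_a`, the components have the degree `q_a`. -/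
theorem L_covec (i a) : Φ.L (Φ.covec i a) = algebraMap ℂ R (Φ.q a) * Φ.covec i a := by
  have : Φ.defect i a = 0 :=
    Φ.covector_ext (f := Φ.defect i) (g := fun _ => 0)
      (fun k => by rw [comp_defect, Φ.comp_zero]) a
  exact sub_eq_zero.1 this

theorem L_len (i) : Φ.L (Φ.len i) = -(algebraMap ℂ R Φ.d * Φ.len i) := by
  have h := Φ.cubic_defect i i
  simp only [if_true, comp_defect] at h
  linear_combination h

/-- The canonical coordinates, as the eigenvalues of the multiplication by the Euler field. -/
def u (i : Fin n) : R := ∑ a, Φ.covec i a * Φ.E a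

theorem D_u (b i) : Φ.D b (Φ.u i) = Φ.covec i b := by
  have h : Φ.D b (Φ.u i) = Φ.L (Φ.covec i b) + algebraMap ℂ R (1 - Φ.q b) * Φ.covec i b := by
    simp only [u, L, map_sum, Derivation.leibniz, smul_eq_mul, D_E, Finset.sum_add_distrib,
      Φ.D_covec_symm b]
    simp only [mul_ite, mul_zero, Finset.sum_ite_eq', Finset.mem_univ, if_true]
    ring
  rw [h, L_covec, map_sub, map_one]
  ring

theorem del_u (j i) : Φ.del j (Φ.u i) = if i = j then 1 else 0 := by
  simp only [Φ.del_apply, D_u, Φ.comp_covec]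

theorem L_eq_sum (f) : Φ.L f = ∑ k, Φ.u k * Φ.del k f := by
  simp only [L, Φ.D_eq_sum, u, Finset.mul_sum, Finset.sum_mul]
  rw [Finset.sum_comm]
  exact Finset.sum_congr rfl fun _ _ => Finset.sum_congr rfl fun _ _ => by ring

theorem del_L (j f) : Φ.del j (Φ.L f) = Φ.L (Φ.del j f) + Φ.del j f := by
  simp only [L_eq_sum, map_sum, Derivation.leibniz, smul_eq_mul, del_u, Finset.sum_add_distrib]
  simp only [Φ.del_comm j, mul_ite, mul_one, mul_zero, Finset.sum_ite_eq', Finset.mem_univ,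
    if_true]

theorem L_hrot (i j) : Φ.L (Φ.hrot i j) = -(algebraMap ℂ R (Φ.d + 1) * Φ.hrot i j) := by
  have h := Φ.del_L j (Φ.len i)
  rw [L_len, Φ.del_len, L_mul] at h
  have h2 : Φ.L (2 : R) = 0 := by rw [← map_ofNat (algebraMap ℂ R) 2, L_algebraMap]
  rw [h2, map_neg, Derivation.leibniz, Derivation.map_algebraMap, Φ.del_len, smul_eq_mul] at h
  apply eq_of_two_mul
  rw [map_add, map_one]
  simp only [smul_zero, add_zero] at h
  linear_combination -h

theorem L_inv (i) : Φ.L (Φ.inv i) = algebraMap ℂ R Φ.d * Φ.inv i := by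
  have h := congr_arg Φ.L (Φ.len_mul_inv i)
  rw [L_mul, L_one, L_len] at h
  linear_combination Φ.inv i * h - (Φ.L (Φ.inv i) - algebraMap ℂ R Φ.d * Φ.inv i) * Φ.len_mul_inv i

/-- The square `γ_ij²` of the rotation coefficient. -/
def rotSq (i j : Fin n) : R := Φ.rot i j ^ 2 * (Φ.inv i * Φ.inv j)

theorem rotSq_symm (i j) : Φ.rotSq i j = Φ.rotSq j i := by
  unfold rotSq; rw [Φ.rot_symm]; ring

theorem L_rotSq {i j} (h : i ≠ j) : Φ.L (Φ.rotSq i j) = -(2 * Φ.rotSq i j) := by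
  have h1 := Φ.L_hrot i j
  rw [Φ.hrot_of_ne h] at h1
  simp only [rotSq, sq, L_mul, L_inv, h1, map_add, map_one]
  ring

theorem del_rotSq {i j k} (hij : i ≠ j) (hik : i ≠ k) (hjk : j ≠ k) :
    Φ.del k (Φ.rotSq i j) =
      2 * (Φ.rot i j * Φ.rot i k * Φ.rot j k * (Φ.inv i * Φ.inv j * Φ.inv k)) := by
  simp only [rotSq, sq, Derivation.leibniz, smul_eq_mul, Φ.del_rot hij hik hjk, Φ.del_inv,
    Φ.hrot_of_ne hik, Φ.hrot_of_ne hjk]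
  ring

/-- Twice the isomonodromic Hamiltonian `H_i`. -/
def ham (i : Fin n) : R := ∑ j, (Φ.u i - Φ.u j) * Φ.rotSq i j

/-- The mixed second derivatives of `2 log τ`. -/
theorem del_ham {i j} (h : i ≠ j) : Φ.del j (Φ.ham i) = Φ.rotSq i j := by
  -- `del_rotSq` is symmetric, which turns the derivative along `j` into an Euler derivative
  have e : ∀ k, Φ.del j ((Φ.u i - Φ.u k) * Φ.rotSq i k) =
      (Φ.u i - Φ.u k) * Φ.del k (Φ.rotSq i j) - (if k = j then Φ.rotSq i j else 0)
        - (if k = i then (Φ.u i - Φ.u k) * Φ.del k (Φ.rotSq i j) else 0) := by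
    intro k
    by_cases hkj : k = j
    · subst hkj
      simp [del_u, h, Ne.symm h]
      ring
    · by_cases hki : k = i
      · subst hki; simp [h]
      · have h1 := Φ.del_rotSq (Ne.symm hki) h hkj
        have h2 := Φ.del_rotSq h (Ne.symm hki) (Ne.symm hkj)
        rw [Φ.rot_symm k j] at h1
        simp [del_u, h, hkj, hki, h1, h2]
        ring
  have hL := Φ.L_rotSq h
  rw [L_eq_sum] at hL
  have h0 : ∑ k, Φ.del k (Φ.rotSq i j) = 0 := by
    rw [Φ.sum_del]
    simp [rotSq, Derivation.leibniz, Derivation.leibniz_pow, Φ.del_zero_rot, Φ.D_inv, Φ.D_len,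
      Φ.covec_zero]
  rw [ham, map_sum]
  have h1 : ∑ k, (Φ.u i - Φ.u k) * Φ.del k (Φ.rotSq i j) = 2 * Φ.rotSq i j := by
    simp only [sub_mul, Finset.sum_sub_distrib, hL]
    rw [← Finset.mul_sum, h0]
    ring
  simp only [e, Finset.sum_sub_distrib, Finset.sum_ite_eq', Finset.mem_univ, if_true, h1]
  ring

theorem sum_ham : ∑ i, Φ.ham i = 0 := by
  apply eq_of_two_mul
  have : ∑ i, Φ.ham i = -∑ i, Φ.ham i := by
    conv_lhs => simp only [ham]
    rw [Finset.sum_comm, ← Finset.sum_neg_distrib]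
    refine Finset.sum_congr rfl fun i _ => ?_
    rw [ham, ← Finset.sum_neg_distrib]
    exact Finset.sum_congr rfl fun j _ => by rw [Φ.rotSq_symm]; ring
  linear_combination this

/-- The logarithmic derivative of the Jacobian `J` along the `i`-th idempotent. -/
def logJac (i : Fin n) : R := ∑ k, Φ.inv k * Φ.hrot k i

theorem sum_logJac : ∑ i, Φ.logJac i = 0 := by
  simp only [logJac]
  rw [Finset.sum_comm]
  simp [← Finset.mul_sum, Φ.sum_hrot]

/-- The degree of the Jacobian `J`. -/
theorem sum_u_logJac : ∑ i, Φ.u i * Φ.logJac i = algebraMap ℂ R (-(n * Φ.d / 2)) := by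
  apply eq_of_two_mul
  have h : ∀ k, ∑ i, Φ.u i * (2 * Φ.hrot k i) = -(algebraMap ℂ R Φ.d * Φ.len k) := by
    intro k
    rw [← L_len, L_eq_sum]
    simp only [Φ.del_len]
  have e : 2 * algebraMap ℂ R (-(n * Φ.d / 2)) = ∑ k : Fin n, -algebraMap ℂ R Φ.d := by
    rw [Finset.sum_const, Finset.card_univ, Fintype.card_fin, nsmul_eq_mul,
      ← map_ofNat (algebraMap ℂ R) 2, ← map_natCast (algebraMap ℂ R) n, ← map_neg, ← map_mul,
      ← map_mul]
    congr 1
    ring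
  rw [e]
  simp only [logJac, Finset.mul_sum]
  rw [Finset.sum_comm]
  refine Finset.sum_congr rfl fun k _ => ?_
  calc _ = Φ.inv k * ∑ i, Φ.u i * (2 * Φ.hrot k i) := by
        rw [Finset.mul_sum]; exact Finset.sum_congr rfl fun _ _ => by ring
    _ = _ := by rw [h]; linear_combination -algebraMap ℂ R Φ.d * Φ.len_mul_inv k

/-- The mixed second derivatives of `log J`. -/
theorem del_logJac {i j} (h : i ≠ j) : Φ.del j (Φ.logJac i) =
    (∑ k, Φ.inv k * Φ.del k (Φ.rot i j)) - 2 * ∑ k, Φ.inv k ^ 2 * Φ.hrot k i * Φ.hrot k j := by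
  have e : ∀ k, Φ.del j (Φ.hrot k i) = Φ.del k (Φ.rot i j) := by
    intro k
    have two : ∀ l, Φ.del l (2 : R) = 0 := fun l => by
      rw [← map_ofNat (algebraMap ℂ R) 2, Derivation.map_algebraMap]
    have h1 : Φ.del j (2 * Φ.hrot k i) = Φ.del k (2 * Φ.hrot i j) := by
      rw [Φ.hrot_symm k i, ← Φ.del_len k i, ← Φ.del_len j i, Φ.del_comm]
    rw [Derivation.leibniz, Derivation.leibniz, two, two, smul_zero, smul_zero, add_zero, add_zero,
      smul_eq_mul, smul_eq_mul, Φ.hrot_of_ne h] at h1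
    exact eq_of_two_mul h1
  rw [logJac, map_sum, Finset.mul_sum, ← Finset.sum_sub_distrib]
  refine Finset.sum_congr rfl fun k _ => ?_
  rw [Derivation.leibniz, smul_eq_mul, smul_eq_mul, e, Φ.del_inv]
  ring

/-- `⟨π_i, μ π_j⟩`, the matrix `V_ij` multiplied by `√(η_ii η_jj)`. -/
def mupair (i j : Fin n) : R := ∑ a, algebraMap ℂ R (Φ.q a - Φ.d / 2) * (Φ.low i a * Φ.vec j a)

theorem mupair_eq_of_ne {i j} (h : i ≠ j) : Φ.mupair i j = (Φ.u j - Φ.u i) * Φ.rot i j := by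
  have e : ∀ a, algebraMap ℂ R (Φ.q a - Φ.d / 2) * (Φ.low i a * Φ.vec j a) =
      Φ.vec j a * Φ.L (Φ.low i a) + algebraMap ℂ R (Φ.d / 2) * (Φ.vec j a * Φ.low i a) := by
    intro a
    have : algebraMap ℂ R Φ.d = algebraMap ℂ R (Φ.d / 2) + algebraMap ℂ R (Φ.d / 2) := by
      rw [← map_add]; congr 1; ring
    rw [Φ.low_eq, L_mul, L_len, L_covec, map_sub, this]
    ring
  have h1 : ∑ a, Φ.vec j a * Φ.low i a = 0 := by
    have := Φ.comp_low j i
    rw [if_neg h] at this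
    exact this
  have h2 : ∑ a, Φ.vec j a * Φ.L (Φ.low i a) = (Φ.u j - Φ.u i) * Φ.rot i j := by
    have e2 : ∀ k, Φ.comp j (fun a => Φ.del k (Φ.low i a)) =
        (if j = k then Φ.rot i j else 0) - if i = k then Φ.rot i j else 0 := by
      intro k
      have hl := Φ.len_mul_inv i
      simp only [Φ.low_eq, Derivation.leibniz, smul_eq_mul, Φ.comp_add, Φ.comp_const_mul,
        Φ.comp_mul_const, Φ.comp_covec, h, if_false, Φ.del_covec, Φ.comp_sub]
      by_cases hik : i = k
      · subst hik
        simp [Φ.comp_sum, Φ.comp_const_mul, Φ.comp_sub, Φ.comp_covec, h, h.symm]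
        linear_combination Φ.rot i j * hl
      · by_cases hjk : j = k
        · subst hjk
          simp [hik, Φ.comp_zero]
          linear_combination Φ.rot i j * hl
        · simp [hik, hjk, Ne.symm hjk, Φ.comp_zero]
    calc _ = Φ.comp j (fun a => ∑ k, Φ.u k * Φ.del k (Φ.low i a)) := by
          simp only [← L_eq_sum]; rfl
      _ = _ := by
          simp only [Φ.comp_sum, Φ.comp_const_mul, e2, mul_sub, Finset.sum_sub_distrib, mul_ite,
            mul_zero, Finset.sum_ite_eq, Finset.mem_univ, if_true]
          ring
  rw [mupair]
  simp only [e, Finset.sum_add_distrib, ← Finset.mul_sum, h1, h2]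
  ring

theorem mupair_antisymm (i j) : Φ.mupair i j = -Φ.mupair j i := by
  have h : ∀ a b, algebraMap ℂ R (Φ.q a - Φ.d / 2) * algebraMap ℂ R (Φ.η a b) =
      -(algebraMap ℂ R (Φ.q b - Φ.d / 2) * algebraMap ℂ R (Φ.η b a)) := by
    intro a b
    have h1 := Φ.metric_homogeneous a b
    rw [Φ.η_symm.apply, ← sub_eq_zero, ← h1, ← map_mul, ← map_mul, ← map_mul, ← map_neg, ← map_sub]
    congr 1
    rw [Φ.η_symm.apply]
    ring
  simp only [mupair, IdempotentFrame.low, Finset.mul_sum, Finset.sum_mul]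
  rw [Finset.sum_comm, ← Finset.sum_neg_distrib]
  refine Finset.sum_congr rfl fun a _ => ?_
  rw [← Finset.sum_neg_distrib]
  refine Finset.sum_congr rfl fun b _ => ?_
  linear_combination Φ.vec i a * Φ.vec j b * h b a

/-- In the normalized form, `V_ij = (u_j - u_i) γ_ij`. -/
theorem mupair_eq (i j) : Φ.mupair i j = (Φ.u j - Φ.u i) * Φ.rot i j := by
  by_cases h : i = j
  · subst h
    rw [Φ.rot_self, mul_zero]
    apply eq_of_two_mul
    linear_combination Φ.mupair_antisymm i i
  · exact Φ.mupair_eq_of_ne h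

/-- The trace of `μ²`, computed as the trace of `V²`. -/
theorem sum_mu_sq : ∑ a, algebraMap ℂ R (Φ.q a - Φ.d / 2) ^ 2 =
    -∑ i, ∑ j, (Φ.u i - Φ.u j) ^ 2 * Φ.rotSq i j := by
  have h1 : ∀ i, ∑ j, (Φ.u i - Φ.u j) ^ 2 * Φ.rotSq i j =
      -∑ j, Φ.inv i * Φ.mupair i j * (Φ.inv j * Φ.mupair j i) := by
    intro i
    rw [← Finset.sum_neg_distrib]
    refine Finset.sum_congr rfl fun j _ => ?_
    rw [mupair_eq, mupair_eq, Φ.rot_symm j i, rotSq]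
    ring
  have hinv : ∀ i j, Φ.inv i * Φ.mupair i j =
      ∑ a, algebraMap ℂ R (Φ.q a - Φ.d / 2) * (Φ.covec i a * Φ.vec j a) := by
    intro i j
    rw [mupair, Finset.mul_sum]
    refine Finset.sum_congr rfl fun a _ => ?_
    rw [Φ.low_eq]
    linear_combination algebraMap ℂ R (Φ.q a - Φ.d / 2) * Φ.covec i a * Φ.vec j a * Φ.len_mul_inv i
  simp only [h1, hinv, Finset.sum_neg_distrib, neg_neg]
  have h2 : ∀ i j, (∑ a, algebraMap ℂ R (Φ.q a - Φ.d / 2) * (Φ.covec i a * Φ.vec j a)) *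
      (∑ b, algebraMap ℂ R (Φ.q b - Φ.d / 2) * (Φ.covec j b * Φ.vec i b)) =
      ∑ a, ∑ b, algebraMap ℂ R (Φ.q a - Φ.d / 2) * algebraMap ℂ R (Φ.q b - Φ.d / 2) *
        ((Φ.vec i b * Φ.covec i a) * (Φ.vec j a * Φ.covec j b)) := by
    intro i j
    rw [Finset.sum_mul_sum]
    exact Finset.sum_congr rfl fun _ _ => Finset.sum_congr rfl fun _ _ => by ring
  simp only [h2]
  symm
  calc _ = ∑ a, ∑ b, algebraMap ℂ R (Φ.q a - Φ.d / 2) * algebraMap ℂ R (Φ.q b - Φ.d / 2) *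
        ((∑ i, Φ.vec i b * Φ.covec i a) * (∑ j, Φ.vec j a * Φ.covec j b)) := by
        simp only [Finset.sum_mul_sum]
        simp only [Finset.mul_sum]
        calc _ = ∑ i, ∑ a, ∑ b, ∑ j, algebraMap ℂ R (Φ.q a - Φ.d / 2) *
              algebraMap ℂ R (Φ.q b - Φ.d / 2) *
              ((Φ.vec i b * Φ.covec i a) * (Φ.vec j a * Φ.covec j b)) := by
              refine Finset.sum_congr rfl fun i _ => ?_
              rw [Finset.sum_comm]
              exact Finset.sum_congr rfl fun a _ => Finset.sum_comm
          _ = _ := by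
              rw [Finset.sum_comm]
              exact Finset.sum_congr rfl fun a _ => Finset.sum_comm
    _ = _ := by
        simp only [Φ.vec_covec]
        refine Finset.sum_congr rfl fun a _ => ?_
        rw [Finset.sum_eq_single a]
        · simp; ring
        · intro b _ hb; simp [hb]
        · simp

/-- The scaling anomaly of the tau-function, doubled. -/
theorem sum_u_ham : ∑ i, Φ.u i * Φ.ham i =
    algebraMap ℂ R (-(1 / 2) * ∑ a, (Φ.q a - Φ.d / 2) ^ 2) := by
  apply eq_of_two_mul
  have h1 : ∑ i, ∑ j, Φ.u i * ((Φ.u i - Φ.u j) * Φ.rotSq i j) =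
      -∑ i, ∑ j, Φ.u j * ((Φ.u i - Φ.u j) * Φ.rotSq i j) := by
    rw [Finset.sum_comm, ← Finset.sum_neg_distrib]
    refine Finset.sum_congr rfl fun i _ => ?_
    rw [← Finset.sum_neg_distrib]
    refine Finset.sum_congr rfl fun j _ => ?_
    rw [Φ.rotSq_symm j i]
    ring
  have h2 : 2 * algebraMap ℂ R (-(1 / 2) * ∑ a, (Φ.q a - Φ.d / 2) ^ 2) =
      ∑ i, ∑ j, (Φ.u i - Φ.u j) ^ 2 * Φ.rotSq i j := by
    have := Φ.sum_mu_sq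
    rw [← neg_eq_iff_eq_neg] at this
    rw [← this, ← map_ofNat (algebraMap ℂ R) 2, ← map_mul, ← mul_assoc]
    simp only [← map_pow]
    rw [← map_sum, ← map_neg]
    congr 1
    ring
  rw [h2]
  simp only [ham, Finset.mul_sum]
  simp only [← Finset.mul_sum]
  have h3 : ∀ i j, (Φ.u i - Φ.u j) ^ 2 * Φ.rotSq i j = Φ.u i * ((Φ.u i - Φ.u j) * Φ.rotSq i j)
      - Φ.u j * ((Φ.u i - Φ.u j) * Φ.rotSq i j) := by intro i j; ring
  simp only [h3, Finset.sum_sub_distrib]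
  rw [two_mul]
  have h4 : ∑ i, Φ.u i * ∑ j, (Φ.u i - Φ.u j) * Φ.rotSq i j =
      ∑ i, ∑ j, Φ.u i * ((Φ.u i - Φ.u j) * Φ.rotSq i j) := by simp only [Finset.mul_sum]
  rw [h4]
  linear_combination h1

/-- The logarithmic derivative of `τ / J^{1/24}` along the `i`-th idempotent. -/
def sol (i : Fin n) : R := algebraMap ℂ R (1 / 2) * Φ.ham i - algebraMap ℂ R (1 / 24) * Φ.logJac i

theorem sum_sol : ∑ i, Φ.sol i = 0 := by
  simp [sol, Finset.sum_sub_distrib, ← Finset.mul_sum, sum_ham, sum_logJac]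

/-- The scaling anomaly of `log (τ / J^{1/24})`. -/
theorem sum_u_sol : ∑ i, Φ.u i * Φ.sol i =
    algebraMap ℂ R (-(1 / 4) * ∑ a, (Φ.q a - Φ.d / 2) ^ 2 + n * Φ.d / 48) := by
  have : ∀ i, Φ.u i * Φ.sol i = algebraMap ℂ R (1 / 2) * (Φ.u i * Φ.ham i)
      - algebraMap ℂ R (1 / 24) * (Φ.u i * Φ.logJac i) := by
    intro i; rw [sol]; ring
  simp only [this, Finset.sum_sub_distrib, ← Finset.mul_sum, sum_u_ham, sum_u_logJac]
  rw [← map_mul, ← map_mul, ← map_sub]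
  congr 1
  ring

/-- The mixed second derivatives of `log (τ / J^{1/24})` are those prescribed by Getzler's system. -/
theorem del_sol {i j} (h : i ≠ j) : Φ.del j (Φ.sol i) = algebraMap ℂ R (1 / 48) * Φ.hess i j := by
  have e1 : algebraMap ℂ R (1 / 2) = algebraMap ℂ R (1 / 48) * 24 := by
    rw [← map_ofNat (algebraMap ℂ R) 24, ← map_mul]; norm_num
  have e2 : algebraMap ℂ R (1 / 24) = algebraMap ℂ R (1 / 48) * 2 := by
    rw [← map_ofNat (algebraMap ℂ R) 2, ← map_mul]; norm_num
  rw [sol, map_sub, Derivation.leibniz, Derivation.leibniz, Derivation.map_algebraMap,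
    Derivation.map_algebraMap, smul_zero, smul_zero, add_zero, add_zero, smul_eq_mul, smul_eq_mul,
    Φ.del_ham h, Φ.del_logJac h, IdempotentFrame.hess, rotSq, e1, e2]
  ring

theorem hess_symm (i j) : Φ.hess i j = Φ.hess j i := by
  unfold IdempotentFrame.hess
  rw [Φ.rot_symm i j]
  have : ∑ k, Φ.inv k ^ 2 * Φ.hrot k i * Φ.hrot k j = ∑ k, Φ.inv k ^ 2 * Φ.hrot k j * Φ.hrot k i :=
    Finset.sum_congr rfl fun _ _ => by ring
  rw [this]
  ring

/-- A solution of the equations for the mixed second derivatives that is constant along the unit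
field and has a constant scaling anomaly has determined first derivatives. -/
theorem del_eq_sol {G : R} {γ : ℂ} (h0 : Φ.D 0 G = 0) (hE : Φ.L G = algebraMap ℂ R γ)
    (h : ∀ i j, i ≠ j → Φ.del i (Φ.del j G) = algebraMap ℂ R (1 / 48) * Φ.hess i j) (i) :
    Φ.del i G = Φ.sol i := by
  set X : Fin n → R := fun i => Φ.del i G - Φ.sol i with hX
  have hX1 : ∀ i j, i ≠ j → Φ.del j (X i) = 0 := by
    intro i j hij
    rw [hX]
    simp only [map_sub]
    rw [Φ.del_sol hij, h j i hij.symm, hess_symm, sub_self]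
  have hX0 : ∑ i, X i = 0 := by
    simp only [hX, Finset.sum_sub_distrib, Φ.sum_del, h0, sum_sol, sub_zero]
  have hX2 : ∀ i j, Φ.del j (X i) = 0 := by
    intro i j
    by_cases hij : i = j
    · subst hij
      have := congr_arg (Φ.del i) hX0
      rw [map_sum, map_zero, Finset.sum_eq_single i] at this
      · exact this
      · intro k _ hk; exact hX1 k i hk
      · simp
    · exact hX1 i j hij
  have hu : ∑ i, Φ.u i * X i = algebraMap ℂ R
      (γ - (-(1 / 4) * ∑ a, (Φ.q a - Φ.d / 2) ^ 2 + n * Φ.d / 48)) := by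
    rw [map_sub, ← hE, ← sum_u_sol, L_eq_sum, ← Finset.sum_sub_distrib]
    exact Finset.sum_congr rfl fun _ _ => by rw [hX]; ring
  have hd := congr_arg (Φ.del i) hu
  rw [Derivation.map_algebraMap, map_sum] at hd
  simp only [Derivation.leibniz, hX2, del_u, smul_eq_mul] at hd
  simp only [mul_ite, mul_one, mul_zero, zero_add, Finset.sum_ite_eq', Finset.mem_univ, if_true] at hd
  exact sub_eq_zero.1 hd

/-- The flat components of the `1`-form `∑ f_i du_i`. -/
def form (f : Fin n → R) (a : Fin n) : R := ∑ i, Φ.covec i a * f i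

theorem form_closed {f : Fin n → R} (hf : ∀ i j, Φ.del j (f i) = Φ.del i (f j)) (a b) :
    Φ.D b (Φ.form f a) = Φ.D a (Φ.form f b) := by
  simp only [form, map_sum, Derivation.leibniz, smul_eq_mul, Finset.sum_add_distrib,
    Φ.D_covec_symm b]
  congr 1
  simp only [Φ.D_eq_sum _ (f _), Finset.mul_sum]
  rw [Finset.sum_comm]
  exact Finset.sum_congr rfl fun i _ => Finset.sum_congr rfl fun j _ => by rw [hf]; ring

theorem del_ham_symm (i j) : Φ.del j (Φ.ham i) = Φ.del i (Φ.ham j) := by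
  by_cases h : i = j
  · rw [h]
  · rw [Φ.del_ham h, Φ.del_ham (Ne.symm h), rotSq_symm]

theorem del_logJac_symm (i j) : Φ.del j (Φ.logJac i) = Φ.del i (Φ.logJac j) := by
  by_cases h : i = j
  · rw [h]
  · rw [Φ.del_logJac h, Φ.del_logJac (Ne.symm h), Φ.rot_symm i j]
    congr 2
    exact Finset.sum_congr rfl fun _ _ => by ring

theorem del_eq_iff_D_eq (G : R) (f : Fin n → R) :
    (∀ i, Φ.del i G = f i) ↔ ∀ a, Φ.D a G = Φ.form f a := by
  constructor
  · intro h a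
    simp only [Φ.D_eq_sum a G, form, h]
  · intro h i
    simp only [Φ.del_apply, h, form, Φ.comp_sum, Φ.comp_mul_const, Φ.comp_covec]
    simp

/-- The determinant of the matrix of the idempotents, that is, the Jacobian `J`. -/
def det : R := (Matrix.of fun a i => Φ.vec i a).det

/-- The Gram determinant of the frame. -/
theorem det_sq : algebraMap ℂ R Φ.η.det * Φ.det ^ 2 = ∏ i, Φ.len i := by
  have h : (Matrix.of fun a i => Φ.vec i a).transpose * (Φ.η.map (algebraMap ℂ R)) *
      (Matrix.of fun a i => Φ.vec i a) = Matrix.diagonal Φ.len := by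
    ext i j
    have h1 := Φ.comp_low i j
    rw [Matrix.mul_assoc, Matrix.mul_apply]
    simp only [Matrix.mul_apply, Matrix.transpose_apply, Matrix.of_apply, Matrix.map_apply]
    have h2 : ∑ a, Φ.vec i a * ∑ b, algebraMap ℂ R (Φ.η a b) * Φ.vec j b = Φ.comp i (Φ.low j) := rfl
    rw [h2, h1, Matrix.diagonal_apply]
    by_cases hij : i = j
    · subst hij; simp
    · simp [hij, Ne.symm hij]
  have h2 := congr_arg Matrix.det h
  rw [Matrix.det_mul, Matrix.det_mul, Matrix.det_transpose, Matrix.det_diagonal] at h2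
  have h3 : (Φ.η.map (algebraMap ℂ R)).det = algebraMap ℂ R Φ.η.det := by
    rw [RingHom.map_det]; rfl
  rw [h3] at h2
  rw [← h2, det]
  ring

theorem isUnit_det : IsUnit Φ.det := by
  have h : (Matrix.of fun i a => Φ.covec i a) * (Matrix.of fun a i => Φ.vec i a) = 1 := by
    ext i j
    rw [Matrix.mul_apply, Matrix.one_apply]
    exact Φ.covec_vec i j
  have := congr_arg Matrix.det h
  rw [Matrix.det_mul, Matrix.det_one] at this
  exact IsUnit.of_mul_eq_one _ (by rw [mul_comm]; exact this)

/-- `logJac` is the logarithmic derivative of the determinant, by `det_sq`. -/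
theorem D_det (a) : Φ.D a Φ.det = Φ.det * Φ.form Φ.logJac a := by
  have h := congr_arg (Φ.D a) Φ.det_sq
  have hp : ∀ s : Finset (Fin n), Φ.D a (∏ i ∈ s, Φ.len i) =
      (∏ i ∈ s, Φ.len i) * ∑ i ∈ s, Φ.inv i * Φ.D a (Φ.len i) := by
    intro s
    induction s using Finset.induction_on with
    | empty => simp
    | insert i s hi ih =>
      rw [Finset.prod_insert hi, Finset.sum_insert hi, Derivation.leibniz, ih, smul_eq_mul,
        smul_eq_mul]
      linear_combination -(∏ i ∈ s, Φ.len i) * Φ.D a (Φ.len i) * Φ.len_mul_inv i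
  have hs : ∑ i, Φ.inv i * Φ.D a (Φ.len i) = 2 * Φ.form Φ.logJac a := by
    simp only [form, logJac, Finset.mul_sum, Φ.D_eq_sum a (Φ.len _), Φ.del_len]
    rw [Finset.sum_comm]
    exact Finset.sum_congr rfl fun _ _ => Finset.sum_congr rfl fun _ _ => by ring
  rw [hp, hs, ← det_sq, Derivation.leibniz, Derivation.map_algebraMap, smul_zero, add_zero,
    Derivation.leibniz_pow] at h
  simp only [smul_eq_mul, Nat.add_one_sub_one, pow_one, nsmul_eq_mul, Nat.cast_ofNat] at h
  have hu : IsUnit (algebraMap ℂ R Φ.η.det * Φ.det) := (Φ.η_nondeg.map _).mul Φ.isUnit_det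
  apply hu.mul_left_cancel
  apply eq_of_two_mul
  linear_combination h

end ConformalFrame

/-! ### Branches of multivalued functions -/

open Filter Topology in
/-- A multivalued function on a simply connected space whose branches `s x i` are given near each
point `x` has a single-valued branch.  The sheets over `x` are indexed by `ι`; they are separated
by their values, and sheets of two charts that agree at a point agree near it.  The graph of the
multivalued function is a covering space, encoded as a bundle with discrete fibre `ι`, and the
branch is a section of it. -/
theorem exists_global_branch {X Z ι : Type*} [TopologicalSpace X] [SimplyConnectedSpace X]
    [LocallyPathConnectedSpace X] (W : X → Set X) (hW : ∀ x, IsOpen (W x)) (hmem : ∀ x, x ∈ W x)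
    (s : X → ι → X → Z) (hinj : ∀ x, ∀ p ∈ W x, Function.Injective fun i => s x i p)
    (hrange : ∀ x y p, p ∈ W x → p ∈ W y → ∀ i, ∃ j, s y j p = s x i p)
    (hopen : ∀ x y i j p, p ∈ W x → p ∈ W y → s x i p = s y j p →
      ∀ᶠ q in 𝓝 p, s x i q = s y j q)
    (x₀ : X) (i₀ : ι) :
    ∃ f : X → Z, f x₀ = s x₀ i₀ x₀ ∧ ∀ x, ∃ i, ∀ᶠ q in 𝓝 x, f q = s x i q := by
  classical
  let _ : TopologicalSpace ι := ⊥
  have : DiscreteTopology ι := ⟨rfl⟩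
  -- the change of sheets, the identity where it is not determined
  let cc : X → X → X → ι → ι := fun x y p i => if h : ∃ j, s y j p = s x i p then h.choose else i
  have hcc : ∀ x y p, p ∈ W x → p ∈ W y → ∀ i, s y (cc x y p i) p = s x i p := by
    intro x y p hx hy i
    have h := hrange x y p hx hy i
    simp only [cc, dif_pos h]
    exact h.choose_spec
  have huniq : ∀ x y p, p ∈ W x → p ∈ W y → ∀ i j, s y j p = s x i p → cc x y p i = j := by
    intro x y p hx hy i j h
    exact hinj y p hy ((hcc x y p hx hy i).trans h.symm)
  let core : FiberBundleCore X X ι :=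
    { baseSet := W
      isOpen_baseSet := hW
      indexAt := id
      mem_baseSet_at := hmem
      coordChange := cc
      coordChange_self := fun x p hp v => huniq x x p hp hp v v rfl
      continuousOn_coordChange := by
        rintro x y ⟨p, v⟩ ⟨⟨hx, hy⟩, -⟩
        apply ContinuousAt.continuousWithinAt
        have h : ∀ᶠ z : X × ι in 𝓝 (p, v), cc x y z.1 z.2 = cc x y p v := by
          have h1 := hopen x y v (cc x y p v) p hx hy (hcc x y p hx hy v).symm
          have h2 : ∀ᶠ q in 𝓝 p, cc x y q v = cc x y p v := by
            filter_upwards [h1, (hW x).mem_nhds hx, (hW y).mem_nhds hy] with q hq hqx hqy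
            exact huniq x y q hqx hqy _ _ hq.symm
          rw [nhds_prod_eq, nhds_discrete ι]
          exact (h2.prod_mk (eventually_pure.2 rfl : ∀ᶠ w in pure v, w = v)).mono
            fun z hz => by rw [hz.2]; exact hz.1
        exact continuousAt_const.congr (h.mono fun z hz => hz.symm)
      coordChange_comp := by
        rintro x y z p ⟨⟨hx, hy⟩, hz⟩ v
        refine (huniq x z p hx hz _ _ ?_).symm
        rw [hcc y z p hy hz, hcc x y p hx hy] }
  have hcov : IsCoveringMap core.proj := FiberBundle.isCoveringMap (F := ι) (E := core.Fiber)
  obtain ⟨f, ⟨hf0, hf⟩, -⟩ := hcov.existsUnique_continuousMap_lifts (ContinuousMap.id X) x₀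
    (⟨x₀, i₀⟩ : core.TotalSpace) rfl
  have hfp : ∀ x, (f x).1 = x := fun x => congr_fun hf x
  refine ⟨fun x => s (f x).1 (f x).2 x, ?_, ?_⟩
  · change s (f x₀).1 (f x₀).2 x₀ = _
    rw [hf0]
  · intro x
    have hc : ContinuousAt (fun q => (core.localTriv x (f q)).2) x := by
      have h1 : ContinuousAt (core.localTriv x) (f x) :=
        (core.localTriv x).continuousAt (by
          rw [FiberBundleCore.mem_localTriv_source]
          exact (hfp x).symm ▸ hmem x)
      exact continuous_snd.continuousAt.comp (h1.comp f.continuous.continuousAt)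
    refine ⟨(core.localTriv x (f x)).2, ?_⟩
    have hc' : ∀ᶠ q in 𝓝 x, (core.localTriv x (f q)).2 = (core.localTriv x (f x)).2 := by
      have := hc.tendsto
      rw [nhds_discrete ι] at this
      exact tendsto_pure.1 this
    filter_upwards [hc', (hW x).mem_nhds (hmem x)] with q hq hqx
    rw [← hq]
    have e : (core.localTriv x (f q)).2 = cc (f q).1 x (f q).1 (f q).2 := rfl
    rw [e]
    have := hcc (f q).1 x (f q).1 (hmem _) ((hfp q).symm ▸ hqx) (f q).2
    rw [hfp q] at this ⊢
    exact this.symm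

open Filter Topology in
/-- Two branches that are different at one point are different everywhere. -/
theorem branch_ne {X Z ι : Type*} [TopologicalSpace X] [PreconnectedSpace X]
    (W : X → Set X) (hW : ∀ x, IsOpen (W x)) (hmem : ∀ x, x ∈ W x)
    (s : X → ι → X → Z) (hinj : ∀ x, ∀ p ∈ W x, Function.Injective fun i => s x i p)
    {f g : X → Z} (hf : ∀ x, ∃ i, ∀ᶠ q in 𝓝 x, f q = s x i q)
    (hg : ∀ x, ∃ i, ∀ᶠ q in 𝓝 x, g q = s x i q) {x₀ : X} (h : f x₀ ≠ g x₀) (x : X) :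
    f x ≠ g x := by
  have hclopen : IsClopen {x | f x ≠ g x} := by
    have key : ∀ x, (∀ᶠ q in 𝓝 x, f q = g q) ∨ (∀ᶠ q in 𝓝 x, f q ≠ g q) := by
      intro x
      obtain ⟨i, hi⟩ := hf x
      obtain ⟨j, hj⟩ := hg x
      by_cases hij : i = j
      · left
        filter_upwards [hi, hj] with q h1 h2
        rw [h1, h2, hij]
      · right
        filter_upwards [hi, hj, (hW x).mem_nhds (hmem x)] with q h1 h2 h3
        rw [h1, h2]
        exact fun h4 => hij (hinj x q h3 h4)
    constructor
    · rw [← isOpen_compl_iff, isOpen_iff_mem_nhds]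
      intro x hx
      rcases key x with h1 | h1
      · filter_upwards [h1] with q hq using fun h2 => h2 hq
      · exact absurd h1.self_of_nhds hx
    · rw [isOpen_iff_mem_nhds]
      intro x hx
      rcases key x with h1 | h1
      · exact absurd h1.self_of_nhds hx
      · exact h1
  have := hclopen.eq_univ ⟨x₀, h⟩
  exact (this ▸ Set.mem_univ x : x ∈ {x | f x ≠ g x})

/-! ### Holomorphic primitives -/

open FormalMultilinearSeries in
/-- A primitive of an analytic `1`-form is analytic: its power series is obtained by dividing the
`k`-th coefficient of the form by `k + 1`. -/
theorem AnalyticAt.of_hasFDerivAt {E : Type*} [NormedAddCommGroup E] [NormedSpace ℂ E]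
    {f : E → ℂ} {ω : E → E →L[ℂ] ℂ} {x : E} (hω : AnalyticAt ℂ ω x)
    (hf : ∀ᶠ y in nhds x, HasFDerivAt f (ω y) y) : AnalyticAt ℂ f x := by
  obtain ⟨p, r₀, hp₀⟩ := hω
  obtain ⟨ε, hε, hball⟩ := Metric.eventually_nhds_iff_ball.1 hf
  have hr : 0 < min r₀ (ENNReal.ofReal ε) := lt_min hp₀.r_pos (ENNReal.ofReal_pos.2 hε)
  have hp := hp₀.mono hr (min_le_left _ _)
  set r := min r₀ (ENNReal.ofReal ε) with hrdef
  have hb : ∀ y ∈ Metric.eball (0 : E) r, ∀ s ∈ Set.Icc (0 : ℝ) 1,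
      (s : ℂ) • y ∈ Metric.eball (0 : E) r ∧ x + (s : ℂ) • y ∈ Metric.ball x ε := by
    intro y hy s hs
    have h1 : (s : ℂ) • y ∈ Metric.eball (0 : E) r := by
      rw [Metric.mem_eball, edist_zero_right] at hy ⊢
      refine lt_of_le_of_lt ?_ hy
      rw [enorm_smul]
      have : ‖(s : ℂ)‖ₑ ≤ 1 := by
        rw [← ofReal_norm, Complex.norm_real, Real.norm_of_nonneg hs.1]
        exact ENNReal.ofReal_le_one.2 hs.2
      calc _ ≤ 1 * ‖y‖ₑ := by gcongr
        _ = _ := one_mul _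
    refine ⟨h1, ?_⟩
    rw [Metric.mem_eball, edist_zero_right] at h1
    have h2 := lt_of_lt_of_le h1 (min_le_right _ _)
    rw [← ofReal_norm, ENNReal.ofReal_lt_ofReal_iff hε] at h2
    simpa [Metric.mem_ball, dist_eq_norm] using h2
  let p' : FormalMultilinearSeries ℂ E (E →L[ℂ] ℂ) := fun k => ((k : ℂ) + 1)⁻¹ • p k
  have hp' : r ≤ p'.radius := by
    refine hp.r_le.trans ?_
    apply radius_le_of_le
    intro k
    simp only [p', norm_smul, norm_inv]
    have : (1 : ℝ) ≤ ‖(k : ℂ) + 1‖ := by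
      rw [← Nat.cast_add_one, Complex.norm_natCast]; simp
    calc _ ≤ 1 * ‖p k‖ := by gcongr; exact inv_le_one_of_one_le₀ this
      _ = _ := one_mul _
  refine ⟨p'.unshift (f x), r, ⟨by rwa [radius_unshift], hp.r_pos, ?_⟩⟩
  intro y hy
  have hderiv : ∀ s ∈ Set.uIcc (0 : ℝ) 1,
      HasDerivAt (fun s : ℝ => f (x + (s : ℂ) • y)) (ω (x + (s : ℂ) • y) y) s := by
    intro s hs
    rw [Set.uIcc_of_le zero_le_one] at hs
    have h1 := hball _ (hb y hy s hs).2
    have h2 : HasDerivAt (fun s : ℝ => x + (s : ℂ) • y) y s := by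
      have := ((Complex.ofRealCLM.hasDerivAt (x := s)).smul_const y).const_add x
      simpa using this
    exact (h1.restrictScalars ℝ).comp_hasDerivAt s h2
  have hcont : ContinuousOn (fun s : ℝ => ω (x + (s : ℂ) • y) y) (Set.uIcc (0 : ℝ) 1) := by
    rw [Set.uIcc_of_le zero_le_one]
    refine ContinuousOn.clm_apply ?_ continuousOn_const
    refine hp.continuousOn.comp (by fun_prop) ?_
    intro s hs
    simpa [Metric.mem_eball, edist_eq_enorm_sub] using (hb y hy s hs).1
  -- the value of `f` at `x + y` is the integral of the form along the segment from `x`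
  have hint := intervalIntegral.integral_eq_sub_of_hasDerivAt hderiv hcont.intervalIntegrable
  have hsum := p.summable_norm_apply (Metric.eball_subset_eball hp.r_le hy)
  have key : HasSum (fun k : ℕ => ∫ s in (0 : ℝ)..1, (s : ℂ) ^ k * p k (fun _ => y) y)
      (∫ s in (0 : ℝ)..1, ω (x + (s : ℂ) • y) y) := by
    refine intervalIntegral.hasSum_integral_of_dominated_convergence
      (fun k _ => ‖p k (fun _ => y)‖ * ‖y‖) (fun k => ?_) (fun k => ?_) ?_ ?_ ?_
    · exact Continuous.aestronglyMeasurable (by fun_prop)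
    · filter_upwards with s hs
      rw [Set.uIoc_of_le zero_le_one] at hs
      rw [norm_mul, norm_pow, Complex.norm_real, Real.norm_of_nonneg hs.1.le]
      calc _ ≤ 1 * ‖p k (fun _ => y) y‖ := by
            gcongr
            exact pow_le_one₀ hs.1.le hs.2
        _ ≤ _ := by rw [one_mul]; exact ContinuousLinearMap.le_opNorm _ _
    · filter_upwards with s hs
      exact hsum.mul_right _
    · exact intervalIntegrable_const
    · filter_upwards with s hs
      rw [Set.uIoc_of_le zero_le_one] at hs
      have h1 := hp.hasSum (hb y hy s ⟨hs.1.le, hs.2⟩).1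
      have h2 := (ContinuousLinearMap.apply ℂ ℂ y).hasSum h1
      have e : ∀ k, (p k fun _ => (s : ℂ) • y) = (s : ℂ) ^ k • p k fun _ => y := fun k => by
        simpa using (p k).map_smul_univ (fun _ => (s : ℂ)) (fun _ => y)
      simp only [e, ContinuousLinearMap.apply_apply, _root_.smul_apply, smul_eq_mul] at h2
      exact h2
  have hI : ∀ k : ℕ, ∫ s in (0 : ℝ)..1, (s : ℂ) ^ k * p k (fun _ => y) y =
      p' k (fun _ => y) y := by
    intro k
    rw [intervalIntegral.integral_mul_const]
    have : ∫ s in (0 : ℝ)..1, (s : ℂ) ^ k = ((k : ℂ) + 1)⁻¹ := by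
      have := integral_pow (a := 0) (b := 1) k
      simp only [← Complex.ofReal_pow]
      rw [intervalIntegral.integral_ofReal, this]
      simp
    rw [this]
    simp [p']
  rw [hint] at key
  simp only [hI, Complex.ofReal_one, one_smul, Complex.ofReal_zero, zero_smul, add_zero] at key
  rw [← add_sub_cancel (f x) (f (x + y))]
  refine HasSum.zero_add (f := fun n => p'.unshift (f x) n fun _ => y) ?_
  simp only [unshift, Nat.succ_eq_add_one, continuousMultilinearCurryRightEquiv_symm_apply']
  exact key

/-- The `1`-form with the given components. -/
def oneForm {n : ℕ} (ω : Fin n → (Fin n → ℂ) → ℂ) (t : Fin n → ℂ) : (Fin n → ℂ) →L[ℂ] ℂ :=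
  ∑ a, ω a t • ContinuousLinearMap.proj a

theorem oneForm_single {n : ℕ} (ω : Fin n → (Fin n → ℂ) → ℂ) (t : Fin n → ℂ) (a : Fin n) :
    oneForm ω t (Pi.single a 1) = ω a t := by
  simp [oneForm, Pi.single_apply]

theorem analyticAt_oneForm {n : ℕ} {ω : Fin n → (Fin n → ℂ) → ℂ} {t : Fin n → ℂ}
    (h : ∀ a, AnalyticAt ℂ (ω a) t) : AnalyticAt ℂ (oneForm ω) t := by
  have : oneForm ω = fun t => ∑ a, ω a t • (ContinuousLinearMap.proj a : (Fin n → ℂ) →L[ℂ] ℂ) := rfl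
  rw [this]
  exact Finset.analyticAt_fun_sum _ fun a _ => (h a).fun_smul analyticAt_const

theorem ext_single {n : ℕ} {f g : (Fin n → ℂ) →L[ℂ] ℂ}
    (h : ∀ a, f (Pi.single a 1) = g (Pi.single a 1)) : f = g := by
  apply ContinuousLinearMap.coe_injective
  apply LinearMap.pi_ext'
  intro a
  ext
  simpa using h a

theorem apply_eq_sum_single {n : ℕ} (f : (Fin n → ℂ) →L[ℂ] ℂ) (x : Fin n → ℂ) :
    f x = ∑ a, x a * f (Pi.single a 1) := by
  conv_lhs => rw [← Finset.univ_sum_single x, map_sum]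
  refine Finset.sum_congr rfl fun a _ => ?_
  rw [show Pi.single a (x a) = x a • (Pi.single a 1 : Fin n → ℂ) by
    rw [← Pi.single_smul, smul_eq_mul, mul_one], map_smul, smul_eq_mul]

theorem fderiv_oneForm_symm {n : ℕ} {ω : Fin n → (Fin n → ℂ) → ℂ} {t : Fin n → ℂ}
    (h : ∀ a, AnalyticAt ℂ (ω a) t) (hcl : ∀ a b, partialD a (ω b) t = partialD b (ω a) t)
    (x y : Fin n → ℂ) : fderiv ℂ (oneForm ω) t x y = fderiv ℂ (oneForm ω) t y x := by
  have hd : HasFDerivAt (oneForm ω) (∑ a, (fderiv ℂ (ω a) t).smulRight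
      (ContinuousLinearMap.proj a : (Fin n → ℂ) →L[ℂ] ℂ)) t := by
    have : oneForm ω = fun t => ∑ a, ω a t • (ContinuousLinearMap.proj a : (Fin n → ℂ) →L[ℂ] ℂ) :=
      rfl
    rw [this]
    exact HasFDerivAt.fun_sum fun a _ => (h a).differentiableAt.hasFDerivAt.smul_const
      (ContinuousLinearMap.proj a : (Fin n → ℂ) →L[ℂ] ℂ)
  have key : ∀ x y : Fin n → ℂ, fderiv ℂ (oneForm ω) t x y =
      ∑ a, ∑ b, x b * y a * partialD b (ω a) t := by
    intro x y
    rw [hd.fderiv]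
    simp only [_root_.sum_apply, ContinuousLinearMap.smulRight_apply,
      _root_.smul_apply, ContinuousLinearMap.proj_apply, smul_eq_mul]
    refine Finset.sum_congr rfl fun a _ => ?_
    rw [apply_eq_sum_single (fderiv ℂ (ω a) t) x, Finset.sum_mul]
    exact Finset.sum_congr rfl fun b _ => by rw [partialD]; ring
  rw [key, key, Finset.sum_comm]
  exact Finset.sum_congr rfl fun a _ => Finset.sum_congr rfl fun b _ => by rw [hcl]; ring

/-- Holomorphic functions on a connected open set with the same partial derivatives differ by a
constant. -/
theorem exists_eq_add_const {n : ℕ} {U : Set (Fin n → ℂ)} (hU : IsOpen U) (hc : IsPreconnected U)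
    {f g : (Fin n → ℂ) → ℂ} (hf : AnalyticOnNhd ℂ f U) (hg : AnalyticOnNhd ℂ g U)
    (h : ∀ t ∈ U, ∀ a, partialD a f t = partialD a g t) : ∃ k, ∀ t ∈ U, f t = g t + k := by
  have hd : ∀ t ∈ U, HasFDerivAt (fun t => f t - g t) (0 : (Fin n → ℂ) →L[ℂ] ℂ) t := by
    intro t ht
    have := (hf t ht).differentiableAt.hasFDerivAt.sub (hg t ht).differentiableAt.hasFDerivAt
    rwa [ext_single (h t ht), sub_self] at this
  obtain ⟨k, hk⟩ := hU.exists_is_const_of_fderiv_eq_zero hc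
    (fun t ht => (hd t ht).differentiableAt.differentiableWithinAt) fun t ht => (hd t ht).fderiv
  exact ⟨k, fun t ht => by rw [← hk t ht]; ring⟩

open Filter Topology in
/-- A closed holomorphic `1`-form on a simply connected open set has a holomorphic primitive. -/
theorem exists_primitive {n : ℕ} {U : Set (Fin n → ℂ)} (hU : IsOpen U) [SimplyConnectedSpace U]
    (ω : Fin n → (Fin n → ℂ) → ℂ) (hω : ∀ a, AnalyticOnNhd ℂ (ω a) U)
    (hcl : ∀ t ∈ U, ∀ a b, partialD a (ω b) t = partialD b (ω a) t) :
    ∃ f, AnalyticOnNhd ℂ f U ∧ ∀ t ∈ U, ∀ a, partialD a f t = ω a t := by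
  classical
  have hΩ : ∀ t ∈ U, AnalyticAt ℂ (oneForm ω) t := fun t ht => analyticAt_oneForm fun a => hω a t ht
  have hball : ∀ x : U, ∃ ε > 0, Metric.ball (x : Fin n → ℂ) ε ⊆ U :=
    fun x => Metric.isOpen_iff.1 hU x x.2
  choose ε hε hεU using hball
  have hloc : ∀ x : U, ∃ g : (Fin n → ℂ) → ℂ, ∀ y ∈ Metric.ball (x : Fin n → ℂ) (ε x),
      HasFDerivAt g (oneForm ω y) y := fun x =>
    (convex_ball _ _).exists_forall_hasFDerivAt_of_fderiv_symmetric Metric.isOpen_ball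
      (fun y hy => ((hΩ y (hεU x hy)).differentiableAt.restrictScalars ℝ).differentiableWithinAt)
      fun y hy a b => by
        rw [(hΩ y (hεU x hy)).differentiableAt.fderiv_restrictScalars ℝ]
        exact fderiv_oneForm_symm (fun a => hω a y (hεU x hy)) (hcl y (hεU x hy)) a b
  choose g hg using hloc
  have := hU.locallyPathConnectedSpace
  let x₀ : U := Classical.arbitrary U
  obtain ⟨f, -, hf⟩ := exists_global_branch (X := U) (Z := ℂ) (ι := ℂ)
    (fun x => Subtype.val ⁻¹' Metric.ball (x : Fin n → ℂ) (ε x))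
    (fun x => Metric.isOpen_ball.preimage continuous_subtype_val)
    (fun x => Metric.mem_ball_self (hε x)) (fun x c p => g x p + c)
    (fun x p _ => add_right_injective (g x p))
    (fun x y p _ _ c => ⟨g x p + c - g y p, by ring⟩)
    (by
      intro x y c c' p hx hy hp
      set S := Metric.ball (x : Fin n → ℂ) (ε x) ∩ Metric.ball (y : Fin n → ℂ) (ε y)
      have hS : IsOpen S := Metric.isOpen_ball.inter Metric.isOpen_ball
      have hSc : IsPreconnected S := ((convex_ball _ _).inter (convex_ball _ _)).isPreconnected
      have hd : ∀ q ∈ S, HasFDerivAt (fun q => g x q - g y q) (0 : (Fin n → ℂ) →L[ℂ] ℂ) q := by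
        intro q hq
        have := (hg x q hq.1).sub (hg y q hq.2)
        rwa [sub_self] at this
      obtain ⟨k, hk⟩ := hS.exists_is_const_of_fderiv_eq_zero hSc
        (fun t ht => (hd t ht).differentiableAt.differentiableWithinAt) fun t ht => (hd t ht).fderiv
      have hSp : Subtype.val ⁻¹' S ∈ 𝓝 p :=
        (hS.preimage continuous_subtype_val).mem_nhds ⟨hx, hy⟩
      filter_upwards [hSp] with q hq
      have h1 := hk q hq
      have h2 := hk p ⟨hx, hy⟩
      linear_combination h1 - h2 + hp)
    x₀ 0
  let F : (Fin n → ℂ) → ℂ := fun t => if h : t ∈ U then f ⟨t, h⟩ else 0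
  have hF : ∀ t ∈ U, HasFDerivAt F (oneForm ω t) t := by
    intro t ht
    obtain ⟨c, hc⟩ := hf ⟨t, ht⟩
    have hc' : ∀ᶠ y in 𝓝 t, F y = g ⟨t, ht⟩ y + c := by
      rw [← map_nhds_subtype_coe_eq_nhds ht (hU.mem_nhds ht), eventually_map]
      filter_upwards [hc] with q hq
      simp only [F, dif_pos q.2, Subtype.coe_eta, hq]
    exact ((hg ⟨t, ht⟩ t (Metric.mem_ball_self (hε _))).add_const c).congr_of_eventuallyEq hc'
  refine ⟨F, fun t ht => (hΩ t ht).of_hasFDerivAt ?_, fun t ht a => ?_⟩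
  · filter_upwards [hU.mem_nhds ht] with y hy using hF y hy
  · rw [partialD, (hF t ht).fderiv, oneForm_single]

/-! ### Fields of idempotents -/

theorem AnalyticAt.partialD {n : ℕ} {f : (Fin n → ℂ) → ℂ} {t : Fin n → ℂ} (h : AnalyticAt ℂ f t)
    (a : Fin n) : AnalyticAt ℂ (partialD a f) t := by
  have : _root_.partialD a f =
    (ContinuousLinearMap.apply ℂ ℂ (Pi.single a 1 : Fin n → ℂ)) ∘ fderiv ℂ f := rfl
  rw [this]
  exact (ContinuousLinearMap.analyticAt _ _).comp h.fderiv

theorem partialD_congr {n : ℕ} {f g : (Fin n → ℂ) → ℂ} {U : Set (Fin n → ℂ)} (hU : IsOpen U)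
    (h : Set.EqOn f g U) (a : Fin n) : Set.EqOn (partialD a f) (partialD a g) U := by
  intro t ht
  rw [partialD, partialD, (h.eventuallyEq_of_mem (hU.mem_nhds ht)).fderiv_eq]

theorem partialD_comm {n : ℕ} {f : (Fin n → ℂ) → ℂ} {t : Fin n → ℂ} (h : AnalyticAt ℂ f t)
    (a b : Fin n) : partialD a (partialD b f) t = partialD b (partialD a f) t := by
  have key : ∀ a b : Fin n, partialD a (partialD b f) t =
      fderiv ℂ (fderiv ℂ f) t (Pi.single a 1) (Pi.single b 1) := by
    intro a b
    have : partialD b f =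
      (ContinuousLinearMap.apply ℂ ℂ (Pi.single b 1 : Fin n → ℂ)) ∘ fderiv ℂ f := rfl
    rw [partialD, this, ((ContinuousLinearMap.apply ℂ ℂ (Pi.single b 1 : Fin n → ℂ)).hasFDerivAt.comp
      t h.fderiv.differentiableAt.hasFDerivAt).fderiv]
    rfl
  rw [key, key]
  exact second_derivative_symmetric_of_eventually
    (h.eventually_analyticAt.mono fun y hy => (hy.differentiableAt.hasFDerivAt))
    h.fderiv.differentiableAt.hasFDerivAt _ _

namespace FrobeniusManifold

variable {n : ℕ} [NeZero n] (M : FrobeniusManifold n)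

theorem analyticAt_c3 {t : Fin n → ℂ} (ht : t ∈ M.domain) (a b c : Fin n) :
    AnalyticAt ℂ (M.c3 a b c) t := by
  have h : M.c3 a b c = fun t => ∑ e, M.η⁻¹ a e * partialD e (partialD b (partialD c M.F)) t := rfl
  rw [h]
  have := fun e => (((M.analytic_F t ht).partialD c).partialD b).partialD e
  fun_prop

/-- The multiplication of tangent vectors at `t` as a bilinear map. -/
def mulBilin (t : Fin n → ℂ) : (Fin n → ℂ) →ₗ[ℂ] (Fin n → ℂ) →ₗ[ℂ] (Fin n → ℂ) :=
  LinearMap.mk₂ ℂ (M.mul t)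
    (fun x y z => by
      ext c; simp only [mul, Pi.add_apply, mul_add, add_mul, Finset.sum_add_distrib])
    (fun k x y => by
      ext c
      simp only [mul, Pi.smul_apply, smul_eq_mul, Finset.mul_sum]
      exact Finset.sum_congr rfl fun _ _ => Finset.sum_congr rfl fun _ _ => by ring)
    (fun x y z => by
      ext c; simp only [mul, Pi.add_apply, mul_add, Finset.sum_add_distrib])
    (fun k x y => by
      ext c
      simp only [mul, Pi.smul_apply, smul_eq_mul, Finset.mul_sum]
      exact Finset.sum_congr rfl fun _ _ => Finset.sum_congr rfl fun _ _ => by ring)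

theorem mulBilin_apply (t x y : Fin n → ℂ) : M.mulBilin t x y = M.mul t x y := rfl

/-- A family of `n` orthogonal nonzero idempotents of the tangent algebra at `t`. -/
structure IsFrameAt (t : Fin n → ℂ) (e : Fin n → Fin n → ℂ) : Prop where
  mul_eq : ∀ i j, M.mul t (e i) (e j) = if i = j then e i else 0
  ne_zero : ∀ i, e i ≠ 0

namespace IsFrameAt

variable {M} {t : Fin n → ℂ} {e e' : Fin n → Fin n → ℂ}

theorem mul_sum_smul (he : M.IsFrameAt t e) (i : Fin n) (c : Fin n → ℂ) :
    M.mul t (e i) (∑ j, c j • e j) = c i • e i := by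
  rw [← mulBilin_apply, map_sum]
  simp [mulBilin_apply, he.mul_eq]

theorem sum_smul_mul (he : M.IsFrameAt t e) (i : Fin n) (c : Fin n → ℂ) :
    M.mul t (∑ j, c j • e j) (e i) = c i • e i := by
  rw [← mulBilin_apply, map_sum, LinearMap.sum_apply]
  simp [mulBilin_apply, he.mul_eq]

theorem linearIndependent (he : M.IsFrameAt t e) : LinearIndependent ℂ e := by
  rw [Fintype.linearIndependent_iff]
  intro c hc i
  have h := he.mul_sum_smul i c
  rw [hc, ← mulBilin_apply, map_zero] at h
  exact (smul_eq_zero.1 h.symm).resolve_right (he.ne_zero i)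

theorem injective (he : M.IsFrameAt t e) : Function.Injective e := he.linearIndependent.injective

theorem exists_eq_sum (he : M.IsFrameAt t e) (x : Fin n → ℂ) : ∃ c : Fin n → ℂ, x = ∑ j, c j • e j := by
  have hspan : Submodule.span ℂ (Set.range e) = ⊤ :=
    he.linearIndependent.span_eq_top_of_card_eq_finrank (by simp)
  have hx : x ∈ Submodule.span ℂ (Set.range e) := hspan ▸ Submodule.mem_top
  obtain ⟨c, hc⟩ := (Submodule.mem_span_range_iff_exists_fun ℂ).1 hx
  exact ⟨c, hc.symm⟩

/-- The orthogonal idempotents are unique up to the order, as they are the minimal ones. -/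
theorem exists_eq (he : M.IsFrameAt t e) (he' : M.IsFrameAt t e') (i : Fin n) :
    ∃ j, e' j = e i := by
  obtain ⟨c, hc⟩ := he'.exists_eq_sum (e i)
  obtain ⟨j, hj⟩ : ∃ j, c j ≠ 0 := by
    by_contra! h
    exact he.ne_zero i (by rw [hc]; simp [h])
  obtain ⟨b, hb⟩ := he.exists_eq_sum (e' j)
  -- `e i * e' j` is proportional to both factors
  have h1 : M.mul t (e i) (e' j) = c j • e' j := by
    conv_lhs => rw [hc]
    exact he'.sum_smul_mul j c
  have h2 : M.mul t (e i) (e' j) = b i • e i := by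
    conv_lhs => rw [hb]
    exact he.mul_sum_smul i b
  have h3 : c j • e' j = b i • e i := h1.symm.trans h2
  have h4 : M.mul t (e i) (c j • e' j) = b i • e i := by
    rw [h3, ← mulBilin_apply, map_smul, mulBilin_apply, he.mul_eq, if_pos rfl]
  have h5 : M.mul t (e i) (c j • e' j) = c j • (c j • e' j) := by
    rw [← mulBilin_apply, map_smul, mulBilin_apply, h1]
  have h6 : c j = 1 := by
    have h7 : (c j * c j - c j) • e' j = 0 := by
      rw [sub_smul, mul_smul, ← h5, h4, h3, sub_self]
    have h8 := (smul_eq_zero.1 h7).resolve_right (he'.ne_zero j)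
    apply mul_left_cancel₀ hj
    linear_combination h8
  have h9 : M.mul t (e' j) (e i) = c j • e' j := by
    conv_lhs => rw [hc]
    exact he'.mul_sum_smul j c
  have h10 : M.mul t (e' j) (e i) = b i • e i := by
    conv_lhs => rw [hb]
    exact he.sum_smul_mul i b
  have h11 : b i = 1 := by
    have h12 : M.mul t (e' j) (c j • e' j) = c j • e' j := by
      rw [← mulBilin_apply, map_smul, mulBilin_apply, he'.mul_eq, if_pos rfl]
    rw [h3, ← mulBilin_apply, map_smul, mulBilin_apply, h10, smul_smul] at h12
    have h13 : (b i * b i - b i) • e i = 0 := by rw [sub_smul, h12, sub_self]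
    have h14 := (smul_eq_zero.1 h13).resolve_right (he.ne_zero i)
    have hbi : b i ≠ 0 := by
      intro h0
      rw [h0, zero_smul, h6, one_smul] at h3
      exact he'.ne_zero j h3
    apply mul_left_cancel₀ hbi
    linear_combination h14
  refine ⟨j, ?_⟩
  rw [h6, h11, one_smul, one_smul] at h3
  exact h3

theorem det_ne_zero (he : M.IsFrameAt t e) : (Matrix.of e).det ≠ 0 := by
  have h := Matrix.linearIndependent_rows_iff_isUnit.1 (he.linearIndependent : LinearIndependent ℂ (Matrix.of e).row)
  exact ((Matrix.isUnit_iff_isUnit_det _).1 h).ne_zero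

end IsFrameAt

theorem exists_isFrameAt {t : Fin n → ℂ} (ht : t ∈ M.semisimpleLocus) : ∃ e, M.IsFrameAt t e := by
  obtain ⟨-, φ, hφ⟩ := ht
  refine ⟨fun i => φ.symm (Pi.single i 1), fun i j => ?_, fun i => ?_⟩
  · apply φ.injective
    rw [hφ]
    by_cases hij : i = j
    · subst hij; simp [← Pi.single_mul]
    · simp only [LinearEquiv.apply_symm_apply, hij, if_false, map_zero]
      ext k
      by_cases hk : k = i
      · subst hk; simp [hij]
      · simp [hk]
  · simp

open ContDiff Topology Filter in
/-- An idempotent of the tangent algebra at a semisimple point extends uniquely to a germ of an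
analytic family of idempotents. -/
theorem exists_idempotent_germ {t₀ p : Fin n → ℂ} (ht : t₀ ∈ M.semisimpleLocus)
    (hp : M.mul t₀ p p = p) : ∃ ψ : (Fin n → ℂ) → Fin n → ℂ, AnalyticAt ℂ ψ t₀ ∧ ψ t₀ = p ∧
      (∀ᶠ t in 𝓝 t₀, M.mul t (ψ t) (ψ t) = ψ t) ∧
      ∀ᶠ w : (Fin n → ℂ) × (Fin n → ℂ) in 𝓝 (t₀, p), M.mul w.1 w.2 w.2 = w.2 → ψ w.1 = w.2 := by
  let f : (Fin n → ℂ) × (Fin n → ℂ) → Fin n → ℂ := fun w => M.mul w.1 w.2 w.2 - w.2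
  have hfa : AnalyticAt ℂ f (t₀, p) := by
    have h := fun a b c => M.analyticAt_c3 ht.1 a b c
    have hc : ∀ a b c, AnalyticAt ℂ (fun w : (Fin n → ℂ) × (Fin n → ℂ) => M.c3 a b c w.1) (t₀, p) :=
      fun a b c => (h a b c).comp_of_eq analyticAt_fst rfl
    have hs : ∀ a, AnalyticAt ℂ (fun w : (Fin n → ℂ) × (Fin n → ℂ) => w.2 a) (t₀, p) :=
      fun a => ((ContinuousLinearMap.proj (R := ℂ) (φ := fun _ : Fin n => ℂ) a).analyticAt
        _).comp analyticAt_snd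
    refine AnalyticAt.sub ?_ analyticAt_snd
    rw [analyticAt_pi_iff]
    intro a
    simp only [mul]
    fun_prop
  have hf : ContDiffAt ℂ ω f (t₀, p) := hfa.contDiffAt
  have hinv : (fderiv ℂ f (t₀, p) ∘L .inr ℂ (Fin n → ℂ) (Fin n → ℂ)).IsInvertible := by
    set A := fderiv ℂ f (t₀, p) ∘L .inr ℂ (Fin n → ℂ) (Fin n → ℂ) with hA
    have hAh : ∀ h, A h = M.mul t₀ p h + M.mul t₀ h p - h := by
      intro h
      have h1 : HasDerivAt (fun s : ℂ => f (t₀, p + s • h)) (A h) 0 := by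
        have h2 : HasDerivAt (fun s : ℂ => ((t₀, p + s • h) : (Fin n → ℂ) × (Fin n → ℂ)))
            (0, h) 0 := by
          refine (hasDerivAt_const _ _).prodMk ?_
          simpa using ((hasDerivAt_id (0 : ℂ)).smul_const h).const_add p
        have h3 : HasFDerivAt f (fderiv ℂ f (t₀, p)) (t₀, p + (0 : ℂ) • h) := by
          simpa using hfa.differentiableAt.hasFDerivAt
        exact h3.comp_hasDerivAt 0 h2
      have h2 : HasDerivAt (fun s : ℂ => f (t₀, p + s • h)) (M.mul t₀ p h + M.mul t₀ h p - h) 0 := by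
        have e : (fun s : ℂ => f (t₀, p + s • h)) = fun s : ℂ =>
            s • (M.mul t₀ p h + M.mul t₀ h p - h) + s ^ 2 • M.mul t₀ h h := by
          funext s
          simp only [f, ← mulBilin_apply, map_add, map_smul, LinearMap.add_apply,
            LinearMap.smul_apply]
          rw [mulBilin_apply M t₀ p p, hp]
          module
        rw [e]
        have h3 := ((hasDerivAt_id (0 : ℂ)).smul_const (M.mul t₀ p h + M.mul t₀ h p - h)).add
          ((hasDerivAt_pow 2 (0 : ℂ)).smul_const (M.mul t₀ h h))
        exact h3.congr_deriv (by simp)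
      exact h1.unique h2
    -- on idempotents `2 p - 1` is an involution, and `A` is the multiplication by it
    have hinj : Function.Injective A := by
      rw [injective_iff_map_eq_zero]
      intro h hh
      rw [hAh] at hh
      obtain ⟨-, φ, hφ⟩ := ht
      have h1 : φ p * φ p = φ p := by rw [← hφ, hp]
      have h2 : φ p * φ h + φ h * φ p - φ h = 0 := by
        rw [← hφ, ← hφ, ← map_add, ← map_sub, hh, map_zero]
      apply φ.injective
      rw [map_zero]
      calc φ h = (2 * φ p - 1) * (φ p * φ h + φ h * φ p - φ h) := by
            linear_combination (-4 * φ h) * h1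
        _ = 0 := by rw [h2, mul_zero]
    refine ⟨(LinearEquiv.ofInjectiveEndo A.toLinearMap hinj).toContinuousLinearEquiv, ?_⟩
    ext1 x
    rfl
  have hω : (ω : WithTop ℕ∞) ≠ 0 := by simp
  have hf0 : f (t₀, p) = 0 := by simp [f, hp]
  refine ⟨hf.implicitFunction hω hinv, ?_, hf.implicitFunction_apply_self hω hinv, ?_, ?_⟩
  · exact (hf.contDiffAt_implicitFunction hω hinv).analyticAt
  · filter_upwards [hf.eventually_apply_implicitFunction hω hinv] with t ht
    rw [hf0] at ht
    exact sub_eq_zero.1 ht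
  · filter_upwards [hf.eventually_apply_eq_iff_implicitFunction hω hinv] with w hw h
    exact hw.1 (by rw [hf0]; exact sub_eq_zero.2 h)

open Topology Filter in
/-- Near a semisimple point the orthogonal idempotents can be chosen as analytic vector fields. -/
theorem exists_local_frame {U : Set (Fin n → ℂ)} (hU : IsOpen U) (hs : U ⊆ M.semisimpleLocus)
    {t₀ : Fin n → ℂ} (ht₀ : t₀ ∈ U) : ∃ (v : Fin n → (Fin n → ℂ) → Fin n → ℂ) (W : Set (Fin n → ℂ)),
      IsOpen W ∧ t₀ ∈ W ∧ W ⊆ U ∧ (∀ i, AnalyticOnNhd ℂ (v i) W) ∧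
      ∀ t ∈ W, M.IsFrameAt t fun i => v i t := by
  obtain ⟨e, he⟩ := M.exists_isFrameAt (hs ht₀)
  choose v hva hv0 hvi hvu using fun i =>
    M.exists_idempotent_germ (hs ht₀) ((he.mul_eq i i).trans (if_pos rfl))
  have h00 : ∀ t, M.mul t 0 0 = 0 := fun t => by rw [← mulBilin_apply, map_zero]
  -- zero is an idempotent, too: an idempotent close to it vanishes
  obtain ⟨z, -, -, -, hz⟩ := M.exists_idempotent_germ (hs ht₀) (h00 t₀)
  have hz0 : ∀ᶠ t in 𝓝 t₀, z t = 0 := by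
    have hc : Tendsto (fun t : Fin n → ℂ => (t, (0 : Fin n → ℂ))) (𝓝 t₀) (𝓝 (t₀, 0)) :=
      Continuous.tendsto (by fun_prop) t₀
    filter_upwards [hc.eventually hz] with t ht using ht (h00 t)
  have horth : ∀ i j, i ≠ j → ∀ᶠ t in 𝓝 t₀, M.mul t (v i t) (v j t) = 0 := by
    intro i j hij
    have hc : ContinuousAt (fun t => M.mul t (v i t) (v j t)) t₀ := by
      have h := fun a b c => M.analyticAt_c3 (hs ht₀).1 a b c
      have hs : ∀ i a, AnalyticAt ℂ (fun t => v i t a) t₀ := fun i =>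
        analyticAt_pi_iff.1 (hva i)
      apply AnalyticAt.continuousAt (𝕜 := ℂ)
      rw [analyticAt_pi_iff]
      intro a
      simp only [mul]
      fun_prop
    have h1 : M.mul t₀ (v i t₀) (v j t₀) = 0 := by rw [hv0, hv0, he.mul_eq, if_neg hij]
    have hc2 : Tendsto (fun t => (t, M.mul t (v i t) (v j t))) (𝓝 t₀) (𝓝 (t₀, 0)) := by
      have := continuousAt_id.prodMk hc
      rw [ContinuousAt, h1] at this
      exact this
    filter_upwards [hc2.eventually hz, hz0, hvi i, hvi j, hU.mem_nhds ht₀] with t h2 h3 h4 h5 h6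
    rw [← h2 ?_, h3]
    -- a product of idempotents is an idempotent
    obtain ⟨-, φ, hφ⟩ := hs h6
    apply φ.injective
    have e1 : φ (v i t) * φ (v i t) = φ (v i t) := by rw [← hφ, h4]
    have e2 : φ (v j t) * φ (v j t) = φ (v j t) := by rw [← hφ, h5]
    simp only [hφ]
    linear_combination (φ (v j t) * φ (v j t)) * e1 + φ (v i t) * e2
  have hne : ∀ i, ∀ᶠ t in 𝓝 t₀, v i t ≠ 0 := fun i =>
    (hva i).continuousAt.eventually_ne (by rw [hv0]; exact he.ne_zero i)
  have hall : ∀ᶠ t in 𝓝 t₀, t ∈ U ∧ (∀ i, AnalyticAt ℂ (v i) t) ∧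
      M.IsFrameAt t fun i => v i t := by
    have h1 := eventually_all.2 fun i => (hva i).eventually_analyticAt
    have h2 := eventually_all.2 hvi
    have h3 := eventually_all.2 hne
    have h4 : ∀ᶠ t in 𝓝 t₀, ∀ i j, i ≠ j → M.mul t (v i t) (v j t) = 0 :=
      eventually_all.2 fun i => eventually_all.2 fun j => by
        by_cases hij : i = j
        · exact Eventually.of_forall fun t h => absurd hij h
        · exact (horth i j hij).mono fun t h _ => h
    filter_upwards [hU.mem_nhds ht₀, h1, h2, h3, h4] with t a1 a2 a3 a4 a5
    refine ⟨a1, a2, fun i j => ?_, a4⟩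
    by_cases hij : i = j
    · subst hij; simp [a3 i]
    · simp [hij, a5 i j hij]
  obtain ⟨W, hW, hWo, htW⟩ := eventually_nhds_iff.1 hall
  exact ⟨v, W, hWo, htW, fun t ht => (hW t ht).1, fun i t ht => (hW t ht).2.1 i,
    fun t ht => (hW t ht).2.2⟩

open Topology Filter in
/-- On a simply connected open set the orthogonal idempotents can be ordered consistently. -/
theorem exists_global_frame {U : Set (Fin n → ℂ)} (hU : IsOpen U) (hs : U ⊆ M.semisimpleLocus)
    [SimplyConnectedSpace U] : ∃ v : Fin n → (Fin n → ℂ) → Fin n → ℂ,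
      (∀ i, AnalyticOnNhd ℂ (v i) U) ∧ ∀ t ∈ U, M.IsFrameAt t fun i => v i t := by
  classical
  have hloc := fun x : U => M.exists_local_frame hU hs x.2
  choose v W hWo hxW hWU hva hvf using hloc
  have := hU.locallyPathConnectedSpace
  have hWo' : ∀ x : U, IsOpen (Subtype.val ⁻¹' W x : Set U) := fun x =>
    (hWo x).preimage continuous_subtype_val
  have hinj : ∀ x : U, ∀ p ∈ (Subtype.val ⁻¹' W x : Set U),
      Function.Injective fun i => v x i (p : Fin n → ℂ) := fun x p hp => (hvf x p hp).injective
  have hcont : ∀ x i, ∀ p : U, (p : Fin n → ℂ) ∈ W x →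
      ContinuousAt (fun q : U => v x i (q : Fin n → ℂ)) p := fun x i p hp =>
    ((hva x i p hp).continuousAt).comp continuous_subtype_val.continuousAt
  let x₀ : U := Classical.arbitrary U
  have hbr := fun i => exists_global_branch (X := U) (Z := Fin n → ℂ) (ι := Fin n)
    (fun x => Subtype.val ⁻¹' W x) hWo' hxW (fun x i p => v x i p) hinj
    (fun x y p hx hy i => (hvf x p hx).exists_eq (hvf y p hy) i)
    (by
      intro x y i j p hx hy hp
      have h1 : ∀ᶠ q : U in 𝓝 p, ∀ k, k ≠ j → v x i (q : Fin n → ℂ) ≠ v y k q := by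
        refine eventually_all.2 fun k => ?_
        by_cases hk : k = j
        · exact Eventually.of_forall fun q h => absurd hk h
        · have : v x i (p : Fin n → ℂ) ≠ v y k p := by
            rw [hp]
            exact fun h => hk (hinj y p hy h.symm)
          exact (((hcont x i p hx).sub (hcont y k p hy)).eventually_ne (sub_ne_zero.2 this)).mono
            fun q h _ => sub_ne_zero.1 h
      filter_upwards [h1, (hWo' x).mem_nhds hx, (hWo' y).mem_nhds hy] with q hq hqx hqy
      obtain ⟨k, hk⟩ := (hvf x q hqx).exists_eq (hvf y q hqy) i
      by_cases hkj : k = j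
      · rw [← hk, hkj]
      · exact absurd hk.symm (hq k hkj))
    x₀ i
  choose f hf0 hf using hbr
  have hfinj : ∀ x, Function.Injective fun i => f i x := by
    intro x i j hij
    by_contra hne
    refine branch_ne (fun x => Subtype.val ⁻¹' W x) hWo' hxW (fun x i p => v x i p) hinj
      (hf i) (hf j) (x₀ := x₀) ?_ x hij
    rw [hf0, hf0]
    exact fun h => hne (hinj x₀ x₀ (hxW x₀) h)
  refine ⟨fun i t => if h : t ∈ U then f i ⟨t, h⟩ else 0, fun i t ht => ?_, fun t ht => ?_⟩
  · obtain ⟨k, hk⟩ := hf i ⟨t, ht⟩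
    refine (hva ⟨t, ht⟩ k t (hxW _)).congr ?_
    change ∀ᶠ y in 𝓝 t, _
    rw [← map_nhds_subtype_coe_eq_nhds ht (hU.mem_nhds ht), eventually_map]
    filter_upwards [hk] with q hq
    simp only [dif_pos q.2, Subtype.coe_eta, hq]
  · choose σ hσ using fun i => hf i ⟨t, ht⟩
    have hσ' : ∀ i, f i ⟨t, ht⟩ = v ⟨t, ht⟩ (σ i) t := fun i => (hσ i).self_of_nhds
    have hσi : Function.Injective σ := by
      intro i j hij
      apply hfinj ⟨t, ht⟩
      simp only [hσ', hij]
    have hfr := hvf ⟨t, ht⟩ t (hxW _)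
    simp only [dif_pos ht, hσ']
    refine ⟨fun i j => ?_, fun i => hfr.ne_zero _⟩
    rw [hfr.mul_eq]
    simp only [hσi.eq_iff]

end FrobeniusManifold

/-! ### The ring of holomorphic functions -/

open TopologicalSpace (Opens)

/-- The ring of holomorphic functions on an open subset `U` of `ℂⁿ`.  They are functions on the
subtype `U`, so that functions with the same values on `U` are equal. -/
def Hol {n : ℕ} (U : Opens (Fin n → ℂ)) : Subalgebra ℂ (U → ℂ) where
  carrier := {f | ∃ g : (Fin n → ℂ) → ℂ, AnalyticOnNhd ℂ g U ∧ ∀ t : U, f t = g t}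
  mul_mem' := by
    rintro f₁ f₂ ⟨g₁, h₁, e₁⟩ ⟨g₂, h₂, e₂⟩
    exact ⟨g₁ * g₂, h₁.mul h₂, fun t => by simp [e₁, e₂]⟩
  add_mem' := by
    rintro f₁ f₂ ⟨g₁, h₁, e₁⟩ ⟨g₂, h₂, e₂⟩
    exact ⟨g₁ + g₂, h₁.add h₂, fun t => by simp [e₁, e₂]⟩
  algebraMap_mem' c := ⟨fun _ => c, analyticOnNhd_const, fun _ => rfl⟩

namespace Hol

variable {n : ℕ} {U : Opens (Fin n → ℂ)}

/-- The restriction to `U` of a function that is analytic there. -/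
def mk (g : (Fin n → ℂ) → ℂ) (hg : AnalyticOnNhd ℂ g U) : Hol U := ⟨fun t => g t, g, hg, fun _ => rfl⟩

/-- The extension by zero, a function on `ℂⁿ` that can be differentiated. -/
def lift (f : Hol U) (t : Fin n → ℂ) : ℂ := open Classical in if h : t ∈ U then f.1 ⟨t, h⟩ else 0

/-- The evaluation at a point. -/
def ev (t : U) : Hol U →ₐ[ℂ] ℂ := (Pi.evalAlgHom ℂ (fun _ : U => ℂ) t).comp (Hol U).val

@[simp] theorem ev_mk (t : U) (g : (Fin n → ℂ) → ℂ) (hg) : ev t (mk g hg) = g t := rfl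

theorem ev_eq_lift (t : U) (f : Hol U) : ev t f = (lift f) t := by
  simp [lift, ev]

theorem ev_ext {f g : Hol U} (h : ∀ t, ev t f = ev t g) : f = g :=
  Subtype.ext (funext h)

theorem lift_mk (g : (Fin n → ℂ) → ℂ) (hg) : Set.EqOn (lift (mk (U := U) g hg)) g U := by
  intro t ht
  have : (lift (mk (U := U) g hg)) t = g t := (ev_eq_lift ⟨t, ht⟩ (mk g hg)).symm
  exact this

theorem analyticOnNhd_lift (f : Hol U) : AnalyticOnNhd ℂ (lift f) U := by
  obtain ⟨f, g, hg, e⟩ := f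
  refine hg.congr U.isOpen fun t ht => ?_
  have := ev_eq_lift ⟨t, ht⟩ (⟨f, g, hg, e⟩ : Hol U)
  rw [← this]
  exact (e ⟨t, ht⟩).symm

theorem mk_lift (f : Hol U) : mk (lift f) (analyticOnNhd_lift f) = f :=
  ev_ext fun t => (ev_eq_lift t f).symm

theorem mk_congr {g g' : (Fin n → ℂ) → ℂ} {hg hg'} (h : Set.EqOn g g' U) :
    mk (U := U) g hg = mk g' hg' := ev_ext fun t => h t.2

theorem analyticOnNhd_partialD {g : (Fin n → ℂ) → ℂ} (hg : AnalyticOnNhd ℂ g U) (a : Fin n) :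
    AnalyticOnNhd ℂ (partialD a g) U := fun t ht => (hg t ht).partialD a

/-- The partial derivatives as derivations of the ring of holomorphic functions. -/
def D (a : Fin n) : Derivation ℂ (Hol U) (Hol U) :=
  Derivation.mk'
    { toFun := fun f => mk (partialD a (lift f)) (analyticOnNhd_partialD (analyticOnNhd_lift f) a)
      map_add' := fun f g => ev_ext fun t => by
        have e : Set.EqOn (lift (f + g)) ((lift f) + (lift g)) U := fun s hs => by
          simp only [Pi.add_apply, ← ev_eq_lift (⟨s, hs⟩ : U), map_add]
        rw [map_add, ev_mk, ev_mk, ev_mk, partialD_congr U.isOpen e a t.2]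
        simp only [partialD]
        rw [fderiv_add (analyticOnNhd_lift f t t.2).differentiableAt
          (analyticOnNhd_lift g t t.2).differentiableAt]
        rfl
      map_smul' := fun c f => ev_ext fun t => by
        have e : Set.EqOn (lift (c • f)) (c • (lift f)) U := fun s hs => by
          simp only [Pi.smul_apply, ← ev_eq_lift (⟨s, hs⟩ : U), map_smul]
        rw [RingHom.id_apply, map_smul, ev_mk, ev_mk, partialD_congr U.isOpen e a t.2]
        simp only [partialD]
        rw [fderiv_const_smul (analyticOnNhd_lift f t t.2).differentiableAt]
        rfl }
    fun f g => ev_ext fun t => by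
      have e : Set.EqOn (lift (f * g)) ((lift f) * (lift g)) U := fun s hs => by
        simp only [Pi.mul_apply, ← ev_eq_lift (⟨s, hs⟩ : U), map_mul]
      simp only [LinearMap.coe_mk, AddHom.coe_mk, smul_eq_mul, map_add, map_mul, ev_mk]
      rw [partialD_congr U.isOpen e a t.2, ev_eq_lift, ev_eq_lift]
      simp only [partialD]
      rw [fderiv_mul (analyticOnNhd_lift f t t.2).differentiableAt
        (analyticOnNhd_lift g t t.2).differentiableAt]
      rfl

theorem D_mk (a : Fin n) (g : (Fin n → ℂ) → ℂ) (hg : AnalyticOnNhd ℂ g U) :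
    D a (mk g hg) = mk (partialD a g) (analyticOnNhd_partialD hg a) :=
  mk_congr (hg := analyticOnNhd_partialD (analyticOnNhd_lift _) a)
    (partialD_congr U.isOpen (lift_mk g hg) a)

theorem analyticOnNhd_coord (a : Fin n) : AnalyticOnNhd ℂ (fun t : Fin n → ℂ => t a) U := fun t _ =>
  analyticAt_pi_iff.1 (analyticAt_id (𝕜 := ℂ) (z := t)) a

/-- The flat coordinates. -/
def coord (a : Fin n) : Hol U := mk (fun t => t a) (analyticOnNhd_coord a)

theorem ev_coord (t : U) (a : Fin n) : ev t (coord a) = (t : Fin n → ℂ) a := rfl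

theorem D_coord (b a : Fin n) : D b (coord (U := U) a) = if a = b then 1 else 0 := by
  refine ev_ext fun t => ?_
  have h : HasFDerivAt (fun t : Fin n → ℂ => t a) (ContinuousLinearMap.proj (R := ℂ)
    (φ := fun _ : Fin n => ℂ) a) (t : Fin n → ℂ) := hasFDerivAt_apply a _
  rw [coord, D_mk, ev_mk, partialD, h.fderiv]
  by_cases hab : a = b
  · subst hab; simp
  · simp [hab]

theorem D_comm (a b : Fin n) (f : Hol U) : D a (D b f) = D b (D a f) := by
  rw [← mk_lift f]
  simp only [D_mk]
  exact mk_congr fun t ht => partialD_comm (analyticOnNhd_lift f t ht) a b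

theorem isUnit_of_ev_ne_zero {f : Hol U} (h : ∀ t, ev t f ≠ 0) : IsUnit f := by
  have hi : AnalyticOnNhd ℂ (lift f)⁻¹ U := (analyticOnNhd_lift f).inv fun t ht => by
    have := h ⟨t, ht⟩
    rwa [ev_eq_lift] at this
  refine IsUnit.of_mul_eq_one (mk _ hi) (ev_ext fun t => ?_)
  rw [map_mul, map_one, ev_mk, Pi.inv_apply, ← ev_eq_lift]
  exact mul_inv_cancel₀ (h t)

end Hol

namespace FrobeniusManifold

variable {n : ℕ} [NeZero n]

/-- Holomorphic vector fields on `U` that form a frame of orthogonal idempotents at each point. -/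
structure IdempotentFields (M : FrobeniusManifold n) (U : Opens (Fin n → ℂ)) where
  subset_domain : (U : Set (Fin n → ℂ)) ⊆ M.domain
  field : Fin n → (Fin n → ℂ) → Fin n → ℂ
  analytic : ∀ i, AnalyticOnNhd ℂ (field i) U
  isFrameAt : ∀ t ∈ U, M.IsFrameAt t fun i => field i t

namespace IdempotentFields

variable {M : FrobeniusManifold n} {U : Opens (Fin n → ℂ)} (v : M.IdempotentFields U)

/-- The components of the idempotent vector fields. -/
def vec (i a : Fin n) : Hol U :=
  Hol.mk (fun t => v.field i t a) fun t ht => analyticAt_pi_iff.1 (v.analytic i t ht) a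

theorem ev_vec (t : U) (i a) : Hol.ev t (v.vec i a) = v.field i t a := rfl

theorem isUnit_det : IsUnit (Matrix.of v.vec).det := by
  refine Hol.isUnit_of_ev_ne_zero fun t => ?_
  rw [AlgHom.map_det]
  exact (v.isFrameAt t t.2).det_ne_zero

/-- The components of the dual covector fields. -/
def covec (i a : Fin n) : Hol U := (Matrix.of v.vec)⁻¹ a i

/-- The potential, as an element of the ring of holomorphic functions. -/
def potential : Hol U := Hol.mk M.F (M.analytic_F.mono v.subset_domain)

theorem ev_D_D_D (t : U) (a b c : Fin n) : Hol.ev t (Hol.D a (Hol.D b (Hol.D c v.potential))) =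
    partialD a (partialD b (partialD c M.F)) t := by
  simp only [potential, Hol.D_mk, Hol.ev_mk]

/-- Lowering an index of the product gives the third derivatives of the potential. -/
theorem sum_metric_mul (M : FrobeniusManifold n) (t x y : Fin n → ℂ) (d : Fin n) :
    ∑ c, M.η d c * M.mul t x y c =
      ∑ a, ∑ b, partialD d (partialD a (partialD b M.F)) t * x a * y b := by
  have h : ∀ a b, ∑ c, M.η d c * M.c3 c a b t = partialD d (partialD a (partialD b M.F)) t := by
    intro a b
    have h1 : M.η.mulVec (M.η⁻¹.mulVec fun e => partialD e (partialD a (partialD b M.F)) t) d =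
        partialD d (partialD a (partialD b M.F)) t := by
      rw [Matrix.mulVec_mulVec, Matrix.mul_nonsing_inv _ M.η_nondeg, Matrix.one_mulVec]
    exact h1
  simp only [← h, mul, Finset.mul_sum, Finset.sum_mul]
  rw [Finset.sum_comm]
  refine Finset.sum_congr rfl fun a _ => ?_
  rw [Finset.sum_comm]
  exact Finset.sum_congr rfl fun b _ => Finset.sum_congr rfl fun c _ => by ring

/-- A frame of idempotents on `U` as a conformal frame over the ring of holomorphic functions
on `U`. -/
def conformalFrame : ConformalFrame n (Hol U) where
  D := Hol.D
  D_comm := Hol.D_comm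
  F := v.potential
  η := M.η
  η_symm := M.η_symm
  η_nondeg := M.η_nondeg
  unit a b := Hol.ev_ext fun t => by
    rw [v.ev_D_D_D, AlgHom.commutes, M.unit t (v.subset_domain t.2)]
    rfl
  vec := v.vec
  covec := v.covec
  covec_vec i j := by
    have h := congr_fun (congr_fun (Matrix.mul_nonsing_inv _ v.isUnit_det) j) i
    rw [Matrix.mul_apply, Matrix.one_apply] at h
    simp only [covec, eq_comm (a := i)]
    rw [← h]
    exact Finset.sum_congr rfl fun _ _ => mul_comm _ _
  vec_covec a b := by
    have h := congr_fun (congr_fun (Matrix.nonsing_inv_mul _ v.isUnit_det) b) a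
    rw [Matrix.mul_apply, Matrix.one_apply] at h
    simp only [covec, eq_comm (a := a)]
    rw [← h]
    exact Finset.sum_congr rfl fun _ _ => mul_comm _ _
  idem i j d := Hol.ev_ext fun t => by
    have h := sum_metric_mul M t (v.field i t) (v.field j t) d
    rw [(v.isFrameAt t t.2).mul_eq] at h
    simp only [map_sum, map_mul, v.ev_D_D_D, ev_vec]
    rw [← h]
    split_ifs
    · simp [ev_vec]
    · simp
  t := Hol.coord
  D_t := Hol.D_coord
  q := M.q
  r := M.r
  d := M.d
  A := M.A
  B := M.B
  C := M.C
  q_zero := M.q_zero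
  quasihom := Hol.ev_ext fun t => by
    have h := M.quasihom t (v.subset_domain t.2)
    simp only [map_sum, map_mul, map_add, AlgHom.commutes, Hol.ev_coord, Hol.ev_mk, potential, Hol.D_mk]
    simp only [Algebra.algebraMap_self, RingHom.id_apply]
    rw [h]
    simp only [mul_assoc]

end IdempotentFields
end FrobeniusManifold

/-! ### From the ring of holomorphic functions to functions -/

open TopologicalSpace (Opens)

namespace FrobeniusManifold.IdempotentFields

variable {n : ℕ} [NeZero n] {M : FrobeniusManifold n} {U : Opens (Fin n → ℂ)}
  (v : M.IdempotentFields U)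

theorem ev_F3 (t : U) (a b c : Fin n) : Hol.ev t (v.conformalFrame.F3 a b c) =
    partialD a (partialD b (partialD c M.F)) t := v.ev_D_D_D t a b c

theorem ev_c3 (t : U) (a b c : Fin n) : Hol.ev t (v.conformalFrame.c3 a b c) = M.c3 a b c t := by
  simp only [IdempotentFrame.c3, map_sum, map_mul, AlgHom.commutes, ev_F3]
  rfl

theorem ev_c4 (t : U) (a b c d : Fin n) :
    Hol.ev t (v.conformalFrame.c4 a b c d) = M.c4 a b c d t := by
  have h : ∀ e, Hol.ev t (v.conformalFrame.F4 e b c d) =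
      partialD e (partialD b (partialD c (partialD d M.F))) t := fun e => by
    change Hol.ev t (Hol.D e (Hol.D b (Hol.D c (Hol.D d v.potential)))) = _
    simp only [potential, Hol.D_mk, Hol.ev_mk]
  simp only [IdempotentFrame.c4, map_sum, map_mul, AlgHom.commutes, h]
  rfl

theorem ev_c5 (t : U) (a b c d e : Fin n) :
    Hol.ev t (v.conformalFrame.c5 a b c d e) = M.c5 a b c d e t := by
  have h : ∀ x, Hol.ev t (v.conformalFrame.D x (v.conformalFrame.F4 b c d e)) =
      partialD x (partialD b (partialD c (partialD d (partialD e M.F)))) t := fun x => by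
    change Hol.ev t (Hol.D x (Hol.D b (Hol.D c (Hol.D d (Hol.D e v.potential))))) = _
    simp only [potential, Hol.D_mk, Hol.ev_mk]
  simp only [IdempotentFrame.c5, map_sum, map_mul, AlgHom.commutes, h]
  rfl

theorem getzlerPoly_eq {G : (Fin n → ℂ) → ℂ} (hG : AnalyticOnNhd ℂ G U) (t : U) (z : Fin n → ℂ) :
    M.getzlerPoly G t z = v.conformalFrame.getzler (Hol.mk G hG) z (Hol.ev t).toRingHom := by
  have h1 : ∀ a, Hol.ev t (v.conformalFrame.D a (Hol.mk G hG)) = partialD a G t := fun a => by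
    change Hol.ev t (Hol.D a (Hol.mk G hG)) = _
    rw [Hol.D_mk, Hol.ev_mk]
  have h2 : ∀ a b, Hol.ev t (v.conformalFrame.D a (v.conformalFrame.D b (Hol.mk G hG))) =
      partialD a (partialD b G) t := fun a b => by
    change Hol.ev t (Hol.D a (Hol.D b (Hol.mk G hG))) = _
    rw [Hol.D_mk, Hol.D_mk, Hol.ev_mk]
  simp only [getzlerPoly, IdempotentFrame.getzler, AlgHom.toRingHom_eq_coe, RingHom.coe_coe, ev_c3,
    ev_c4, ev_c5, h1, h2]

/-- A vector with the components `Z` in the frame; thus all values of the canonical components occur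
at a given point. -/
theorem ev_can (t : U) (Z : Fin n → ℂ) (i : Fin n) :
    Hol.ev t (v.conformalFrame.can (fun a => ∑ k, Z k * v.field k t a) i) = Z i := by
  have h : ∀ k, ∑ a, v.field k t a * Hol.ev t (v.conformalFrame.covec i a) =
      if i = k then 1 else 0 := fun k => by
    have := congr_arg (Hol.ev t) (v.conformalFrame.comp_covec k i)
    simp only [IdempotentFrame.comp, pairing, map_sum, map_mul] at this
    refine this.trans ?_
    split_ifs <;> simp
  simp only [IdempotentFrame.can, pairing, map_sum, map_mul, AlgHom.commutes, Finset.sum_mul]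
  rw [Finset.sum_comm]
  simp only [Algebra.algebraMap_self, RingHom.id_apply, mul_assoc, ← Finset.mul_sum, h]
  simp

theorem ev_L {G : (Fin n → ℂ) → ℂ} (hG : AnalyticOnNhd ℂ G U) (t : U) :
    Hol.ev t (v.conformalFrame.L (Hol.mk G hG)) = ∑ a, M.euler t a * partialD a G t := by
  have h1 : ∀ a, Hol.ev t (v.conformalFrame.D a (Hol.mk G hG)) = partialD a G t := fun a => by
    change Hol.ev t (Hol.D a (Hol.mk G hG)) = _
    rw [Hol.D_mk, Hol.ev_mk]
  have h2 : ∀ a, Hol.ev t (v.conformalFrame.E a) = M.euler t a := fun a => by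
    simp only [ConformalFrame.E, map_add, map_mul, AlgHom.commutes]
    rfl
  simp only [ConformalFrame.L, map_sum, map_mul, h1, h2]

/-- A solution with a constant scaling anomaly has the derivatives of `log (τ / J^{1/24})`. -/
theorem del_eq_sol_of_solution {G : (Fin n → ℂ) → ℂ} {γ : ℂ} (hG : M.IsGetzlerSolution G U)
    (hγ : M.HasAnomaly G γ U) (i : Fin n) :
    v.conformalFrame.del i (Hol.mk G hG.analytic) = v.conformalFrame.sol i := by
  have h0 : v.conformalFrame.D 0 (Hol.mk G hG.analytic) = 0 := Hol.ev_ext fun t => by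
    change Hol.ev t (Hol.D 0 (Hol.mk G hG.analytic)) = _
    rw [Hol.D_mk, Hol.ev_mk, hG.indep t t.2, map_zero]
  refine v.conformalFrame.del_eq_sol (γ := γ) h0 ?_ ?_ i
  · refine Hol.ev_ext fun t => ?_
    rw [ev_L, AlgHom.commutes, hγ t t.2]
    rfl
  · intro i j hij
    refine Hol.ev_ext fun t => ?_
    have h := eq_zero_of_sum_quartic (fun i j => Hol.ev t (v.conformalFrame.del i
        (v.conformalFrame.del j (Hol.mk G hG.analytic)))
        - (1 / 48) * Hol.ev t (v.conformalFrame.hess i j))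
      (fun i j => by
        rw [IdempotentFrame.del_comm, v.conformalFrame.hess_symm]) (fun Z => ?_) hij
    · rw [map_mul, AlgHom.commutes]
      exact sub_eq_zero.1 h
    · have h1 := v.conformalFrame.getzler_eq (Hol.mk G hG.analytic)
        (fun a => ∑ k, Z k * v.field k t a) (Hol.ev t) h0
      have h2 := hG.getzler t t.2 (fun a => ∑ k, Z k * v.field k t a)
      rw [v.getzlerPoly_eq hG.analytic] at h2
      simp only [ev_can] at h1
      have h3 := h1.symm.trans h2
      simpa using h3

theorem partialD_eq_of_solution {G : (Fin n → ℂ) → ℂ} {γ : ℂ} (hG : M.IsGetzlerSolution G U)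
    (hγ : M.HasAnomaly G γ U) (t : U) (a : Fin n) :
    partialD a G t = Hol.ev t (v.conformalFrame.form v.conformalFrame.sol a) := by
  rw [← (v.conformalFrame.del_eq_iff_D_eq (Hol.mk G hG.analytic) _).1
    (v.del_eq_sol_of_solution hG hγ) a]
  change _ = Hol.ev t (Hol.D a (Hol.mk G hG.analytic))
  rw [Hol.D_mk, Hol.ev_mk]

theorem L_eq_anomaly {G : Hol U} (h : ∀ i, v.conformalFrame.del i G = v.conformalFrame.sol i) :
    v.conformalFrame.L G = algebraMap ℂ _ M.anomaly := by
  rw [ConformalFrame.L_eq_sum]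
  simp only [h]
  exact v.conformalFrame.sum_u_sol

theorem anomaly_eq_of_solution (v : M.IdempotentFields U) {G : (Fin n → ℂ) → ℂ} {γ : ℂ}
    (hG : M.IsGetzlerSolution G U) (hγ : M.HasAnomaly G γ U) (t : U) : γ = M.anomaly := by
  have h := congr_arg (Hol.ev t) (v.L_eq_anomaly (v.del_eq_sol_of_solution hG hγ))
  rw [ev_L, hγ t t.2, AlgHom.commutes] at h
  exact h

/-- A function with the derivatives of `log (τ / J^{1/24})` is a solution. -/
theorem isSolution_of_partialD_eq {G : (Fin n → ℂ) → ℂ} (hG : AnalyticOnNhd ℂ G U)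
    (h : ∀ t : U, ∀ a, partialD a G t = Hol.ev t (v.conformalFrame.form v.conformalFrame.sol a)) :
    M.IsGetzlerSolution G U ∧ M.HasAnomaly G M.anomaly U := by
  have hdel : ∀ i, v.conformalFrame.del i (Hol.mk G hG) = v.conformalFrame.sol i := by
    rw [ConformalFrame.del_eq_iff_D_eq]
    intro a
    refine Hol.ev_ext fun t => ?_
    rw [← h t a]
    change Hol.ev t (Hol.D a (Hol.mk G hG)) = _
    rw [Hol.D_mk, Hol.ev_mk]
  have h0 : v.conformalFrame.D 0 (Hol.mk G hG) = 0 := by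
    rw [← IdempotentFrame.sum_del]
    simp only [hdel]
    exact v.conformalFrame.sum_sol
  refine ⟨⟨hG, fun t ht => ?_, fun t ht z => ?_⟩, fun t ht => ?_⟩
  · have h1 := congr_arg (Hol.ev ⟨t, ht⟩) h0
    change Hol.ev ⟨t, ht⟩ (Hol.D 0 (Hol.mk G hG)) = _ at h1
    rw [Hol.D_mk, Hol.ev_mk, map_zero] at h1
    exact h1
  · rw [v.getzlerPoly_eq hG ⟨t, ht⟩]
    refine (v.conformalFrame.getzler_eq _ z (Hol.ev ⟨t, ht⟩) h0).trans ?_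
    rw [Finset.sum_eq_zero, mul_zero]
    refine fun i _ => Finset.sum_eq_zero fun j _ => ?_
    by_cases hij : i = j
    · subst hij; simp
    · rw [hdel, v.conformalFrame.del_sol (Ne.symm hij), map_mul, AlgHom.commutes,
        v.conformalFrame.hess_symm]
      simp
  · have h1 := congr_arg (Hol.ev ⟨t, ht⟩) (v.L_eq_anomaly hdel)
    rw [ev_L, AlgHom.commutes] at h1
    exact h1

/-! ### Canonical coordinates -/

variable {v} {u : (Fin n → ℂ) → Fin n → ℂ}

/-- The coframe consists of the differentials of functions `u_i` exactly if the frame consists of the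
fields `∂/∂u_i`. -/
theorem ev_covec_eq_jac_iff (t : U) :
    (∀ i a, Hol.ev t (v.conformalFrame.covec i a) = jac u t i a) ↔
      ((jac u t).det ≠ 0 ∧ ∀ i, frame u i t = v.field i t) := by
  set P : Matrix (Fin n) (Fin n) ℂ := Matrix.of fun a i => v.field i t a
  set Q : Matrix (Fin n) (Fin n) ℂ := Matrix.of fun i a => Hol.ev t (v.conformalFrame.covec i a)
  have hQP : Q * P = 1 := by
    ext i j
    have := congr_arg (Hol.ev t) (v.conformalFrame.covec_vec i j)
    rw [map_sum] at this
    simp only [map_mul] at this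
    rw [Matrix.mul_apply, Matrix.one_apply]
    refine this.trans ?_
    split_ifs <;> simp
  constructor
  · intro h
    have hJ : Q = jac u t := Matrix.ext h
    rw [hJ] at hQP
    refine ⟨?_, fun i => ?_⟩
    · intro h0
      have := congr_arg Matrix.det hQP
      simp [h0] at this
    · ext a
      rw [frame, Matrix.inv_eq_right_inv hQP]
      rfl
  · rintro ⟨h0, h⟩ i a
    have hP : P = (jac u t)⁻¹ := by
      ext a i
      change v.field i t a = _
      rw [← h i]
      rfl
    have : Q = jac u t := by
      rw [hP] at hQP
      have := Matrix.inv_eq_left_inv hQP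
      rw [← this, Matrix.nonsing_inv_nonsing_inv _ (isUnit_iff_ne_zero.2 h0)]
    rw [← this]
    rfl

/-- The canonical coordinates given by the eigenvalues of the multiplication by `E`. -/
def canonical (v : M.IdempotentFields U) (t : Fin n → ℂ) (i : Fin n) : ℂ :=
  Hol.lift (v.conformalFrame.u i) t

theorem jac_canonical (t : U) (i a : Fin n) :
    jac v.canonical t i a = Hol.ev t (v.conformalFrame.covec i a) := by
  rw [← v.conformalFrame.D_u a i]
  rfl

theorem frame_canonical (t : U) (i : Fin n) : frame v.canonical i t = v.field i t :=
  ((ev_covec_eq_jac_iff t).1 fun i a => (jac_canonical t i a).symm).2 i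

theorem euler_eq_sum (t : U) (a : Fin n) :
    M.euler t a = ∑ i, Hol.ev t (v.conformalFrame.u i) * v.field i t a := by
  have h2 : ∀ a, Hol.ev t (v.conformalFrame.E a) = M.euler t a := fun a => by
    simp only [ConformalFrame.E, map_add, map_mul, AlgHom.commutes]
    rfl
  have h1 : v.conformalFrame.E a = ∑ i, v.conformalFrame.u i * v.conformalFrame.vec i a := by
    simp only [ConformalFrame.u, Finset.sum_mul]
    rw [Finset.sum_comm]
    calc _ = ∑ b, v.conformalFrame.E b * if a = b then 1 else 0 := by simp
      _ = _ := by
        refine Finset.sum_congr rfl fun b _ => ?_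
        rw [← v.conformalFrame.vec_covec a b, Finset.mul_sum]
        exact Finset.sum_congr rfl fun i _ => by ring
  rw [← h2, h1, map_sum]
  exact Finset.sum_congr rfl fun i _ => by rw [map_mul]; rfl

theorem isCanonical_canonical (v : M.IdempotentFields U) : M.IsCanonical v.canonical U where
  analytic i := Hol.analyticOnNhd_lift (v.conformalFrame.u i)
  det_ne_zero t ht :=
    ((ev_covec_eq_jac_iff ⟨t, ht⟩).1 fun i a => (jac_canonical ⟨t, ht⟩ i a).symm).1
  mul_frame t ht i j := by
    have h := fun i => frame_canonical (v := v) ⟨t, ht⟩ i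
    simp only [h, (v.isFrameAt t ht).mul_eq]
  euler_eq t ht := by
    have h := fun i => frame_canonical (v := v) ⟨t, ht⟩ i
    ext a
    simp only [h]
    rw [euler_eq_sum (v := v) ⟨t, ht⟩ a, Finset.sum_apply]
    exact Finset.sum_congr rfl fun i _ => by rw [Hol.ev_eq_lift]; rfl

/-- The coordinate vector fields of canonical coordinates as a frame of idempotents. -/
theorem exists_of_isCanonical (hU : (U : Set (Fin n → ℂ)) ⊆ M.domain) (hu : M.IsCanonical u U) :
    ∃ v : M.IdempotentFields U, ∀ t : U, ∀ i, frame u i t = v.field i t := by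
  have hJ : ∀ i a, AnalyticOnNhd ℂ (partialD a fun s => u s i) U := fun i a t ht =>
    (hu.analytic i t ht).partialD a
  let J : Matrix (Fin n) (Fin n) (Hol U) := Matrix.of fun i a => Hol.mk _ (hJ i a)
  have hJt : ∀ t : U, (Hol.ev t).mapMatrix J = jac u t := fun t => rfl
  have hJu : IsUnit J.det := Hol.isUnit_of_ev_ne_zero fun t => by
    rw [AlgHom.map_det, hJt]
    exact hu.det_ne_zero t t.2
  have hinv : ∀ (t : U) a i, Hol.ev t (J⁻¹ a i) = (jac u t)⁻¹ a i := by
    intro t a i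
    have h := congr_arg (Hol.ev t).mapMatrix (Matrix.mul_nonsing_inv _ hJu)
    rw [map_mul, map_one, hJt] at h
    rw [Matrix.inv_eq_right_inv h]
    rfl
  have hfr : ∀ (t : U) i, frame u i t = fun a => Hol.lift (J⁻¹ a i) t := fun t i => by
    ext a
    rw [← Hol.ev_eq_lift, hinv]
    rfl
  refine ⟨⟨hU, fun i t a => Hol.lift (J⁻¹ a i) t, fun i t ht => ?_, fun t ht => ⟨fun i j => ?_,
    fun i => ?_⟩⟩, hfr⟩
  · rw [analyticAt_pi_iff]
    exact fun a => Hol.analyticOnNhd_lift _ t ht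
  · have := hu.mul_frame t ht i j
    simp only [hfr ⟨t, ht⟩] at this
    exact this
  · rw [← hfr ⟨t, ht⟩ i]
    intro h0
    have h1 : jac u t * (jac u t)⁻¹ = 1 :=
      Matrix.mul_nonsing_inv _ (isUnit_iff_ne_zero.2 (hu.det_ne_zero t ht))
    have h2 := congr_fun (congr_fun h1 i) i
    rw [Matrix.mul_apply, Matrix.one_apply_eq] at h2
    have h3 : ∀ a, (jac u t)⁻¹ a i = 0 := fun a => congr_fun h0 a
    simp [h3] at h2

theorem ev_covec (hu : M.IsCanonical u U) (hv : ∀ t : U, ∀ i, frame u i t = v.field i t) (t : U)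
    (i a : Fin n) : Hol.ev t (v.conformalFrame.covec i a) = partialD a (fun s => u s i) t :=
  (ev_covec_eq_jac_iff t).2 ⟨hu.det_ne_zero t t.2, hv t⟩ i a

theorem ev_u (hu : M.IsCanonical u U) (hv : ∀ t : U, ∀ i, frame u i t = v.field i t) (t : U)
    (i : Fin n) : Hol.ev t (v.conformalFrame.u i) = u t i := by
  have h1 : ∑ i, (Hol.ev t (v.conformalFrame.u i) - u t i) • v.field i t = 0 := by
    ext a
    have h2 := congr_fun (hu.euler_eq t t.2) a
    rw [euler_eq_sum (v := v) t a] at h2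
    simp only [hv t] at h2
    simp only [sub_smul, Finset.sum_sub_distrib, Pi.sub_apply, Pi.zero_apply]
    rw [← h2]
    simp
  exact sub_eq_zero.1 (Fintype.linearIndependent_iff.1 (v.isFrameAt t t.2).linearIndependent _ h1 i)

theorem ev_det (hv : ∀ t : U, ∀ i, frame u i t = v.field i t) (t : U) :
    Hol.ev t v.conformalFrame.det = jacobian u t := by
  rw [ConformalFrame.det, AlgHom.map_det, jacobian]
  congr 1
  ext a i
  simp only [hv t]
  rfl

/-- The Hamiltonians.  The square roots in `ψ` enter only through their squares. -/
theorem ev_ham (hu : M.IsCanonical u U) (hv : ∀ t : U, ∀ i, frame u i t = v.field i t) (t : U)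
    (i : Fin n) : M.H u i t = (1 / 2) * Hol.ev t (v.conformalFrame.ham i) := by
  have hlow : ∀ i a, ∑ b, M.η a b * frame u i t b = Hol.ev t (v.conformalFrame.low i a) := by
    intro i a
    simp only [IdempotentFrame.low, map_sum, map_mul, AlgHom.commutes, hv t]
    rfl
  have hlen : ∀ i, M.metric (frame u i t) (frame u i t) = Hol.ev t (v.conformalFrame.len i) := by
    intro i
    simp only [IdempotentFrame.len, IdempotentFrame.comp, pairing, map_sum, map_mul, ← hlow]
    simp only [metric, Finset.mul_sum]
    refine Finset.sum_congr rfl fun a _ => Finset.sum_congr rfl fun b _ => ?_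
    have : Hol.ev t (v.conformalFrame.vec i a) = frame u i t a := by rw [hv t]; rfl
    rw [this]
    ring
  have hinv : ∀ i, Hol.ev t (v.conformalFrame.len i) * Hol.ev t (v.conformalFrame.inv i) = 1 := by
    intro i
    rw [← map_mul, IdempotentFrame.len_mul_inv, map_one]
  have hsq : ∀ x : ℂ, (x ^ (1 / 2 : ℂ)) ^ 2 = x := fun x => by
    simp
  have hη : ∀ a b, M.η⁻¹ a b = M.η⁻¹ b a := by
    intro a b
    have h : (M.η⁻¹).transpose = M.η⁻¹ := by
      rw [Matrix.transpose_nonsing_inv, M.η_symm.eq]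
    exact congr_fun (congr_fun h b) a
  have hraise : ∀ j a, ∑ c, M.psi u j c t * M.η⁻¹ c a =
      Hol.ev t (v.conformalFrame.vec j a) /
        (Hol.ev t (v.conformalFrame.len j)) ^ (1 / 2 : ℂ) := by
    intro j a
    simp only [psi, hlow, hlen]
    rw [← v.conformalFrame.sum_inv_low, map_sum, Finset.sum_div]
    refine Finset.sum_congr rfl fun c _ => ?_
    rw [map_mul, AlgHom.commutes, hη c a]
    change _ = M.η⁻¹ a c * _ / _
    ring
  have hV : ∀ i j, M.V u i j t = Hol.ev t (v.conformalFrame.mupair i j) /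
      ((Hol.ev t (v.conformalFrame.len i)) ^ (1 / 2 : ℂ) *
        (Hol.ev t (v.conformalFrame.len j)) ^ (1 / 2 : ℂ)) := by
    intro i j
    simp only [V, hraise, ConformalFrame.mupair, map_sum, map_mul, AlgHom.commutes, Finset.sum_div]
    refine Finset.sum_congr rfl fun a _ => ?_
    simp only [psi, hlow, hlen]
    change M.mu a * _ * _ = M.mu a * _ / _
    ring
  have hV2 : ∀ i j, M.V u i j t ^ 2 = (u t i - u t j) ^ 2 *
      Hol.ev t (v.conformalFrame.rotSq i j) := by
    intro i j
    rw [hV, div_pow, mul_pow, hsq, hsq, v.conformalFrame.mupair_eq, ConformalFrame.rotSq]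
    simp only [map_mul, map_sub, map_pow, ev_u hu hv]
    have h1 := hinv i
    have h2 := hinv j
    rw [div_eq_iff (mul_ne_zero (left_ne_zero_of_mul_eq_one h1) (left_ne_zero_of_mul_eq_one h2))]
    linear_combination (-(u t i - u t j) ^ 2 * Hol.ev t (v.conformalFrame.rot i j) ^ 2) *
      (h1 + Hol.ev t (v.conformalFrame.len i) * Hol.ev t (v.conformalFrame.inv i) * h2)
  rw [H, ConformalFrame.ham, map_sum]
  congr 1
  rw [← Finset.sum_erase_add _ _ (Finset.mem_univ i)]
  simp only [sub_self, zero_mul, map_zero, add_zero]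
  refine Finset.sum_congr rfl fun j _ => ?_
  rw [hV2, map_mul, map_sub, ev_u hu hv, ev_u hu hv]
  -- both sides vanish where `u i = u j`
  by_cases h : u t i - u t j = 0
  · simp [h]
  · field_simp

end FrobeniusManifold.IdempotentFields

/-! ### Logarithmic derivatives -/

open TopologicalSpace (Opens)

section LogDerivative

variable {n : ℕ}

/-- The logarithmic derivative `∂_a log f`. -/
def dlog (a : Fin n) (f : (Fin n → ℂ) → ℂ) (t : Fin n → ℂ) : ℂ := partialD a f t / f t

variable {f g : (Fin n → ℂ) → ℂ} {t : Fin n → ℂ} {U : Set (Fin n → ℂ)}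

theorem partialD_mul (a : Fin n) (hf : AnalyticAt ℂ f t) (hg : AnalyticAt ℂ g t) :
    partialD a (fun s => f s * g s) t = partialD a f t * g t + f t * partialD a g t := by
  simp only [partialD]
  rw [fderiv_fun_mul hf.differentiableAt hg.differentiableAt]
  simp only [add_apply, smul_apply, smul_eq_mul]
  ring

theorem partialD_const_mul (a : Fin n) (c : ℂ) (hf : AnalyticAt ℂ f t) :
    partialD a (fun s => c * f s) t = c * partialD a f t := by
  simp only [partialD]
  rw [fderiv_const_mul hf.differentiableAt]
  rfl

theorem dlog_congr (hU : IsOpen U) (h : Set.EqOn f g U) (a : Fin n) (ht : t ∈ U) :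
    dlog a f t = dlog a g t := by
  rw [dlog, dlog, partialD_congr hU h a ht, h ht]

theorem dlog_mul (a : Fin n) (hf : AnalyticAt ℂ f t) (hg : AnalyticAt ℂ g t) (hf0 : f t ≠ 0)
    (hg0 : g t ≠ 0) : dlog a (fun s => f s * g s) t = dlog a f t + dlog a g t := by
  rw [dlog, partialD_mul a hf hg, dlog, dlog]
  field_simp

theorem dlog_pow (a : Fin n) (hf : AnalyticAt ℂ f t) (hf0 : f t ≠ 0) (m : ℕ) :
    dlog a (fun s => f s ^ m) t = m * dlog a f t := by
  induction m with
  | zero => simp [dlog, partialD]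
  | succ m ih =>
    simp only [pow_succ]
    rw [dlog_mul a (hf.fun_pow m) hf (pow_ne_zero _ hf0) hf0, ih]
    push_cast
    ring

theorem dlog_div (a : Fin n) (hf : AnalyticAt ℂ f t) (hg : AnalyticAt ℂ g t) (hf0 : f t ≠ 0)
    (hg0 : g t ≠ 0) (hU : IsOpen U) (htU : t ∈ U) (hgU : ∀ s ∈ U, g s ≠ 0) :
    dlog a (fun s => f s / g s) t = dlog a f t - dlog a g t := by
  have h1 := dlog_mul a (hf.fun_div hg hg0) hg (div_ne_zero hf0 hg0) hg0
  have h2 : Set.EqOn (fun s => f s / g s * g s) f U := fun s hs => div_mul_cancel₀ _ (hgU s hs)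
  rw [dlog_congr hU h2 a htU] at h1
  rw [h1, add_sub_cancel_right]

theorem analyticOnNhd_exp (hf : AnalyticOnNhd ℂ f U) :
    AnalyticOnNhd ℂ (fun t => Complex.exp (f t)) U := fun t ht => (hf t ht).cexp

theorem dlog_exp (a : Fin n) (hf : AnalyticAt ℂ f t) :
    dlog a (fun s => Complex.exp (f s)) t = partialD a f t := by
  have h := (hf.differentiableAt.hasFDerivAt.cexp).fderiv
  rw [dlog, partialD, h]
  simp only [smul_apply, smul_eq_mul, partialD]
  field_simp

/-- Holomorphic functions without zeros on a connected open set are proportional exactly if they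
have the same logarithmic derivatives. -/
theorem exists_eq_const_mul_iff (hU : IsOpen U) (hc : IsConnected U) (hf : AnalyticOnNhd ℂ f U)
    (hg : AnalyticOnNhd ℂ g U) (hf0 : ∀ t ∈ U, f t ≠ 0) (hg0 : ∀ t ∈ U, g t ≠ 0) :
    (∃ k, k ≠ 0 ∧ ∀ t ∈ U, f t = k * g t) ↔ ∀ t ∈ U, ∀ a, dlog a f t = dlog a g t := by
  constructor
  · rintro ⟨k, hk, h⟩ t ht a
    rw [dlog_congr hU h a ht, dlog_mul a analyticAt_const (hg t ht) hk (hg0 t ht)]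
    simp [dlog, partialD]
  · intro h
    have hd : ∀ t ∈ U, ∀ a, partialD a (fun s => f s / g s) t = partialD a (fun _ => 0) t := by
      intro t ht a
      have h1 := dlog_div a (hf t ht) (hg t ht) (hf0 t ht) (hg0 t ht) hU ht hg0
      rw [h t ht a, sub_self, dlog, div_eq_zero_iff] at h1
      rw [h1.resolve_right (div_ne_zero (hf0 t ht) (hg0 t ht))]
      simp [partialD]
    obtain ⟨k, hk⟩ := exists_eq_add_const hU hc.isPreconnected
      (fun t ht => (hf t ht).fun_div (hg t ht) (hg0 t ht)) analyticOnNhd_const hd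
    obtain ⟨t₀, ht₀⟩ := hc.nonempty
    refine ⟨k, fun h0 => ?_, fun t ht => ?_⟩
    · have h1 := hk t₀ ht₀
      rw [h0, add_zero] at h1
      exact div_ne_zero (hf0 t₀ ht₀) (hg0 t₀ ht₀) h1
    · rw [← zero_add k, ← hk t ht, div_mul_cancel₀ _ (hg0 t ht)]

end LogDerivative

/-! ### Tau-functions and the solution -/

namespace FrobeniusManifold

variable {n : ℕ} [NeZero n] {M : FrobeniusManifold n}

theorem IsGetzlerSolution.mono {G : (Fin n → ℂ) → ℂ} {U W : Set (Fin n → ℂ)}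
    (h : M.IsGetzlerSolution G U) (hWU : W ⊆ U) : M.IsGetzlerSolution G W :=
  ⟨h.analytic.mono hWU, fun t ht => h.indep t (hWU ht), fun t ht => h.getzler t (hWU ht)⟩

namespace IdempotentFields

variable {U : Opens (Fin n → ℂ)} {v : M.IdempotentFields U} {u : (Fin n → ℂ) → Fin n → ℂ}

theorem ev_form_sol (v : M.IdempotentFields U) (t : U) (a : Fin n) :
    Hol.ev t (v.conformalFrame.form v.conformalFrame.sol a) =
      (1 / 2) * Hol.ev t (v.conformalFrame.form v.conformalFrame.ham a) -
        (1 / 24) * Hol.ev t (v.conformalFrame.form v.conformalFrame.logJac a) := by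
  simp only [ConformalFrame.form, ConformalFrame.sol, map_sum, map_mul, map_sub, AlgHom.commutes,
    Finset.mul_sum, ← Finset.sum_sub_distrib, Algebra.algebraMap_self, RingHom.id_apply]
  exact Finset.sum_congr rfl fun i _ => by ring

theorem sum_H (hu : M.IsCanonical u U) (hv : ∀ t : U, ∀ i, frame u i t = v.field i t) (t : U)
    (a : Fin n) : ∑ i, M.H u i t * partialD a (fun s => u s i) t =
      (1 / 2) * Hol.ev t (v.conformalFrame.form v.conformalFrame.ham a) := by
  simp only [ConformalFrame.form, map_sum, map_mul, Finset.mul_sum, ev_ham hu hv, ev_covec hu hv]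
  exact Finset.sum_congr rfl fun i _ => by ring

theorem analyticOnNhd_jacobian (hv : ∀ t : U, ∀ i, frame u i t = v.field i t) :
    AnalyticOnNhd ℂ (jacobian u) U :=
  (Hol.analyticOnNhd_lift v.conformalFrame.det).congr U.isOpen fun t ht => by
    rw [← ev_det hv ⟨t, ht⟩, Hol.ev_eq_lift]

theorem jacobian_ne_zero (hv : ∀ t : U, ∀ i, frame u i t = v.field i t) (t : U) :
    jacobian u t ≠ 0 := by
  rw [← ev_det hv t]
  exact (v.conformalFrame.isUnit_det.map (Hol.ev t)).ne_zero

theorem dlog_jacobian (hv : ∀ t : U, ∀ i, frame u i t = v.field i t) (t : U) (a : Fin n) :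
    dlog a (jacobian u) t = Hol.ev t (v.conformalFrame.form v.conformalFrame.logJac a) := by
  have h : Set.EqOn (jacobian u) (Hol.lift v.conformalFrame.det) U := fun t ht => by
    rw [← ev_det hv ⟨t, ht⟩, Hol.ev_eq_lift]
  have h1 := congr_arg (Hol.ev t) (v.conformalFrame.D_det a)
  have h2 : Hol.ev t (v.conformalFrame.D a v.conformalFrame.det) =
      partialD a (Hol.lift v.conformalFrame.det) t := rfl
  have h3 : Hol.ev t v.conformalFrame.det ≠ 0 :=
    (v.conformalFrame.isUnit_det.map (Hol.ev t)).ne_zero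
  rw [dlog_congr U.isOpen h a t.2, dlog, ← h2, h1, map_mul, ← Hol.ev_eq_lift, mul_div_cancel_left₀ _ h3]

theorem root_ne_zero (hv : ∀ t : U, ∀ i, frame u i t = v.field i t) {j : (Fin n → ℂ) → ℂ}
    (hj : IsJacobianRoot u j U) (t) (ht : t ∈ U) : j t ≠ 0 := by
  intro h
  have := hj.pow_eq t ht
  rw [h, zero_pow (by norm_num)] at this
  exact jacobian_ne_zero hv ⟨t, ht⟩ this.symm

/-- The logarithmic derivatives of `τ / J^{1/24}`. -/
theorem dlog_tau_div_root (hu : M.IsCanonical u U)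
    (hv : ∀ t : U, ∀ i, frame u i t = v.field i t) {τ j : (Fin n → ℂ) → ℂ} (hτ : M.IsTau u τ U)
    (hj : IsJacobianRoot u j U) (t : U) (a : Fin n) :
    dlog a (fun s => τ s / j s) t = Hol.ev t (v.conformalFrame.form v.conformalFrame.sol a) := by
  have hj0 := root_ne_zero hv hj
  have h1 : dlog a τ t = _ := hτ.dlog t t.2 a
  have h2 := dlog_pow a (hj.analytic t t.2) (hj0 t t.2) 24
  rw [dlog_congr U.isOpen hj.pow_eq a t.2, dlog_jacobian hv] at h2
  rw [dlog_div a (hτ.analytic t t.2) (hj.analytic t t.2) (hτ.ne_zero t t.2) (hj0 t t.2) U.isOpen t.2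
    hj0, h1, sum_H hu hv, ev_form_sol, h2]
  push_cast
  ring

end IdempotentFields

/-- The fields of idempotents near a point of the semisimple locus. -/
theorem exists_local_idempotentFields {U : Set (Fin n → ℂ)} (hU : IsOpen U)
    (hs : U ⊆ M.semisimpleLocus) {t : Fin n → ℂ} (ht : t ∈ U) :
    ∃ W : Opens (Fin n → ℂ), t ∈ W ∧ (W : Set (Fin n → ℂ)) ⊆ U ∧ Nonempty (M.IdempotentFields W) := by
  obtain ⟨v, W, hW, htW, hWU, hva, hvf⟩ := M.exists_local_frame hU hs ht
  exact ⟨⟨W, hW⟩, htW, hWU, ⟨⟨fun s hs' => (hs (hWU hs')).1, v, hva, hvf⟩⟩⟩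

/-- Existence: `τ` and a root of `J` are exponentials of primitives of closed forms. -/
theorem exists_solution {U : Set (Fin n → ℂ)} (hU : IsOpen U) (hs : U ⊆ M.semisimpleLocus)
    [SimplyConnectedSpace U] : ∃ (u : (Fin n → ℂ) → Fin n → ℂ) (τ j G : (Fin n → ℂ) → ℂ),
      M.IsCanonical u U ∧ M.IsTau u τ U ∧ IsJacobianRoot u j U ∧
      M.IsGetzlerSolution G U ∧ M.HasAnomaly G M.anomaly U ∧
      ∀ t ∈ U, Complex.exp (G t) = τ t / j t := by
  obtain ⟨f, hfa, hff⟩ := M.exists_global_frame hU hs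
  let U' : Opens (Fin n → ℂ) := ⟨U, hU⟩
  let v : M.IdempotentFields U' := ⟨fun t ht => (hs ht).1, f, hfa, hff⟩
  have hu : M.IsCanonical v.canonical U' := v.isCanonical_canonical
  have hv : ∀ t : U', ∀ i, frame v.canonical i t = v.field i t :=
    fun t i => IdempotentFields.frame_canonical t i
  have hconn : IsConnected U := isConnected_iff_connectedSpace.2 inferInstance
  have hprim : ∀ w : Fin n → Hol U',
      (∀ i j, v.conformalFrame.del j (w i) = v.conformalFrame.del i (w j)) →
      ∃ S, AnalyticOnNhd ℂ S U ∧ ∀ t : U', ∀ a,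
        partialD a S t = Hol.ev t (v.conformalFrame.form w a) := by
    intro w hw
    obtain ⟨S, hS, hSd⟩ := exists_primitive hU (fun a => Hol.lift (v.conformalFrame.form w a))
      (fun a => Hol.analyticOnNhd_lift _) fun t ht a b =>
        congr_arg (Hol.ev (⟨t, ht⟩ : U')) (v.conformalFrame.form_closed hw b a)
    exact ⟨S, hS, fun t a => by rw [hSd t t.2, Hol.ev_eq_lift]⟩
  obtain ⟨S, hS, hSd⟩ := hprim _ v.conformalFrame.del_ham_symm
  obtain ⟨l, hl, hld⟩ := hprim _ v.conformalFrame.del_logJac_symm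
  -- `l` is a logarithm of `J` up to the constant factor `c`
  obtain ⟨c, hc, hcJ⟩ := (exists_eq_const_mul_iff hU hconn
      (IdempotentFields.analyticOnNhd_jacobian hv) (analyticOnNhd_exp hl)
      (fun t ht => IdempotentFields.jacobian_ne_zero hv ⟨t, ht⟩) (fun t _ => Complex.exp_ne_zero _)).2
    fun t ht a => by
      rw [IdempotentFields.dlog_jacobian hv ⟨t, ht⟩, dlog_exp a (hl t ht), hld ⟨t, ht⟩]
  have hSt : AnalyticOnNhd ℂ (fun t => (1 / 2) * S t) U := fun t ht => analyticAt_const.fun_mul (hS t ht)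
  have hlt : AnalyticOnNhd ℂ (fun t => (1 / 24) * (l t + Complex.log c)) U := fun t ht =>
    analyticAt_const.fun_mul ((hl t ht).fun_add analyticAt_const)
  have hτ : M.IsTau v.canonical (fun t => Complex.exp ((1 / 2) * S t)) U :=
    ⟨analyticOnNhd_exp hSt, fun t _ => Complex.exp_ne_zero _, fun t ht a => by
      rw [IdempotentFields.sum_H hu hv ⟨t, ht⟩, ← hSd ⟨t, ht⟩, ← partialD_const_mul a _ (hS t ht)]
      exact dlog_exp a (hSt t ht)⟩
  have hj : IsJacobianRoot v.canonical (fun t => Complex.exp ((1 / 24) * (l t + Complex.log c))) U :=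
    ⟨analyticOnNhd_exp hlt, fun t ht => by
      rw [hcJ t ht, ← Complex.exp_nat_mul]
      have : ((24 : ℕ) : ℂ) * (1 / 24 * (l t + Complex.log c)) = Complex.log c + l t := by
        push_cast; ring
      rw [this, Complex.exp_add, Complex.exp_log hc]⟩
  have hG : AnalyticOnNhd ℂ (fun t => (1 / 2) * S t - (1 / 24) * (l t + Complex.log c)) U :=
    fun t ht => (hSt t ht).fun_sub (hlt t ht)
  have hexp : ∀ t ∈ U, Complex.exp ((1 / 2) * S t - (1 / 24) * (l t + Complex.log c)) =
      Complex.exp ((1 / 2) * S t) / Complex.exp ((1 / 24) * (l t + Complex.log c)) :=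
    fun t _ => Complex.exp_sub _ _
  have hsol := v.isSolution_of_partialD_eq hG fun t a => by
    rw [← IdempotentFields.dlog_tau_div_root hu hv hτ hj t a, ← dlog_exp a (hG t t.2)]
    exact dlog_congr hU hexp a t.2
  exact ⟨_, _, _, _, hu, hτ, hj, hsol.1, hsol.2, hexp⟩

end FrobeniusManifold

theorem theorem3 (n : ℕ) [NeZero n] (M : FrobeniusManifold n) (hM : M.IsSemisimple) :
    -- existence, on every simply connected domain of semisimple points
    (∀ U : Set (Fin n → ℂ), IsOpen U → U ⊆ M.semisimpleLocus → SimplyConnectedSpace U →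
      ∃ (u : (Fin n → ℂ) → Fin n → ℂ) (τ j G : (Fin n → ℂ) → ℂ),
        M.IsCanonical u U ∧ M.IsTau u τ U ∧ FrobeniusManifold.IsJacobianRoot u j U ∧
        M.IsGetzlerSolution G U ∧ M.HasAnomaly G M.anomaly U ∧
        ∀ t ∈ U, Complex.exp (G t) = τ t / j t) ∧
    -- uniqueness, the scaling anomaly and the formula, on every domain of semisimple points
    (∀ U : Set (Fin n → ℂ), IsOpen U → U ⊆ M.semisimpleLocus → IsConnected U →
      (∀ (G : (Fin n → ℂ) → ℂ) (γ : ℂ),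
        M.IsGetzlerSolution G U → M.HasAnomaly G γ U → γ = M.anomaly) ∧
      (∀ (G₁ G₂ : (Fin n → ℂ) → ℂ) (γ₁ γ₂ : ℂ),
        M.IsGetzlerSolution G₁ U → M.HasAnomaly G₁ γ₁ U →
        M.IsGetzlerSolution G₂ U → M.HasAnomaly G₂ γ₂ U →
        ∃ k : ℂ, ∀ t ∈ U, G₁ t = G₂ t + k) ∧
      (∀ (u : (Fin n → ℂ) → Fin n → ℂ) (τ j : (Fin n → ℂ) → ℂ),
        M.IsCanonical u U → M.IsTau u τ U → FrobeniusManifold.IsJacobianRoot u j U →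
        ∀ G : (Fin n → ℂ) → ℂ, AnalyticOnNhd ℂ G U →
          ((M.IsGetzlerSolution G U ∧ ∃ γ : ℂ, M.HasAnomaly G γ U) ↔
            ∃ k : ℂ, k ≠ 0 ∧ ∀ t ∈ U, Complex.exp (G t) = k * (τ t / j t)))) := by
  refine ⟨fun U hU hs _ => FrobeniusManifold.exists_solution hU hs, fun U hU hs hc => ⟨?_, ?_, ?_⟩⟩
  · intro G γ hG hγ
    -- there need not be a frame on all of `U`, but a local one suffices for these two claims
    obtain ⟨t, ht⟩ := hc.nonempty
    obtain ⟨W, htW, hWU, ⟨v⟩⟩ := FrobeniusManifold.exists_local_idempotentFields hU hs ht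
    exact FrobeniusManifold.IdempotentFields.anomaly_eq_of_solution v (hG.mono hWU)
      (fun s hs' => hγ s (hWU hs')) ⟨t, htW⟩
  · intro G₁ G₂ γ₁ γ₂ hG₁ hγ₁ hG₂ hγ₂
    refine exists_eq_add_const hU hc.isPreconnected hG₁.analytic hG₂.analytic fun t ht a => ?_
    obtain ⟨W, htW, hWU, ⟨v⟩⟩ := FrobeniusManifold.exists_local_idempotentFields hU hs ht
    rw [v.partialD_eq_of_solution (hG₁.mono hWU) (fun s hs' => hγ₁ s (hWU hs')) ⟨t, htW⟩,
      v.partialD_eq_of_solution (hG₂.mono hWU) (fun s hs' => hγ₂ s (hWU hs')) ⟨t, htW⟩]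
  · intro u τ j hu hτ hj G hG
    -- both conditions say that `exp G` and `τ / j` have the same logarithmic derivatives
    obtain ⟨v, hv⟩ := FrobeniusManifold.IdempotentFields.exists_of_isCanonical (U := ⟨U, hU⟩)
      (fun t ht => (hs ht).1) hu
    have hj0 := FrobeniusManifold.IdempotentFields.root_ne_zero hv hj
    have key := exists_eq_const_mul_iff hU hc (analyticOnNhd_exp hG)
      (fun t ht => (hτ.analytic t ht).fun_div (hj.analytic t ht) (hj0 t ht))
      (fun t _ => Complex.exp_ne_zero _) (fun t ht => div_ne_zero (hτ.ne_zero t ht) (hj0 t ht))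
    rw [key]
    constructor
    · rintro ⟨hsol, γ, hγ⟩ t ht a
      rw [dlog_exp a (hG t ht), v.dlog_tau_div_root hu hv hτ hj ⟨t, ht⟩ a]
      exact v.partialD_eq_of_solution hsol hγ ⟨t, ht⟩ a
    · intro h
      have hsol := v.isSolution_of_partialD_eq hG fun t a => by
        rw [← v.dlog_tau_div_root hu hv hτ hj t a, ← h t t.2 a, dlog_exp a (hG t t.2)]
      exact ⟨hsol.1, _, hsol.2⟩

end
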